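/- Let $J \subset S^3$ be a (tame) knot with open tubular neighbourhood $\nu J$, so that the exterior $S^3 \setminus \nu J$ is compact with torus boundary, and let $\mu$ and $\lambda$ be the meridian of $J$ and the longitude of $J$ that is null-homologous in $S^3\setminus\nu J$. Let $N$ be the twisted $I$-bundle over the Klein bottle (with orientable total space), that is, $N = (S^1 \times S^1 \times [-1,1])/\bigl((z,w,t) \sim (-z,\bar w,-t)\bigr)$ with $S^1 \subset \mathbb{C}$, so that $\partial N$ is the torus $S^1 \times S^1 \times \{1\}$. On $\partial N$ let $\phi_0$ be the curve $w \mapsto [1,w,1]$ (the rational longitude of $N$, which is the fibre slope of the Seifert structure over the Möbius band) and let $\phi_1$ be the dual curve $z \mapsto [z,1,1]$ (the fibre slope of the Seifert structure over the disc with two cone points of order two). Let $h : \partial N \to \partial(S^3 \setminus \nu J)$ be a homeomorphism (for instance, an orientation-reversing one), let $X = (S^3 \setminus \nu J) \cup_h N$ be the space obtained by gluing along $h$, and let $$[h_*] = \begin{pmatrix} q & r \\ p & s \end{pmatrix}$$ be the matrix of $h_* : H_1(\partial N;\mathbb{Z}) \to H_1(\partial (S^3\setminus\nu J);\mathbb{Z})$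 in the bases $(\phi_0, \phi_1)$ and $(\lambda, \mu)$, i.e. $h_*(\phi_0) = q\lambda + p\mu$ and $h_*(\phi_1) = r\lambda + s\mu$. Then $|H_1(X;\mathbb{Z})| = 8$ if and only if $|p| = 2$. Moreover, if $|p| = 2$, then $$H_1(X;\mathbb{Z}) \cong \begin{cases} \mathbb{Z}/2\mathbb{Z} \oplus \mathbb{Z}/4\mathbb{Z} & \text{if } s \text{ is even},\\ \mathbb{Z}/8\mathbb{Z} & \text{if } s \text{ is odd}.\end{cases}$$ -/

import Mathlib

noncomputable section

namespace KleinGluing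

/-! ### First singular homology with integer coefficients -/

/-- The first singular homology group `H_1(Y; ℤ)`. -/
abbrev H1 (Y : Type) [TopologicalSpace Y] : ModuleCat.{0} ℤ :=
  ((AlgebraicTopology.singularHomologyFunctor (ModuleCat.{0} ℤ) 1).obj
    (ModuleCat.of ℤ ℤ)).obj (TopCat.of Y)

/-- The homomorphism `f_* : H_1(Y; ℤ) → H_1(Z; ℤ)` induced by a continuous map. -/
def H1.map {Y Z : Type} [TopologicalSpace Y] [TopologicalSpace Z] (f : C(Y, Z)) :
    H1 Y →ₗ[ℤ] H1 Z :=
  (((AlgebraicTopology.singularHomologyFunctor (ModuleCat.{0} ℤ) 1).obj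
    (ModuleCat.of ℤ ℤ)).map (TopCat.ofHom f)).hom

/-- `u` is a fundamental class (an orientation) of the circle: a generator of `H_1(S¹; ℤ)`.
The homology class of a closed curve `γ : S¹ → Y` is then `H1.map γ u`. -/
def IsFundamentalClass (u : H1 Circle) : Prop :=
  ∀ x : H1 Circle, ∃ n : ℤ, x = n • u

/-! ### Knots in the three-sphere, their exteriors, meridians and longitudes -/

/-- The three-sphere. -/
abbrev S3 : Type := Metric.sphere (0 : EuclideanSpace ℝ (Fin 4)) 1

/-- A parametrized open tubular neighbourhood `S¹ × ℂ → S³` of a knot `J : S¹ → S³`.  Knots that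
have one are embedded and tame; every smooth knot has one. -/
structure TubularNbhd (J : C(Circle, S3)) where
  toFun : Circle × ℂ → S3
  isOpenEmbedding : Topology.IsOpenEmbedding toFun
  core : ∀ z : Circle, toFun (z, 0) = J z

namespace TubularNbhd

variable {J : C(Circle, S3)} (τ : TubularNbhd J)

/-- The (compact) knot exterior `S³ ∖ νJ`, where `νJ` is the open solid torus that corresponds to
`S¹ ×` (open unit disc). -/
def exterior : Set S3 :=
  (τ.toFun '' {x : Circle × ℂ | ‖x.2‖ < 1})ᶜ

/-- The boundary torus of the exterior, which corresponds to `S¹ × S¹`. -/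
def bdry : Set τ.exterior :=
  {x | ∃ y : Circle × ℂ, ‖y.2‖ = 1 ∧ τ.toFun y = x}

/-- The inclusion of the boundary torus in the exterior. -/
def incl : C(τ.bdry, τ.exterior) :=
  ⟨Subtype.val, continuous_subtype_val⟩

/-- The parametrization of the boundary torus of the exterior by `S¹ × S¹`. -/
def param : C(Circle × Circle, τ.bdry) where
  toFun x := ⟨⟨τ.toFun (x.1, (x.2 : ℂ)), by
      rintro ⟨y, hy, hxy⟩
      have h := τ.isOpenEmbedding.injective hxy
      rw [h] at hy
      exact absurd (Circle.norm_coe x.2) (ne_of_lt hy)⟩,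
    (x.1, (x.2 : ℂ)), Circle.norm_coe x.2, rfl⟩
  continuous_toFun := by
    refine Continuous.subtype_mk (Continuous.subtype_mk ?_ _) _
    exact τ.isOpenEmbedding.continuous.comp (by fun_prop)

/-- The meridian of the knot: the boundary of a fibre disc of the tubular neighbourhood. -/
def meridian : C(Circle, τ.bdry) :=
  τ.param.comp ⟨fun w => (1, w), by fun_prop⟩

/-- The curves on the boundary torus parallel to the knot: the `n`-th one winds `n` times in the
meridian direction, relative to the given parametrization. -/
def parallel (n : ℤ) : C(Circle, τ.bdry) :=
  τ.param.comp ⟨fun z => (z, z ^ n), by fun_prop⟩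

/-- The `n`-th parallel is the (Seifert) longitude: it is null-homologous in the exterior. -/
def IsLongitude (n : ℤ) : Prop :=
  H1.map (τ.incl.comp (τ.parallel n)) = 0

end TubularNbhd

/-! ### The twisted `I`-bundle over the Klein bottle -/

/-- The free involution `(z, w, t) ↦ (-z, w̄, -t)` of `S¹ × S¹ × [-1, 1]`.  It preserves the
orientation, and on `S¹ × S¹ × {0}` its quotient is the Klein bottle. -/
def flip (x : Circle × Circle × Set.Icc (-1 : ℝ) 1) : Circle × Circle × Set.Icc (-1 : ℝ) 1 :=
  (-x.1, x.2.1⁻¹,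
    ⟨-x.2.2.1, neg_le_neg x.2.2.2.2, neg_le.mp x.2.2.2.1⟩)

/-- The twisted `I`-bundle over the Klein bottle (with orientable total space): the quotient of
`S¹ × S¹ × [-1, 1]` by the involution `flip`, which is an interval bundle, with coordinate `t`,
over the Klein bottle `S¹ × S¹ / (z, w) ∼ (-z, w̄)`. -/
def N : Type := Quot (fun x y : Circle × Circle × Set.Icc (-1 : ℝ) 1 => y = flip x)

instance : TopologicalSpace N :=
  inferInstanceAs (TopologicalSpace
    (Quot (fun x y : Circle × Circle × Set.Icc (-1 : ℝ) 1 => y = flip x)))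

/-- The quotient map onto `N`. -/
def N.mk : C(Circle × Circle × Set.Icc (-1 : ℝ) 1, N) :=
  ⟨Quot.mk _, continuous_quot_mk⟩

/-- The boundary torus of `N`: the points with `t = ±1`. -/
def N.bdry : Set N :=
  {x | ∃ y : Circle × Circle × Set.Icc (-1 : ℝ) 1, |(y.2.2 : ℝ)| = 1 ∧ N.mk y = x}

/-- The parametrization of the boundary torus of `N` by `S¹ × S¹`, as the points with `t = 1`. -/
def N.param : C(Circle × Circle, N.bdry) where
  toFun x := ⟨N.mk (x.1, x.2, ⟨1, by norm_num⟩), (x.1, x.2, ⟨1, by norm_num⟩), by simp, rfl⟩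
  continuous_toFun :=
    Continuous.subtype_mk (N.mk.continuous.comp (by fun_prop)) _

/-- The curve `φ₀` on `∂N`: the rational longitude of `N`, the fibre of the Seifert structure
`(z, w, t) ↦ (z, t)` of `N` over the Möbius band. -/
def N.phi0 : C(Circle, N.bdry) :=
  N.param.comp ⟨fun w => (1, w), by fun_prop⟩

/-- The curve `φ₁` on `∂N`, dual to `φ₀`: the regular fibre of the Seifert structure
`(z, w, t) ↦ (w, t)` of `N` over the disc with two cone points of order two. -/
def N.phi1 : C(Circle, N.bdry) :=
  N.param.comp ⟨fun z => (z, 1), by fun_prop⟩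

/-! ### Gluing -/

/-- The space `A ∪_h B`: the disjoint union of `A` and `B` with `t ∈ T ⊆ B` identified with
`h t ∈ S ⊆ A`. -/
def Glue {A B : Type} [TopologicalSpace A] [TopologicalSpace B] {S : Set A} {T : Set B}
    (h : T ≃ₜ S) : Type :=
  Quot (fun x y : A ⊕ B => ∃ t : T, x = Sum.inl (h t : A) ∧ y = Sum.inr (t : B))

instance {A B : Type} [TopologicalSpace A] [TopologicalSpace B] {S : Set A} {T : Set B}
    (h : T ≃ₜ S) : TopologicalSpace (Glue h) :=
  inferInstanceAs (TopologicalSpace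
    (Quot (fun x y : A ⊕ B => ∃ t : T, x = Sum.inl (h t : A) ∧ y = Sum.inr (t : B))))

/-- The map induced on first homology by a homeomorphism of the boundary tori. -/
def bdryMap {A B : Type} [TopologicalSpace A] [TopologicalSpace B] {S : Set A} {T : Set B}
    (h : T ≃ₜ S) : H1 T →ₗ[ℤ] H1 S :=
  H1.map ⟨h, h.continuous⟩

end KleinGluing

end

/-!
`H₁` is studied through its cocycles with coefficients in an abelian group: functions on paths whose
signed sum around every singular square vanishes. A cocycle on the knot exterior is determined up to
coboundaries by its value on the meridian: once that value vanishes, so does its value on the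
longitude, the cocycle extends over the solid torus, and `S³` is simply connected. A cocycle with
value `1` on the meridian arises by splitting, over the cover of `S³` by the exterior and the
neighbourhood, the winding cocycle of their overlap. On `N` the cocycles are given by the values `α`
and `β` on two loops with the single relation `2 β = 0`, and `φ₀`, `φ₁` take the values `β`, `2 α`.
Comparing along the gluing torus, where the longitude contributes nothing, forces `β = p m` and
`2 α = s m`. So `H₁(X)` is generated by `m` and `a` subject to `2 p m = 0` and `s m = 2 a`.
-/

open unitInterval

noncomputable section

namespace KleinGluing

/-! ### Path cocycles -/

section Cocycles

variable {X Y A B : Type*} [TopologicalSpace X] [TopologicalSpace Y]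
  [AddCommGroup A] [AddCommGroup B]

/-- The side `t = 0` of a singular square, as a path. -/
@[simps]
def bottomEdge (H : C(I × I, X)) : C(I, X) where
  toFun s := H (s, 0)

/-- The side `t = 1` of a singular square, as a path. -/
@[simps]
def topEdge (H : C(I × I, X)) : C(I, X) where
  toFun s := H (s, 1)

/-- The side `s = 0` of a singular square, as a path. -/
@[simps]
def leftEdge (H : C(I × I, X)) : C(I, X) where
  toFun t := H (0, t)

/-- The side `s = 1` of a singular square, as a path. -/
@[simps]
def rightEdge (H : C(I × I, X)) : C(I, X) where
  toFun t := H (1, t)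

/-- A one-cocycle on `S`, encoded as a function on all paths of `X` whose values matter only on the
paths in `S`.  Squares are used in place of triangles because they subdivide and multiply well. -/
structure IsCocycleOn (S : Set X) (c : C(I, X) → A) : Prop where
  const : ∀ x ∈ S, c (.const I x) = 0
  square : ∀ H : C(I × I, X), (∀ z, H z ∈ S) →
    c (bottomEdge H) + c (rightEdge H) = c (leftEdge H) + c (topEdge H)

/-- The coboundary of a function on points. -/
def coboundary (g : X → A) (γ : C(I, X)) : A := g (γ 1) - g (γ 0)

/-- A function on paths is a coboundary on `S` if along every path in `S` it is the increment of a
fixed function on points. -/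
def IsCoboundaryOn (S : Set X) (c : C(I, X) → A) : Prop :=
  ∃ g : X → A, ∀ γ : C(I, X), (∀ t, γ t ∈ S) → c γ = g (γ 1) - g (γ 0)

variable {S S' : Set X} {T : Set Y} {c d : C(I, X) → A}

namespace IsCocycleOn

lemma mono (h : IsCocycleOn S' c) (hS : S ⊆ S') : IsCocycleOn S c :=
  ⟨fun x hx => h.const x (hS hx), fun H hH => h.square H fun z => hS (hH z)⟩

lemma congr (hc : IsCocycleOn S c) (h : ∀ γ : C(I, X), (∀ t, γ t ∈ S) → d γ = c γ) :
    IsCocycleOn S d where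
  const x hx := by rw [h _ fun _ => hx, hc.const x hx]
  square H hH := by
    rw [h _ fun _ => hH _, h _ fun _ => hH _, h _ fun _ => hH _, h _ fun _ => hH _,
      hc.square H hH]

lemma zero (S : Set X) : IsCocycleOn S (0 : C(I, X) → A) :=
  ⟨fun _ _ => rfl, fun _ _ => rfl⟩

lemma add (hc : IsCocycleOn S c) (hd : IsCocycleOn S d) : IsCocycleOn S (c + d) where
  const x hx := by simp [hc.const x hx, hd.const x hx]
  square H hH := by
    simp only [Pi.add_apply]
    rw [add_add_add_comm, hc.square H hH, hd.square H hH, add_add_add_comm]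

lemma map (hc : IsCocycleOn S c) (φ : A →+ B) : IsCocycleOn S (fun γ => φ (c γ)) where
  const x hx := by simp [hc.const x hx]
  square H hH := by rw [← map_add, hc.square H hH, map_add]

lemma neg (hc : IsCocycleOn S c) : IsCocycleOn S (-c) :=
  hc.map (negAddMonoidHom : A →+ A)

lemma sub (hc : IsCocycleOn S c) (hd : IsCocycleOn S d) : IsCocycleOn S (c - d) := by
  rw [sub_eq_add_neg]
  exact hc.add hd.neg

lemma comp {c : C(I, Y) → A} (hc : IsCocycleOn T c) (f : C(X, Y)) (hf : ∀ x ∈ S, f x ∈ T) :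
    IsCocycleOn S (fun γ => c (f.comp γ)) where
  const x hx := hc.const _ (hf x hx)
  square H hH := hc.square (f.comp H) fun z => hf _ (hH z)

lemma comp_univ {c : C(I, Y) → A} (hc : IsCocycleOn Set.univ c) (f : C(X, Y)) :
    IsCocycleOn Set.univ (fun γ => c (f.comp γ)) :=
  hc.comp f fun _ _ => trivial

end IsCocycleOn

lemma isCocycleOn_coboundary (g : X → A) (S : Set X) : IsCocycleOn S (coboundary g) where
  const x _ := by simp [coboundary]
  square H _ := by simp [coboundary]

lemma isCoboundaryOn_coboundary (g : X → A) (S : Set X) : IsCoboundaryOn S (coboundary g) :=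
  ⟨g, fun _ _ => rfl⟩

namespace IsCoboundaryOn

lemma congr (hc : IsCoboundaryOn S c) (h : ∀ γ : C(I, X), (∀ t, γ t ∈ S) → d γ = c γ) :
    IsCoboundaryOn S d :=
  let ⟨g, hg⟩ := hc
  ⟨g, fun γ hγ => (h γ hγ).trans (hg γ hγ)⟩

lemma add (hc : IsCoboundaryOn S c) (hd : IsCoboundaryOn S d) : IsCoboundaryOn S (c + d) := by
  obtain ⟨g, hg⟩ := hc
  obtain ⟨g', hg'⟩ := hd
  refine ⟨g + g', fun γ hγ => ?_⟩
  simp only [Pi.add_apply, hg γ hγ, hg' γ hγ]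
  abel

lemma neg (hc : IsCoboundaryOn S c) : IsCoboundaryOn S (-c) := by
  obtain ⟨g, hg⟩ := hc
  refine ⟨-g, fun γ hγ => ?_⟩
  simp only [Pi.neg_apply, hg γ hγ]
  abel

lemma comp {c : C(I, Y) → A} (hc : IsCoboundaryOn T c) (f : C(X, Y)) (hf : ∀ x ∈ S, f x ∈ T) :
    IsCoboundaryOn S (fun γ => c (f.comp γ)) :=
  let ⟨g, hg⟩ := hc
  ⟨g ∘ f, fun γ hγ => hg (f.comp γ) fun t => hf _ (hγ t)⟩

lemma eq_zero_of_closed (hc : IsCoboundaryOn S c) {γ : C(I, X)} (hγ : ∀ t, γ t ∈ S)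
    (hloop : γ 0 = γ 1) : c γ = 0 := by
  obtain ⟨g, hg⟩ := hc
  rw [hg γ hγ, hloop, sub_self]

end IsCoboundaryOn

end Cocycles

/-! ### Cocycles and the first homology -/

section Homology

open CategoryTheory Simplicial

variable {Y Z : Type} [TopologicalSpace Y] [TopologicalSpace Z]
variable {A B : Type} [AddCommGroup A] [AddCommGroup B]

variable (Y) in
/-- The singular simplicial set of a space. -/
abbrev sing : SSet.{0} := TopCat.toSSet.obj (TopCat.of Y)

variable (Y) in
/-- The integral singular chain complex of a space. -/
abbrev chains : ChainComplex (ModuleCat.{0} ℤ) ℕ := (sing Y).chainComplex (ModuleCat.of ℤ ℤ)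

/-- The map of integral singular chain complexes induced by a continuous map. -/
abbrev chainsMap (f : C(Y, Z)) : chains Y ⟶ chains Z :=
  SSet.chainComplexMap (TopCat.toSSet.map (TopCat.ofHom f)) (ModuleCat.of ℤ ℤ)

/-- Paths are the singular one-simplices. -/
def pathEquiv : C(I, Y) ≃ (sing Y) _⦋1⦌ :=
  (stdSimplexHomeomorphUnitInterval.symm.continuousMapCongr (.refl Y)).trans
    (TopCat.toSSetObjEquiv (TopCat.of Y) (.op ⦋1⦌)).symm

/-- The `i`-th face of the standard triangle, as a path. -/
def face (i : Fin 3) : C(I, stdSimplex ℝ (Fin 3)) :=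
  ⟨fun t => stdSimplex.map i.succAbove (stdSimplexHomeomorphUnitInterval.symm t),
    (stdSimplex.continuous_map _).comp (Homeomorph.continuous _)⟩

lemma face_apply (i k : Fin 3) (t : I) :
    face i t k = (if i.succAbove 0 = k then 1 - (t : ℝ) else 0) +
      (if i.succAbove 1 = k then (t : ℝ) else 0) := by
  refine (FunOnFinite.linearMap_apply_apply ..).trans ?_
  rw [Finset.sum_filter, Fin.sum_univ_two]
  rfl

lemma δ_toSSetObjEquiv_symm (i : Fin 3) (x : C(stdSimplex ℝ (Fin 3), Y)) :
    (sing Y).δ i ((TopCat.toSSetObjEquiv (TopCat.of Y) (.op ⦋2⦌)).symm x) =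
      pathEquiv (x.comp (face i)) := by
  apply (TopCat.toSSetObjEquiv (TopCat.of Y) (.op ⦋1⦌)).injective
  ext s
  exact congrArg (fun r => x (stdSimplex.map i.succAbove r))
    (stdSimplexHomeomorphUnitInterval.symm_apply_apply s).symm

lemma δ_zero_pathEquiv (γ : C(I, Y)) :
    (sing Y).δ 0 (pathEquiv γ) = TopCat.toSSetObj₀Equiv.symm (γ 1) := by
  apply TopCat.toSSetObj₀Equiv.injective
  change γ (stdSimplexHomeomorphUnitInterval (stdSimplex.map (Fin.succAbove 0) default)) = γ 1
  rw [Subsingleton.elim default (stdSimplex.vertex 0), stdSimplex.map_vertex]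
  rfl

lemma δ_one_pathEquiv (γ : C(I, Y)) :
    (sing Y).δ 1 (pathEquiv γ) = TopCat.toSSetObj₀Equiv.symm (γ 0) := by
  apply TopCat.toSSetObj₀Equiv.injective
  change γ (stdSimplexHomeomorphUnitInterval (stdSimplex.map (Fin.succAbove 1) default)) = γ 0
  rw [Subsingleton.elim default (stdSimplex.vertex 0), stdSimplex.map_vertex]
  rfl

/-- A function on the `n`-simplices, extended linearly to the `n`-chains. -/
def linearExtension {K : SSet.{0}} {n : ℕ} (f : K _⦋n⦌ → A) :
    (K.chainComplex (ModuleCat.of ℤ ℤ)).X n ⟶ ModuleCat.of ℤ A :=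
  Limits.Sigma.desc fun x => ModuleCat.ofHom (LinearMap.toSpanSingleton ℤ A (f x))

lemma ιChainComplex_linearExtension {K : SSet.{0}} {n : ℕ} (f : K _⦋n⦌ → A) (x : K _⦋n⦌) :
    K.ιChainComplex (R := ModuleCat.of ℤ ℤ) x ≫ linearExtension f =
      ModuleCat.ofHom (LinearMap.toSpanSingleton ℤ A (f x)) :=
  Limits.Sigma.ι_desc _ x

/-- The class of a path in the one-chains modulo boundaries. -/
def pathClass (γ : C(I, Y)) : (chains Y).opcycles 1 :=
  ((sing Y).ιChainComplex (R := ModuleCat.of ℤ ℤ) (pathEquiv γ) ≫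
    (chains Y).pOpcycles 1).hom (1 : ℤ)

/-- A point as a zero-chain. -/
def pointChain (y : Y) : (chains Y).X 0 :=
  ((sing Y).ιChainComplex (R := ModuleCat.of ℤ ℤ) (TopCat.toSSetObj₀Equiv.symm y)).hom (1 : ℤ)

lemma fromOpcycles_pathClass (γ : C(I, Y)) :
    ((chains Y).fromOpcycles 1 0).hom (pathClass γ) = pointChain (γ 1) - pointChain (γ 0) := by
  have hd := (sing Y).ιChainComplex_d (R := ModuleCat.of ℤ ℤ) (pathEquiv γ)
  rw [Fin.sum_univ_two, δ_zero_pathEquiv, δ_one_pathEquiv] at hd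
  calc
    ((chains Y).fromOpcycles 1 0).hom (pathClass γ) =
        ((sing Y).ιChainComplex (R := ModuleCat.of ℤ ℤ) (pathEquiv γ) ≫
          (chains Y).d 1 0).hom (1 : ℤ) := by
      rw [← (chains Y).p_fromOpcycles 1 0]
      rfl
    _ = pointChain (γ 1) - pointChain (γ 0) := by
      rw [hd]
      simp [pointChain, sub_eq_add_neg]

lemma pathClass_face_one (x : C(stdSimplex ℝ (Fin 3), Y)) :
    pathClass (x.comp (face 1)) = pathClass (x.comp (face 2)) + pathClass (x.comp (face 0)) := by
  have h := congrArg (fun f => (f ≫ (chains Y).pOpcycles 1).hom (1 : ℤ))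
    ((sing Y).ιChainComplex_d (R := ModuleCat.of ℤ ℤ)
      ((TopCat.toSSetObjEquiv (TopCat.of Y) (.op ⦋2⦌)).symm x))
  simp only [Category.assoc, HomologicalComplex.d_pOpcycles, Limits.comp_zero] at h
  rw [Fin.sum_univ_three, δ_toSSetObjEquiv_symm, δ_toSSetObjEquiv_symm, δ_toSSetObjEquiv_symm] at h
  replace h : 0 = pathClass (x.comp (face 0)) - pathClass (x.comp (face 1)) +
      pathClass (x.comp (face 2)) := by
    simpa [pathClass, Preadditive.add_comp, sub_eq_add_neg] using h
  rw [← sub_eq_zero, ← neg_eq_zero]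
  refine Eq.trans ?_ h.symm
  abel

lemma opcyclesMap_pathClass (f : C(Y, Z)) (γ : C(I, Y)) :
    (HomologicalComplex.opcyclesMap (chainsMap f) 1).hom (pathClass γ) =
      pathClass (f.comp γ) := by
  have h : (sing Y).ιChainComplex (R := ModuleCat.of ℤ ℤ) (pathEquiv γ) ≫
      (chains Y).pOpcycles 1 ≫ HomologicalComplex.opcyclesMap (chainsMap f) 1 =
      (sing Z).ιChainComplex (R := ModuleCat.of ℤ ℤ) (pathEquiv (f.comp γ)) ≫
        (chains Z).pOpcycles 1 := by
    rw [HomologicalComplex.p_opcyclesMap, SSet.ι_chainComplexMap_f_assoc]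
    rfl
  exact congrArg (fun f => f.hom (1 : ℤ)) h

lemma opcycles_addMonoidHom_ext {φ ψ : (chains Y).opcycles 1 →+ A}
    (h : ∀ γ : C(I, Y), φ (pathClass γ) = ψ (pathClass γ)) : φ = ψ := by
  let toHom (χ : (chains Y).opcycles 1 →+ A) : (chains Y).opcycles 1 ⟶ ModuleCat.of ℤ A :=
    ModuleCat.ofHom { χ with map_smul' := fun n x =>
      (congrArg χ (int_smul_eq_zsmul _ n x)).trans (map_zsmul χ n x) }
  have : toHom φ = toHom ψ := by
    rw [← cancel_epi ((chains Y).pOpcycles 1)]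
    refine SSet.chainComplex_hom_ext fun x => ?_
    obtain ⟨γ, rfl⟩ := pathEquiv.surjective x
    ext
    exact h γ
  ext x
  exact congrArg (fun f => f.hom x) this

/-- The map of the square onto the triangle `0 ≤ y ≤ x ≤ 1` given by `(s, t) ↦ (s, s t)`, in
barycentric coordinates.  It collapses the left side to a vertex. -/
def squareToTriangle : C(I × I, stdSimplex ℝ (Fin 3)) where
  toFun z := ⟨![1 - z.1, z.1 * (1 - z.2), z.1 * z.2], by
    constructor
    · intro i
      fin_cases i
      · exact sub_nonneg.2 z.1.2.2
      · exact mul_nonneg z.1.2.1 (sub_nonneg.2 z.2.2.2)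
      · exact mul_nonneg z.1.2.1 z.2.2.1
    · simp only [Fin.sum_univ_three, Matrix.cons_val]
      ring⟩
  continuous_toFun := by
    refine Continuous.subtype_mk (continuous_pi fun i => ?_) _
    fin_cases i <;> dsimp <;> fun_prop

lemma IsCocycleOn.face_one {c : C(I, Y) → A} (hc : IsCocycleOn Set.univ c)
    (x : C(stdSimplex ℝ (Fin 3), Y)) :
    c (x.comp (face 1)) = c (x.comp (face 2)) + c (x.comp (face 0)) := by
  have happly (z : I × I) (k : Fin 3) :
      squareToTriangle z k = ![1 - (z.1 : ℝ), z.1 * (1 - z.2), z.1 * z.2] k := rfl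
  have hbottom : bottomEdge (x.comp squareToTriangle) = x.comp (face 2) := by
    ext t
    refine congrArg x (stdSimplex.ext (funext fun k => ?_))
    rw [happly, face_apply]
    fin_cases k <;> simp [Fin.succAbove]
  have htop : topEdge (x.comp squareToTriangle) = x.comp (face 1) := by
    ext t
    refine congrArg x (stdSimplex.ext (funext fun k => ?_))
    rw [happly, face_apply]
    fin_cases k <;> simp [Fin.succAbove]
  have hright : rightEdge (x.comp squareToTriangle) = x.comp (face 0) := by
    ext t
    refine congrArg x (stdSimplex.ext (funext fun k => ?_))
    rw [happly, face_apply]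
    fin_cases k <;> simp
  have hleft : leftEdge (x.comp squareToTriangle) = .const I (x (squareToTriangle (0, 0))) := by
    ext t
    refine congrArg x (stdSimplex.ext (funext fun k => ?_))
    fin_cases k <;> simp [happly]
  rw [← htop, ← hbottom, ← hright, hc.square _ fun _ => trivial, hleft, hc.const _ trivial,
    zero_add]

/-- The inclusion of the triangle in the square with vertices `(0, 0)`, `(1, 0)`, `(1, 1)`. -/
def triangleToSquare : C(stdSimplex ℝ (Fin 3), I × I) where
  toFun x := (⟨1 - x 0, by simp, by simp⟩, ⟨x 2, by simp, by simp⟩)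
  continuous_toFun := by
    have hcoord (k : Fin 3) : Continuous fun x : stdSimplex ℝ (Fin 3) => x k :=
      (continuous_apply k).comp continuous_subtype_val
    exact ((continuous_const.sub (hcoord 0)).subtype_mk _).prodMk ((hcoord 2).subtype_mk _)

lemma triangleToSquare_comp_face_zero :
    triangleToSquare.comp (face 0) = ⟨fun t => (1, t), by fun_prop⟩ := by
  ext t <;> simp [triangleToSquare, face_apply]

lemma triangleToSquare_comp_face_one :
    triangleToSquare.comp (face 1) = ⟨fun t => (t, t), by fun_prop⟩ := by
  ext t <;> simp [triangleToSquare, face_apply, Fin.succAbove]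

lemma triangleToSquare_comp_face_two :
    triangleToSquare.comp (face 2) = ⟨fun t => (t, 0), by fun_prop⟩ := by
  ext t <;> simp [triangleToSquare, face_apply, Fin.succAbove]

lemma isCocycleOn_univ_iff_face {c : C(I, Y) → A} :
    IsCocycleOn Set.univ c ↔ ∀ x : C(stdSimplex ℝ (Fin 3), Y),
      c (x.comp (face 1)) = c (x.comp (face 2)) + c (x.comp (face 0)) := by
  refine ⟨IsCocycleOn.face_one, fun hc => ⟨fun y _ => ?_, fun H _ => ?_⟩⟩
  · simpa using hc (.const _ y)
  · have hlower := hc (H.comp triangleToSquare)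
    have hupper := hc (H.comp (ContinuousMap.prodSwap.comp triangleToSquare))
    simp only [ContinuousMap.comp_assoc, triangleToSquare_comp_face_zero,
      triangleToSquare_comp_face_one, triangleToSquare_comp_face_two] at hlower hupper
    exact hlower.symm.trans hupper

lemma isCocycleOn_pathClass : IsCocycleOn Set.univ (pathClass (Y := Y)) :=
  isCocycleOn_univ_iff_face.2 pathClass_face_one

namespace IsCocycleOn

variable {c d : C(I, Y) → A}

lemma d_comp_linearExtension (hc : IsCocycleOn Set.univ c) :
    (chains Y).d 2 1 ≫ linearExtension (c ∘ pathEquiv.symm) = 0 := by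
  refine SSet.chainComplex_hom_ext fun x => ?_
  obtain ⟨x, rfl⟩ := (TopCat.toSSetObjEquiv (TopCat.of Y) (.op ⦋2⦌)).symm.surjective x
  rw [SSet.ιChainComplex_d_assoc, Fin.sum_univ_three, δ_toSSetObjEquiv_symm,
    δ_toSSetObjEquiv_symm, δ_toSSetObjEquiv_symm]
  ext
  simp only [Preadditive.add_comp, Linear.smul_comp, ιChainComplex_linearExtension]
  simp [hc.face_one]

/-- The homomorphism from the one-chains modulo boundaries that a cocycle defines. -/
def desc (hc : IsCocycleOn Set.univ c) : (chains Y).opcycles 1 →+ A :=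
  ((chains Y).descOpcycles _ 2 (by simp) hc.d_comp_linearExtension).hom.toAddMonoidHom

@[simp]
lemma desc_pathClass (hc : IsCocycleOn Set.univ c) (γ : C(I, Y)) :
    hc.desc (pathClass γ) = c γ := by
  have h := ιChainComplex_linearExtension (c ∘ pathEquiv.symm) (pathEquiv γ)
  rw [← (chains Y).p_descOpcycles _ 2 (by simp) hc.d_comp_linearExtension,
    ← Category.assoc, Function.comp_apply, Equiv.symm_apply_apply] at h
  exact (congrArg (fun f => f.hom (1 : ℤ)) h).trans (one_smul ℤ (c γ))

end IsCocycleOn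

lemma exists_pointChain_lift (g : Y → A) :
    ∃ φ : (chains Y).X 0 →+ A, ∀ y, φ (pointChain y) = g y := by
  refine ⟨(linearExtension (g ∘ TopCat.toSSetObj₀Equiv)).hom.toAddMonoidHom, fun y => ?_⟩
  have h := ιChainComplex_linearExtension (g ∘ TopCat.toSSetObj₀Equiv (X := TopCat.of Y))
    (TopCat.toSSetObj₀Equiv.symm y)
  rw [Function.comp_apply, Equiv.apply_symm_apply] at h
  exact (congrArg (fun f => f.hom (1 : ℤ)) h).trans (one_smul ℤ (g y))

namespace H1

variable (Y) in
/-- The inclusion of the first homology in the one-chains modulo boundaries. -/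
def ι : H1 Y →ₗ[ℤ] (chains Y).opcycles 1 :=
  ((chains Y).homologyι 1).hom

lemma ι_injective : Function.Injective (ι Y) :=
  (ModuleCat.mono_iff_injective ((chains Y).homologyι 1)).1 inferInstance

lemma exists_ι_eq {v : (chains Y).opcycles 1} (hv : ((chains Y).fromOpcycles 1 0).hom v = 0) :
    ∃ x : H1 Y, ι Y x = v := by
  let k : ModuleCat.of ℤ ℤ ⟶ (chains Y).opcycles 1 :=
    ModuleCat.ofHom (LinearMap.toSpanSingleton ℤ ((chains Y).opcycles 1) v)
  have hkv : k.hom (1 : ℤ) = v := LinearMap.toSpanSingleton_apply_one ℤ _ v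
  have hk : k ≫ (chains Y).fromOpcycles 1 0 = 0 := by
    ext
    exact (congrArg ((chains Y).fromOpcycles 1 0).hom hkv).trans hv
  obtain ⟨l, hl⟩ := Limits.KernelFork.IsLimit.lift'
    ((chains Y).homologyIsKernel 1 0 (by simp)) k hk
  exact ⟨l.hom (1 : ℤ), (congrArg (fun f => f.hom (1 : ℤ)) hl).trans hkv⟩

@[simp]
lemma fromOpcycles_ι (x : H1 Y) : ((chains Y).fromOpcycles 1 0).hom (ι Y x) = 0 :=
  congrArg (fun f => f.hom x) ((chains Y).homologyι_comp_fromOpcycles 1 0)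

lemma ι_map (f : C(Y, Z)) (x : H1 Y) :
    ι Z (H1.map f x) = (HomologicalComplex.opcyclesMap (chainsMap f) 1).hom (ι Y x) :=
  congrArg (fun f => f.hom x) (HomologicalComplex.homologyι_naturality (chainsMap f) 1)

end H1

namespace IsCocycleOn

variable {c d : C(I, Y) → A}

/-- The pairing of a cocycle with first homology. -/
def eval (hc : IsCocycleOn Set.univ c) : H1 Y →+ A :=
  hc.desc.comp (H1.ι Y).toAddMonoidHom

lemma eval_eq (hc : IsCocycleOn Set.univ c) {φ : (chains Y).opcycles 1 →+ A}
    (hφ : ∀ γ, φ (pathClass γ) = c γ) (x : H1 Y) : hc.eval x = φ (H1.ι Y x) := by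
  have : hc.desc = φ := opcycles_addMonoidHom_ext fun γ => by rw [hc.desc_pathClass, hφ]
  exact DFunLike.congr_fun this (H1.ι Y x)

lemma eval_map {c : C(I, Z) → A} (hc : IsCocycleOn Set.univ c) (f : C(Y, Z)) (x : H1 Y) :
    hc.eval (H1.map f x) = (hc.comp_univ f).eval x := by
  rw [(hc.comp_univ f).eval_eq (φ := hc.desc.comp
    (HomologicalComplex.opcyclesMap (chainsMap f) 1).hom.toAddMonoidHom) fun γ => ?_]
  · exact congrArg hc.desc (H1.ι_map f x)
  · exact (congrArg hc.desc (opcyclesMap_pathClass f γ)).trans (hc.desc_pathClass _)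

lemma eval_add (hc : IsCocycleOn Set.univ c) (hd : IsCocycleOn Set.univ d) (x : H1 Y) :
    (hc.add hd).eval x = hc.eval x + hd.eval x :=
  (hc.add hd).eval_eq (φ := hc.desc + hd.desc) (fun γ => by simp) x

lemma eval_hom (hc : IsCocycleOn Set.univ c) (ψ : A →+ B) (x : H1 Y) :
    (hc.map ψ).eval x = ψ (hc.eval x) :=
  (hc.map ψ).eval_eq (φ := ψ.comp hc.desc) (fun γ => by simp) x

lemma eval_eq_zero (hc : IsCocycleOn Set.univ c) (h : IsCoboundaryOn Set.univ c) (x : H1 Y) :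
    hc.eval x = 0 := by
  obtain ⟨g, hg⟩ := h
  obtain ⟨φ, hφ⟩ := exists_pointChain_lift g
  rw [hc.eval_eq (φ := φ.comp ((chains Y).fromOpcycles 1 0).hom.toAddMonoidHom) fun γ => ?_]
  · simp
  · simp [fromOpcycles_pathClass, hφ, hg γ fun _ => trivial]

lemma eval_congr (hc : IsCocycleOn Set.univ c) (hd : IsCocycleOn Set.univ d)
    (h : IsCoboundaryOn Set.univ (c - d)) (x : H1 Y) : hc.eval x = hd.eval x := by
  have : hc.eval x = (hd.add (hc.sub hd)).eval x := by congr 2; abel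
  rw [this, hd.eval_add (hc.sub hd), (hc.sub hd).eval_eq_zero h, add_zero]

end IsCocycleOn

lemma exists_ι_eq_pathClass (γ : C(I, Y)) (hγ : γ 0 = γ 1) : ∃ x, H1.ι Y x = pathClass γ :=
  H1.exists_ι_eq (by rw [fromOpcycles_pathClass, hγ, sub_self])

/-- The homology class of a closed path. -/
def loopClass (γ : C(I, Y)) (hγ : γ 0 = γ 1) : H1 Y :=
  (exists_ι_eq_pathClass γ hγ).choose

@[simp]
lemma IsCocycleOn.eval_loopClass {c : C(I, Y) → A} (hc : IsCocycleOn Set.univ c) (γ : C(I, Y))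
    (hγ : γ 0 = γ 1) : hc.eval (loopClass γ hγ) = c γ :=
  (congrArg hc.desc (exists_ι_eq_pathClass γ hγ).choose_spec).trans (hc.desc_pathClass γ)

variable (Y) in
/-- Joining each point to a base point of its path component makes every path a cycle. -/
lemma exists_ι_eq_pathClass_add : ∃ (p : Y → (chains Y).opcycles 1) (e : C(I, Y) → H1 Y),
    ∀ γ, H1.ι Y (e γ) = pathClass γ + p (γ 0) - p (γ 1) := by
  let base (y : Y) : Y := Quotient.out (Quotient.mk (pathSetoid Y) y)
  have hjoined (y : Y) : Joined (base y) y := Quotient.mk_out (s := pathSetoid Y) y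
  have hbase (γ : C(I, Y)) : base (γ 0) = base (γ 1) :=
    congrArg Quotient.out (Quotient.sound (s := pathSetoid Y) ⟨⟨γ, rfl, rfl⟩⟩)
  let p (y : Y) : (chains Y).opcycles 1 := pathClass (hjoined y).somePath.toContinuousMap
  have hp (y : Y) :
      ((chains Y).fromOpcycles 1 0).hom (p y) = pointChain y - pointChain (base y) := by
    simp [p, fromOpcycles_pathClass]
  have he (γ : C(I, Y)) : ∃ x : H1 Y, H1.ι Y x = pathClass γ + p (γ 0) - p (γ 1) := by
    apply H1.exists_ι_eq
    rw [map_sub, map_add, hp, hp, fromOpcycles_pathClass, hbase]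
    abel
  choose e he using he
  exact ⟨p, e, he⟩

variable (Y) in
lemma exists_universalCocycle :
    ∃ (e : C(I, Y) → H1 Y) (he : IsCocycleOn Set.univ e), ∀ x, he.eval x = x := by
  obtain ⟨p, e, he⟩ := exists_ι_eq_pathClass_add Y
  have hcongr : H1.ι Y ∘ e = pathClass - coboundary p := by
    ext γ
    simp only [Function.comp_apply, he, Pi.sub_apply, coboundary]
    abel
  have hι : IsCocycleOn Set.univ (H1.ι Y ∘ e) := by
    rw [hcongr]
    exact isCocycleOn_pathClass.sub (isCocycleOn_coboundary p _)
  have hcocycle : IsCocycleOn Set.univ e :=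
    ⟨fun y hy => H1.ι_injective (by simpa using hι.const y hy),
      fun H hH => H1.ι_injective (by simpa using hι.square H hH)⟩
  refine ⟨e, hcocycle, fun x => H1.ι_injective ?_⟩
  calc
    H1.ι Y (hcocycle.eval x) = hι.eval x := (hcocycle.eval_hom (H1.ι Y).toAddMonoidHom x).symm
    _ = isCocycleOn_pathClass.eval x := by
      refine IsCocycleOn.eval_congr _ _ ?_ x
      rw [hcongr, sub_sub_cancel_left]
      exact (isCoboundaryOn_coboundary p _).neg
    _ = H1.ι Y x := isCocycleOn_pathClass.eval_eq (φ := .id _) (fun _ => rfl) x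

lemma exists_eval_eq (ψ : H1 Y →+ A) :
    ∃ (c : C(I, Y) → A) (hc : IsCocycleOn Set.univ c), ∀ x, hc.eval x = ψ x := by
  obtain ⟨e, he, hid⟩ := exists_universalCocycle Y
  exact ⟨_, he.map ψ, fun x => by rw [he.eval_hom, hid]⟩

end Homology

/-! ### Subdivision and gluing -/

section Subdivision

variable {X ι A : Type*} [TopologicalSpace X] [AddCommGroup A]

/-- The affine maps of the unit interval onto its two halves, the upper one for `true`. -/
def half (b : Bool) : C(I, I) where
  toFun t := ⟨((if b then 1 else 0) + t) / 2, by
    have := t.2.1; split_ifs <;> positivity, by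
    have := t.2.2; split_ifs <;> linarith⟩
  continuous_toFun := by fun_prop

lemma half_coe (b : Bool) (t : I) : (half b t : ℝ) = ((if b then 1 else 0) + t) / 2 := rfl

@[simp] lemma half_false_zero : half false 0 = 0 := by ext; simp [half_coe]
@[simp] lemma half_true_one : half true 1 = 1 := by ext; simp [half_coe]
lemma half_false_one : half false 1 = half true 0 := by ext; simp [half_coe]

lemma dist_half (b : Bool) (s t : I) : dist (half b s) (half b t) = dist s t / 2 := by
  simp only [Subtype.dist_eq, half_coe, Real.dist_eq, ← sub_div, add_sub_add_left_eq_sub, abs_div,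
    abs_two]

lemma IsCocycleOn.eq_half_add_half {S : Set X} {c : C(I, X) → A} (hc : IsCocycleOn S c)
    {γ : C(I, X)} (hγ : ∀ t, γ t ∈ S) :
    c γ = c (γ.comp (half false)) + c (γ.comp (half true)) := by
  -- The square `(s, t) ↦ γ (s (1 + t) / 2)` has sides `γ`, its two halves and a constant path.
  let H : C(I × I, X) := γ.comp ⟨fun z => ⟨z.1 * (1 + z.2) / 2, by
    have := z.1.2.1; have := z.2.2.1; positivity, by
    have := z.1.2.2; have := z.2.2.2; have := z.1.2.1; have := z.2.2.1; nlinarith⟩, by fun_prop⟩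
  have hbottom : bottomEdge H = γ.comp (half false) := by
    ext t; exact congrArg γ (Subtype.ext (by simp [half_coe]))
  have hright : rightEdge H = γ.comp (half true) := by
    ext t; exact congrArg γ (Subtype.ext (by simp [half_coe]))
  have hleft : leftEdge H = .const I (γ 0) := by
    ext t; exact congrArg γ (Subtype.ext (by simp))
  have htop : topEdge H = γ := by
    ext t; exact congrArg γ (Subtype.ext (by simp; ring))
  rw [← hbottom, ← hright, hc.square H fun _ => hγ _, hleft, htop, hc.const _ (hγ 0), zero_add]

/-- The affine maps of the unit square onto its four quarters. -/
def quarter (a b : Bool) : C(I × I, I × I) := (half a).prodMap (half b)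

lemma dist_quarter (a b : Bool) (z w : I × I) :
    dist (quarter a b z) (quarter a b w) = dist z w / 2 := by
  simp only [quarter, ContinuousMap.prodMap_apply, Prod.dist_eq, Prod.map_fst, Prod.map_snd,
    dist_half]
  exact max_div_div_right zero_le_two _ _

lemma bottomEdge_quarter (H : C(I × I, X)) (a : Bool) :
    bottomEdge (H.comp (quarter a false)) = (bottomEdge H).comp (half a) := by
  ext t; simp [quarter]

lemma topEdge_quarter (H : C(I × I, X)) (a : Bool) :
    topEdge (H.comp (quarter a true)) = (topEdge H).comp (half a) := by
  ext t; simp [quarter]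

lemma leftEdge_quarter (H : C(I × I, X)) (b : Bool) :
    leftEdge (H.comp (quarter false b)) = (leftEdge H).comp (half b) := by
  ext t; simp [quarter]

lemma rightEdge_quarter (H : C(I × I, X)) (b : Bool) :
    rightEdge (H.comp (quarter true b)) = (rightEdge H).comp (half b) := by
  ext t; simp [quarter]

lemma topEdge_quarter_false (H : C(I × I, X)) (a : Bool) :
    topEdge (H.comp (quarter a false)) = bottomEdge (H.comp (quarter a true)) := by
  ext t; simp [quarter, half_false_one]

lemma rightEdge_quarter_false (H : C(I × I, X)) (b : Bool) :
    rightEdge (H.comp (quarter false b)) = leftEdge (H.comp (quarter true b)) := by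
  ext t; simp [quarter, half_false_one]

/-- The sum of a function over the pieces of the `n`-th dyadic subdivision of a path. -/
def subdividedSum (c : C(I, X) → A) : ℕ → C(I, X) → A
  | 0 => c
  | n + 1 => fun γ =>
    subdividedSum c n (γ.comp (half false)) + subdividedSum c n (γ.comp (half true))

/-- Each piece of the `n`-th dyadic subdivision of the path lies in a member of the family. -/
def FinePath (U : ι → Set X) : ℕ → C(I, X) → Prop
  | 0 => fun γ => ∃ i, ∀ t, γ t ∈ U i
  | n + 1 => fun γ => ∀ b, FinePath U n (γ.comp (half b))

/-- Each piece of the `n`-th dyadic subdivision of the square lies in a member of the family. -/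
def FineSquare (U : ι → Set X) : ℕ → C(I × I, X) → Prop
  | 0 => fun H => ∃ i, ∀ z, H z ∈ U i
  | n + 1 => fun H => ∀ a b, FineSquare U n (H.comp (quarter a b))

variable {U : ι → Set X} {c : C(I, X) → A} {n : ℕ}

lemma fineSquare_comp_of_dist_le {H : C(I × I, X)} {δ : ℝ}
    (hball : ∀ z, ∃ i, Metric.ball z δ ⊆ H ⁻¹' U i) {L : ℝ} (hL₀ : 0 ≤ L) (hL : L < δ * 2 ^ n)
    {φ : C(I × I, I × I)} (hφ : ∀ z w, dist (φ z) (φ w) ≤ L * dist z w) :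
    FineSquare U n (H.comp φ) := by
  induction n generalizing L φ with
  | zero =>
    obtain ⟨i, hi⟩ := hball (φ 0)
    have hdist (s t : I) : dist s t ≤ 1 := by
      rw [Subtype.dist_eq, Real.dist_eq, abs_le]
      constructor <;> linarith [s.2.1, s.2.2, t.2.1, t.2.2]
    refine ⟨i, fun z => hi ?_⟩
    rw [Metric.mem_ball]
    calc
      dist (φ z) (φ 0) ≤ L * dist z 0 := hφ z 0
      _ ≤ L * 1 := by gcongr; exact max_le (hdist _ _) (hdist _ _)
      _ < δ := by simpa using hL
  | succ n ih =>
    intro a b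
    refine ih (L := L / 2) (by positivity) (by rw [pow_succ] at hL; linarith)
      (φ := φ.comp (quarter a b)) fun z w => (hφ _ _).trans_eq ?_
    rw [dist_quarter]
    ring

lemma exists_fineSquare (hU : ∀ i, IsOpen (U i)) (H : C(I × I, X)) (hH : ∀ z, H z ∈ ⋃ i, U i) :
    ∃ n, FineSquare U n H := by
  obtain ⟨δ, hδ, hball⟩ := lebesgue_number_lemma_of_metric (s := (Set.univ : Set (I × I)))
    isCompact_univ (fun i => (hU i).preimage H.continuous)
    (fun z _ => Set.preimage_iUnion ▸ hH z)
  obtain ⟨n, hn⟩ := pow_unbounded_of_one_lt (1 / δ) (one_lt_two : (1 : ℝ) < 2)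
  rw [div_lt_iff₀' hδ] at hn
  exact ⟨n, fineSquare_comp_of_dist_le (fun z => hball z trivial) zero_le_one hn (φ := .id _)
    fun z w => by simp⟩

lemma FineSquare.edges {H : C(I × I, X)} (h : FineSquare U n H) :
    FinePath U n (bottomEdge H) ∧ FinePath U n (topEdge H) ∧ FinePath U n (leftEdge H) ∧
      FinePath U n (rightEdge H) := by
  induction n generalizing H with
  | zero =>
    obtain ⟨i, hi⟩ := h
    exact ⟨⟨i, fun _ => hi _⟩, ⟨i, fun _ => hi _⟩, ⟨i, fun _ => hi _⟩, ⟨i, fun _ => hi _⟩⟩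
  | succ n ih =>
    exact ⟨fun b => bottomEdge_quarter H b ▸ (ih (h b false)).1,
      fun b => topEdge_quarter H b ▸ (ih (h b true)).2.1,
      fun b => leftEdge_quarter H b ▸ (ih (h false b)).2.2.1,
      fun b => rightEdge_quarter H b ▸ (ih (h true b)).2.2.2⟩

lemma exists_finePath (hU : ∀ i, IsOpen (U i)) (γ : C(I, X)) (hγ : ∀ t, γ t ∈ ⋃ i, U i) :
    ∃ n, FinePath U n γ := by
  obtain ⟨n, hn⟩ := exists_fineSquare hU (γ.comp .fst) fun z => hγ _
  exact ⟨n, hn.edges.1⟩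

lemma FinePath.succ {γ : C(I, X)} (h : FinePath U n γ) : FinePath U (n + 1) γ := by
  induction n generalizing γ with
  | zero => exact fun b => h.imp fun _ h _ => h _
  | succ n ih => exact fun b => ih (h b)

lemma FinePath.subdividedSum_succ {γ : C(I, X)} (h : FinePath U n γ)
    (hc : ∀ i, IsCocycleOn (U i) c) : subdividedSum c (n + 1) γ = subdividedSum c n γ := by
  induction n generalizing γ with
  | zero =>
    obtain ⟨i, hi⟩ := h
    exact ((hc i).eq_half_add_half hi).symm
  | succ n ih =>
    change subdividedSum c (n + 1) _ + subdividedSum c (n + 1) _ = _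
    rw [ih (h _), ih (h _)]
    rfl

lemma FinePath.subdividedSum_add {γ : C(I, X)} (h : FinePath U n γ)
    (hc : ∀ i, IsCocycleOn (U i) c) (k : ℕ) :
    FinePath U (n + k) γ ∧ subdividedSum c (n + k) γ = subdividedSum c n γ := by
  induction k with
  | zero => exact ⟨h, rfl⟩
  | succ k ih => exact ⟨ih.1.succ, (ih.1.subdividedSum_succ hc).trans ih.2⟩

lemma FineSquare.subdividedSum_square {H : C(I × I, X)} (h : FineSquare U n H)
    (hc : ∀ i, IsCocycleOn (U i) c) :
    subdividedSum c n (bottomEdge H) + subdividedSum c n (rightEdge H) =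
      subdividedSum c n (leftEdge H) + subdividedSum c n (topEdge H) := by
  induction n generalizing H with
  | zero =>
    obtain ⟨i, hi⟩ := h
    exact (hc i).square H hi
  | succ n ih =>
    have h₀₀ := ih (h false false)
    have h₀₁ := ih (h false true)
    have h₁₀ := ih (h true false)
    have h₁₁ := ih (h true true)
    rw [bottomEdge_quarter, rightEdge_quarter_false, leftEdge_quarter, topEdge_quarter_false]
      at h₀₀
    rw [rightEdge_quarter_false, leftEdge_quarter, topEdge_quarter] at h₀₁
    rw [bottomEdge_quarter, rightEdge_quarter, topEdge_quarter_false] at h₁₀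
    rw [rightEdge_quarter, topEdge_quarter] at h₁₁
    simp only [subdividedSum]
    grind

lemma exists_isCocycleOn_iUnion (hU : ∀ i, IsOpen (U i)) (hc : ∀ i, IsCocycleOn (U i) c) :
    ∃ d : C(I, X) → A, IsCocycleOn (⋃ i, U i) d ∧ ∀ i γ, (∀ t, γ t ∈ U i) → d γ = c γ := by
  classical
  let d (γ : C(I, X)) : A := if h : ∃ n, FinePath U n γ then subdividedSum c h.choose γ else 0
  have hd {γ : C(I, X)} {n : ℕ} (h : FinePath U n γ) : d γ = subdividedSum c n γ := by
    have h' : ∃ n, FinePath U n γ := ⟨n, h⟩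
    simp only [d, dif_pos h']
    rw [← (h'.choose_spec.subdividedSum_add hc n).2, ← (h.subdividedSum_add hc h'.choose).2,
      add_comm]
  have hdU (i) (γ : C(I, X)) (hγ : ∀ t, γ t ∈ U i) : d γ = c γ := hd (n := 0) ⟨i, hγ⟩
  refine ⟨d, ⟨fun x hx => ?_, fun H hH => ?_⟩, hdU⟩
  · obtain ⟨i, hi⟩ := Set.mem_iUnion.1 hx
    rw [hdU i _ fun _ => hi, (hc i).const x hi]
  · obtain ⟨n, hn⟩ := exists_fineSquare hU H hH
    obtain ⟨hbottom, htop, hleft, hright⟩ := hn.edges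
    rw [hd hbottom, hd htop, hd hleft, hd hright, hn.subdividedSum_square hc]

lemma IsCocycleOn.eq_zero_of_iUnion (hU : ∀ i, IsOpen (U i)) (hc : IsCocycleOn (⋃ i, U i) c)
    (hcU : ∀ i γ, (∀ t, γ t ∈ U i) → c γ = 0) (γ : C(I, X)) (hγ : ∀ t, γ t ∈ ⋃ i, U i) :
    c γ = 0 := by
  obtain ⟨n, hn⟩ := exists_finePath hU γ hγ
  induction n generalizing γ with
  | zero =>
    obtain ⟨i, hi⟩ := hn
    exact hcU i γ hi
  | succ n ih =>
    rw [hc.eq_half_add_half hγ, ih (γ.comp (half false)) (fun _ => hγ _) (hn _),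
      ih (γ.comp (half true)) (fun _ => hγ _) (hn _), add_zero]

end Subdivision

section Union

variable {X A : Type*} [TopologicalSpace X] [AddCommGroup A] {U V : Set X} {c d : C(I, X) → A}

lemma exists_isCocycleOn_union (hU : IsOpen U) (hV : IsOpen V) (hc : IsCocycleOn U c)
    (hd : IsCocycleOn V d) (h : ∀ γ : C(I, X), (∀ t, γ t ∈ U ∩ V) → c γ = d γ) :
    ∃ e : C(I, X) → A, IsCocycleOn (U ∪ V) e ∧ (∀ γ, (∀ t, γ t ∈ U) → e γ = c γ) ∧
      ∀ γ, (∀ t, γ t ∈ V) → e γ = d γ := by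
  classical
  let f (γ : C(I, X)) : A := if ∀ t, γ t ∈ U then c γ else d γ
  have hfU (γ : C(I, X)) (hγ : ∀ t, γ t ∈ U) : f γ = c γ := if_pos hγ
  have hfV (γ : C(I, X)) (hγ : ∀ t, γ t ∈ V) : f γ = d γ := by
    simp only [f]
    split_ifs with hU
    · exact h γ fun t => ⟨hU t, hγ t⟩
    · rfl
  obtain ⟨e, he, hef⟩ := exists_isCocycleOn_iUnion (U := (cond · U V)) (c := f)
    (Bool.forall_bool.2 ⟨hV, hU⟩) (Bool.forall_bool.2 ⟨hd.congr hfV, hc.congr hfU⟩)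
  rw [← Set.union_eq_iUnion] at he
  exact ⟨e, he, fun γ hγ => (hef true γ hγ).trans (hfU γ hγ),
    fun γ hγ => (hef false γ hγ).trans (hfV γ hγ)⟩

lemma exists_continuousMap_of_joinedIn {W : Set X} {x y : X} (h : JoinedIn W x y) :
    ∃ γ : C(I, X), γ 0 = x ∧ γ 1 = y ∧ ∀ t, γ t ∈ W :=
  ⟨h.somePath, h.somePath.source, h.somePath.target, h.somePath_mem⟩

lemma exists_primitives_eq_add_const {W : Set X} (hW : ∀ x ∈ W, ∀ y ∈ W, JoinedIn W x y)
    {f g : X → A} (hf : ∀ γ : C(I, X), (∀ t, γ t ∈ W) → c γ = f (γ 1) - f (γ 0))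
    (hg : ∀ γ : C(I, X), (∀ t, γ t ∈ W) → c γ = g (γ 1) - g (γ 0)) :
    ∃ a : A, ∀ x ∈ W, f x = g x + a := by
  rcases W.eq_empty_or_nonempty with rfl | ⟨x₀, hx₀⟩
  · exact ⟨0, fun x hx => hx.elim⟩
  · refine ⟨f x₀ - g x₀, fun x hx => ?_⟩
    obtain ⟨γ, hγ₀, hγ₁, hγ⟩ := exists_continuousMap_of_joinedIn (hW x₀ hx₀ x hx)
    have h := (hf γ hγ).symm.trans (hg γ hγ)
    rw [hγ₀, hγ₁] at h
    grind

lemma IsCocycleOn.isCoboundaryOn_union (hU : IsOpen U) (hV : IsOpen V)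
    (hUV : ∀ x ∈ U ∩ V, ∀ y ∈ U ∩ V, JoinedIn (U ∩ V) x y) (hc : IsCocycleOn (U ∪ V) c)
    (hcU : IsCoboundaryOn U c) (hcV : IsCoboundaryOn V c) : IsCoboundaryOn (U ∪ V) c := by
  classical
  obtain ⟨f, hf⟩ := hcU
  obtain ⟨g, hg⟩ := hcV
  obtain ⟨a, ha⟩ := exists_primitives_eq_add_const hUV (fun γ hγ => hf γ fun t => (hγ t).1)
    fun γ hγ => hg γ fun t => (hγ t).2
  let k (x : X) : A := if x ∈ U then f x else g x + a
  have hkU (x : X) (hx : x ∈ U) : k x = f x := if_pos hx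
  have hkV (x : X) (hx : x ∈ V) : k x = g x + a := by
    simp only [k]
    split_ifs with h
    · exact ha x ⟨h, hx⟩
    · rfl
  have hdiff := hc.sub (isCocycleOn_coboundary k (U ∪ V))
  rw [Set.union_eq_iUnion] at hdiff ⊢
  have hzero := hdiff.eq_zero_of_iUnion (Bool.forall_bool.2 ⟨hV, hU⟩) (Bool.forall_bool.2
    ⟨fun γ hγ => by simp [coboundary, hg γ hγ, hkV _ (hγ _)],
      fun γ hγ => by simp [coboundary, hf γ hγ, hkU _ (hγ _)]⟩)
  exact ⟨k, fun γ hγ => sub_eq_zero.1 (hzero γ hγ)⟩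

end Union

section Vanishing

variable {X Y A : Type*} [TopologicalSpace X] [TopologicalSpace Y] [AddCommGroup A]

section Convex

variable {E : Type*} [AddCommGroup E] [Module ℝ E] [TopologicalSpace E] [ContinuousAdd E]
  [ContinuousSMul ℝ E] {S : Set E} {c : C(I, E) → A}

lemma IsCocycleOn.isCoboundaryOn_starConvex {x₀ : E} (hS : StarConvex ℝ x₀ S)
    (hc : IsCocycleOn S c) : IsCoboundaryOn S c := by
  let cone (γ : C(I, E)) : C(I × I, E) :=
    ⟨fun z => (1 - (z.2 : ℝ)) • x₀ + (z.2 : ℝ) • γ z.1, by fun_prop⟩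
  let segment (x : E) : C(I, E) := ⟨fun t => (1 - (t : ℝ)) • x₀ + (t : ℝ) • x, by fun_prop⟩
  refine ⟨fun x => c (segment x), fun γ hγ => ?_⟩
  have h := hc.square (cone γ) fun z => hS (hγ _) (sub_nonneg.2 z.2.2.2) z.2.2.1 (by ring)
  have hbottom : bottomEdge (cone γ) = .const I x₀ := by ext t; simp [cone]
  have htop : topEdge (cone γ) = γ := by ext t; simp [cone]
  have hx₀ : x₀ ∈ S := by simpa using hS (hγ 0) zero_le_one le_rfl (by ring)
  rw [hbottom, htop, hc.const _ hx₀, zero_add] at h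
  exact eq_sub_of_add_eq' h.symm

lemma IsCocycleOn.isCoboundaryOn_convex (hS : Convex ℝ S) (hc : IsCocycleOn S c) :
    IsCoboundaryOn S c := by
  rcases S.eq_empty_or_nonempty with rfl | ⟨x, hx⟩
  · exact ⟨0, fun γ hγ => (hγ 0).elim⟩
  · exact hc.isCoboundaryOn_starConvex (hS hx)

end Convex

lemma IsCoboundaryOn.of_section {S : Set X} {T : Set Y} {c : C(I, X) → A} (ψ : C(Y, X))
    (φ : X → Y) (hφ : ContinuousOn φ S) (hST : Set.MapsTo φ S T) (h : ∀ x ∈ S, ψ (φ x) = x)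
    (hc : IsCoboundaryOn T fun γ => c (ψ.comp γ)) : IsCoboundaryOn S c := by
  obtain ⟨g, hg⟩ := hc
  refine ⟨g ∘ φ, fun γ hγ => ?_⟩
  let γ' : C(I, Y) := ⟨fun t => φ (γ t), hφ.comp_continuous γ.continuous hγ⟩
  have hγ' : ψ.comp γ' = γ := ContinuousMap.ext fun t => h _ (hγ t)
  exact (congrArg c hγ').symm.trans (hg γ' fun t => hST (hγ t))

section Prod

variable {S : Set X} {T : Set Y} {c : C(I, X × Y) → A}

lemma IsCocycleOn.prodMk_eq_add (hc : IsCocycleOn (S ×ˢ T) c) {α : C(I, X)} {β : C(I, Y)}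
    (hα : ∀ t, α t ∈ S) (hβ : ∀ t, β t ∈ T) :
    c (α.prodMk β) =
      c (α.prodMk (.const I (β 0))) + c ((ContinuousMap.const I (α 1)).prodMk β) := by
  have h := hc.square ⟨fun z => (α z.1, β (z.1 * z.2)), by fun_prop⟩ fun z => ⟨hα _, hβ _⟩
  have hconst := hc.const (α 0, β 0) ⟨hα 0, hβ 0⟩
  rw [← zero_add (c (α.prodMk β)), ← hconst]
  convert h.symm using 3 <;> ext t <;> simp

lemma IsCocycleOn.prod_square (hc : IsCocycleOn (S ×ˢ T) c) {α : C(I, X)} {β : C(I, Y)}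
    (hα : ∀ t, α t ∈ S) (hβ : ∀ t, β t ∈ T) :
    c (α.prodMk (.const I (β 0))) + c ((ContinuousMap.const I (α 1)).prodMk β) =
      c ((ContinuousMap.const I (α 0)).prodMk β) + c (α.prodMk (.const I (β 1))) :=
  hc.square (α.prodMap β) fun _ => ⟨hα _, hβ _⟩

lemma IsCocycleOn.isCoboundaryOn_prod (hc : IsCocycleOn (S ×ˢ T) c) {y₀ : Y}
    (hT : ∀ y ∈ T, JoinedIn T y₀ y)
    (hX : IsCoboundaryOn S fun γ => c (γ.prodMk (.const I y₀)))
    (hY : ∀ x ∈ S, IsCoboundaryOn T fun γ => c ((ContinuousMap.const I x).prodMk γ)) :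
    IsCoboundaryOn (S ×ˢ T) c := by
  obtain ⟨g, hg⟩ := hX
  have hY' : ∀ x : X, ∃ f : Y → A, x ∈ S → ∀ γ : C(I, Y), (∀ t, γ t ∈ T) →
      c ((ContinuousMap.const I x).prodMk γ) = f (γ 1) - f (γ 0) := fun x => by
    by_cases hx : x ∈ S
    · exact (hY x hx).imp fun f hf _ => hf
    · exact ⟨0, fun h => (hx h).elim⟩
  choose f hf using hY'
  refine ⟨fun z => g z.1 + (f z.1 z.2 - f z.1 y₀), fun γ hγ => ?_⟩
  let α : C(I, X) := .comp .fst γ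
  let β : C(I, Y) := .comp .snd γ
  have hα (t : I) : α t ∈ S := (hγ t).1
  have hβ (t : I) : β t ∈ T := (hγ t).2
  obtain ⟨η, hη₀, hη₁, hη⟩ := exists_continuousMap_of_joinedIn (hT (β 0) (hβ 0))
  have hsquare := hc.prod_square hα hη
  rw [hf _ (hα 1) _ hη, hf _ (hα 0) _ hη, hη₀, hη₁] at hsquare
  have hgα : c (α.prodMk (.const I y₀)) = g (α 1) - g (α 0) := hg α hα
  have hγ' : c γ = c (α.prodMk β) := rfl
  rw [hγ', hc.prodMk_eq_add hα hβ, hf _ (hα 1) _ hβ]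
  change _ = g (α 1) + (f (α 1) (β 1) - f (α 1) y₀) - (g (α 0) + (f (α 0) (β 0) - f (α 0) y₀))
  grind

end Prod

end Vanishing

/-! ### Spheres -/

section Spheres

variable {X Y A : Type*} [TopologicalSpace X] [TopologicalSpace Y] [AddCommGroup A]

/-- The inverse of a chart onto a whole space. -/
def chartSymm (φ : OpenPartialHomeomorph X Y) (hφ : φ.target = Set.univ) : C(Y, X) where
  toFun := φ.symm
  continuous_toFun := by
    rw [← continuousOn_univ, ← hφ]
    exact φ.continuousOn_symm

section Chart

variable {φ : OpenPartialHomeomorph X Y} (hφ : φ.target = Set.univ)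

lemma chartSymm_mem_source (y : Y) : chartSymm φ hφ y ∈ φ.source :=
  φ.map_target (hφ ▸ Set.mem_univ y)

lemma chart_chartSymm (y : Y) : φ (chartSymm φ hφ y) = y :=
  φ.right_inv (hφ ▸ Set.mem_univ y)

lemma chartSymm_chart {x : X} (hx : x ∈ φ.source) : chartSymm φ hφ (φ x) = x :=
  φ.left_inv hx

end Chart

section Sphere

variable {E : Type*} [NormedAddCommGroup E] [InnerProductSpace ℝ E]

lemma IsCocycleOn.isCoboundaryOn_sphere_compl_singleton (p : Metric.sphere (0 : E) 1)
    {c : C(I, Metric.sphere (0 : E) 1) → A} (hc : IsCocycleOn {p}ᶜ c) :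
    IsCoboundaryOn {p}ᶜ c := by
  let φ := stereographic (norm_eq_of_mem_sphere p)
  have hφ : φ.target = Set.univ := stereographic_target _
  have hsource : φ.source = {p}ᶜ := stereographic_source _
  refine .of_section (T := Set.univ) (chartSymm φ hφ) φ (hsource ▸ φ.continuousOn)
    (Set.mapsTo_univ _ _) (fun x hx => chartSymm_chart hφ (hsource ▸ hx)) ?_
  exact (hc.comp _ fun y _ => hsource ▸ chartSymm_mem_source hφ y).isCoboundaryOn_convex
    convex_univ

lemma sphere_ne_neg {F : Type*} [NormedAddCommGroup F] [NormedSpace ℝ F]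
    (p : Metric.sphere (0 : F) 1) : p ≠ -p := fun h => by
  have hp : (p : F) = -p := congrArg Subtype.val h
  rw [eq_neg_iff_add_eq_zero, ← two_smul ℝ, smul_eq_zero_iff_right two_ne_zero] at hp
  exact ne_zero_of_mem_unit_sphere p hp

lemma isPathConnected_sphere_compl_pair (hE : 2 < Module.finrank ℝ E)
    (p : Metric.sphere (0 : E) 1) :
    IsPathConnected ({p}ᶜ ∩ {-p}ᶜ : Set (Metric.sphere (0 : E) 1)) := by
  have : FiniteDimensional ℝ E := Module.finite_of_finrank_pos (by omega)
  let φ := stereographic (norm_eq_of_mem_sphere p)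
  have hφ : φ.target = Set.univ := stereographic_target _
  have hsource : φ.source = {p}ᶜ := stereographic_source _
  have hneg : φ (-p) = 0 := stereographic_apply_neg p
  have hrank : 1 < Module.rank ℝ (ℝ ∙ (p : E))ᗮ := by
    have h := Submodule.finrank_add_finrank_orthogonal (ℝ ∙ (p : E))
    rw [finrank_span_singleton (ne_zero_of_mem_unit_sphere p)] at h
    rw [← Module.finrank_eq_rank]
    exact_mod_cast (by omega : 1 < Module.finrank ℝ (ℝ ∙ (p : E))ᗮ)
  convert (isPathConnected_compl_singleton_of_one_lt_rank hrank 0).image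
    (chartSymm φ hφ).continuous
  ext x
  constructor
  · rintro ⟨hxp, hxneg⟩
    have hx : x ∈ φ.source := hsource ▸ hxp
    refine ⟨φ x, fun h => hxneg (φ.injOn hx ?_ ?_), chartSymm_chart hφ hx⟩
    · exact hsource ▸ (sphere_ne_neg p).symm
    · exact (Set.mem_singleton_iff.1 h).trans hneg.symm
  · rintro ⟨y, hy, rfl⟩
    refine ⟨hsource ▸ chartSymm_mem_source hφ y, fun h => hy ?_⟩
    rw [Set.mem_singleton_iff, ← chart_chartSymm hφ y, Set.mem_singleton_iff.1 h, hneg]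

lemma IsCocycleOn.isCoboundaryOn_sphere (hE : 2 < Module.finrank ℝ E)
    {c : C(I, Metric.sphere (0 : E) 1) → A} (hc : IsCocycleOn Set.univ c) :
    IsCoboundaryOn Set.univ c := by
  have : Nontrivial E := Module.nontrivial_of_finrank_pos (R := ℝ) (by omega)
  obtain ⟨v, hv⟩ := exists_norm_eq E zero_le_one
  let p : Metric.sphere (0 : E) 1 := ⟨v, by simpa using hv⟩
  have hcover : ({p}ᶜ ∪ {-p}ᶜ : Set (Metric.sphere (0 : E) 1)) = Set.univ := by
    rw [← Set.compl_inter, Set.compl_univ_iff]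
    exact Set.singleton_inter_eq_empty.2 (sphere_ne_neg p)
  rw [← hcover]
  exact (hc.mono (Set.subset_univ _)).isCoboundaryOn_union isOpen_compl_singleton
    isOpen_compl_singleton (isPathConnected_sphere_compl_pair hE p).joinedIn
    (hc.mono (Set.subset_univ _)).isCoboundaryOn_sphere_compl_singleton
    (hc.mono (Set.subset_univ _)).isCoboundaryOn_sphere_compl_singleton

lemma exists_continuousOn_direction (E : Type*) [NormedAddCommGroup E] [NormedSpace ℝ E]
    [Nontrivial E] : ∃ u : E → Metric.sphere (0 : E) 1,
      ContinuousOn u {0}ᶜ ∧ ∀ x, x ≠ 0 → ‖x‖ • (u x : E) = x := by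
  classical
  obtain ⟨v, hv⟩ := exists_norm_eq E zero_le_one
  let u (x : E) : Metric.sphere (0 : E) 1 := if h : ‖x‖ = 0 then ⟨v, by simpa using hv⟩ else
    ⟨‖x‖⁻¹ • x, by simp [norm_smul, inv_mul_cancel₀ h]⟩
  have hu {x : E} (hx : x ≠ 0) : (u x : E) = ‖x‖⁻¹ • x := by simp [u, hx]
  refine ⟨u, ?_, fun x hx => by rw [hu hx, smul_inv_smul₀ (norm_ne_zero_iff.2 hx)]⟩
  rw [Topology.IsInducing.subtypeVal.continuousOn_iff]
  refine ContinuousOn.congr (f := fun x : E => ‖x‖⁻¹ • x) ?_ fun x hx => hu hx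
  exact (continuous_norm.continuousOn.inv₀ fun x hx => norm_ne_zero_iff.2 hx).smul
    continuousOn_id

lemma IsCocycleOn.isCoboundaryOn_shell (hE : 2 < Module.finrank ℝ E) {r R : ℝ} (hr : 0 ≤ r)
    {c : C(I, E) → A} (hc : IsCocycleOn {x | ‖x‖ ∈ Set.Ioo r R} c) :
    IsCoboundaryOn {x | ‖x‖ ∈ Set.Ioo r R} c := by
  rcases le_or_gt R r with hRr | hrR
  · exact ⟨0, fun γ hγ => (hRr.not_gt ((hγ 0).1.trans (hγ 0).2)).elim⟩
  have : Nontrivial E := Module.nontrivial_of_finrank_pos (R := ℝ) (by omega)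
  obtain ⟨u, hu, hsmul⟩ := exists_continuousOn_direction E
  have hne {x : E} (hx : ‖x‖ ∈ Set.Ioo r R) : x ≠ 0 := norm_ne_zero_iff.1 (hr.trans_lt hx.1).ne'
  let ψ : C(Metric.sphere (0 : E) 1 × ℝ, E) := ⟨fun z => z.2 • (z.1 : E), by fun_prop⟩
  have hψ : ∀ z ∈ (Set.univ : Set (Metric.sphere (0 : E) 1)) ×ˢ Set.Ioo r R,
      ψ z ∈ {x : E | ‖x‖ ∈ Set.Ioo r R} := by
    rintro ⟨v, t⟩ ⟨-, ht⟩
    have hnorm : ‖t • (v : E)‖ = t := by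
      rw [norm_smul, norm_eq_of_mem_sphere, mul_one, Real.norm_of_nonneg (hr.trans ht.1.le)]
    simpa [ψ, hnorm] using ht
  have hcψ := hc.comp ψ hψ
  have hmid : (r + R) / 2 ∈ Set.Ioo r R := ⟨by linarith, by linarith⟩
  have hpolar := hcψ.isCoboundaryOn_prod (y₀ := (r + R) / 2)
    (fun y hy => (convex_Ioo r R).isPathConnected ⟨_, hmid⟩ |>.joinedIn _ hmid _ hy)
    ((hcψ.comp (S := Set.univ) ((ContinuousMap.id _).prodMk (.const _ ((r + R) / 2)))
      fun _ _ => Set.mk_mem_prod trivial hmid).isCoboundaryOn_sphere hE)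
    fun v _ => (hcψ.comp (S := Set.Ioo r R) ((ContinuousMap.const ℝ v).prodMk (.id ℝ))
      fun _ ht => Set.mk_mem_prod trivial ht).isCoboundaryOn_convex (convex_Ioo r R)
  refine .of_section (T := Set.univ ×ˢ Set.Ioo r R) ψ (fun x => (u x, ‖x‖)) ?_
    (fun x hx => ⟨trivial, hx⟩) ?_ hpolar
  · exact (hu.mono fun x hx => hne hx).prodMk continuous_norm.continuousOn
  · exact fun x hx => hsmul x (hne hx)

end Sphere

end Spheres

/-! ### Splitting a cocycle on an intersection -/

section Splitting

variable {X Y A : Type*} [TopologicalSpace X] [TopologicalSpace Y] [AddCommGroup A]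

lemma IsCocycleOn.exists_pullback {S : Set X} {T : Set Y} {c : C(I, Y) → A}
    (hc : IsCocycleOn T c) {φ : X → Y} (hφ : ContinuousOn φ S) (hST : Set.MapsTo φ S T) :
    ∃ d : C(I, X) → A, IsCocycleOn S d ∧
      ∀ (γ : C(I, X)) (δ : C(I, Y)), (∀ t, γ t ∈ S) → (∀ t, δ t = φ (γ t)) → d γ = c δ := by
  classical
  let d (γ : C(I, X)) : A := if h : ∀ t, γ t ∈ S then
    c ⟨fun t => φ (γ t), hφ.comp_continuous γ.continuous h⟩ else 0
  have hd (γ : C(I, X)) (δ : C(I, Y)) (h : ∀ t, γ t ∈ S) (h' : ∀ t, δ t = φ (γ t)) :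
      d γ = c δ := by
    simp only [d, dif_pos h]
    exact congrArg c (ContinuousMap.ext fun t => (h' t).symm)
  refine ⟨d, ⟨fun x hx => ?_, fun H hH => ?_⟩, hd⟩
  · rw [hd _ (.const I (φ x)) (fun _ => hx) fun _ => rfl, hc.const _ (hST hx)]
  · let K : C(I × I, Y) := ⟨fun z => φ (H z), hφ.comp_continuous H.continuous hH⟩
    rw [hd _ (bottomEdge K) (fun _ => hH _) fun _ => rfl,
      hd _ (rightEdge K) (fun _ => hH _) fun _ => rfl,
      hd _ (leftEdge K) (fun _ => hH _) fun _ => rfl,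
      hd _ (topEdge K) (fun _ => hH _) fun _ => rfl]
    exact hc.square K fun z => hST (hH z)

/-- The cocycle `w` on `E ∩ V` is, over `B`, a difference of cocycles on `E` and on `V`. -/
def SplitsOver (E V : Set X) (w : C(I, X) → A) (B : Set X) : Prop :=
  ∃ c d : C(I, X) → A, IsCocycleOn (B ∩ E) c ∧ IsCocycleOn (B ∩ V) d ∧
    ∀ γ : C(I, X), (∀ t, γ t ∈ B ∩ (E ∩ V)) → c γ - d γ = w γ

variable {E V B C : Set X} {w : C(I, X) → A}

lemma splitsOver_of_subset (hw : IsCocycleOn (E ∩ V) w) (hB : B ⊆ E ∨ B ⊆ V) :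
    SplitsOver E V w B := by
  rcases hB with hB | hB
  · exact ⟨0, -w, .zero _, (hw.mono fun x hx => ⟨hB hx.1, hx.2⟩).neg, fun γ _ => by simp⟩
  · exact ⟨w, 0, hw.mono fun x hx => ⟨hx.2, hB hx.1⟩, .zero _, fun γ _ => by simp⟩

namespace SplitsOver

lemma mono (h : SplitsOver E V w C) (hBC : B ⊆ C) : SplitsOver E V w B := by
  obtain ⟨c, d, hc, hd, h⟩ := h
  exact ⟨c, d, hc.mono (Set.inter_subset_inter_left _ hBC),
    hd.mono (Set.inter_subset_inter_left _ hBC), fun γ hγ => h γ fun t => ⟨hBC (hγ t).1, (hγ t).2⟩⟩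

lemma of_section {T : Set Y} (ψ : C(Y, X)) (φ : X → Y) (hφ : ContinuousOn φ B)
    (hBT : Set.MapsTo φ B T) (h : ∀ x ∈ B, ψ (φ x) = x)
    (hT : SplitsOver (ψ ⁻¹' E) (ψ ⁻¹' V) (fun γ => w (ψ.comp γ)) T) : SplitsOver E V w B := by
  obtain ⟨c, d, hc, hd, hcd⟩ := hT
  have hmaps (W : Set X) : Set.MapsTo φ (B ∩ W) (T ∩ ψ ⁻¹' W) := fun x hx =>
    ⟨hBT hx.1, Set.mem_preimage.2 ((h x hx.1).symm ▸ hx.2)⟩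
  obtain ⟨c', hc', hcc'⟩ := hc.exists_pullback (hφ.mono Set.inter_subset_left) (hmaps E)
  obtain ⟨d', hd', hdd'⟩ := hd.exists_pullback (hφ.mono Set.inter_subset_left) (hmaps V)
  refine ⟨c', d', hc', hd', fun γ hγ => ?_⟩
  let δ : C(I, Y) := ⟨fun t => φ (γ t), hφ.comp_continuous γ.continuous fun t => (hγ t).1⟩
  have hδ : ψ.comp δ = γ := ContinuousMap.ext fun t => h _ (hγ t).1
  rw [hcc' γ δ (fun t => ⟨(hγ t).1, (hγ t).2.1⟩) fun _ => rfl,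
    hdd' γ δ (fun t => ⟨(hγ t).1, (hγ t).2.2⟩) fun _ => rfl, hcd δ fun t => hmaps (E ∩ V) (hγ t)]
  exact congrArg w hδ

end SplitsOver

/-- Two splittings over `B ∩ C` differ by a cocycle that is defined on both `E` and `V`. -/
lemma exists_coboundary_eq_sub (hE : IsOpen E) (hV : IsOpen V) (hB : IsOpen B)
    (hBEV : B ⊆ E ∪ V)
    (hcob : ∀ c : C(I, X) → A, IsCocycleOn B c → IsCoboundaryOn B c) {c d : C(I, X) → A}
    (hc : IsCocycleOn (B ∩ E) c) (hd : IsCocycleOn (B ∩ V) d)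
    (h : ∀ γ : C(I, X), (∀ t, γ t ∈ B ∩ (E ∩ V)) → c γ = d γ) :
    ∃ g : X → A, (∀ γ, (∀ t, γ t ∈ B ∩ E) → c γ = coboundary g γ) ∧
      ∀ γ, (∀ t, γ t ∈ B ∩ V) → d γ = coboundary g γ := by
  obtain ⟨e, he, hec, hed⟩ := exists_isCocycleOn_union (hB.inter hE) (hB.inter hV) hc hd
    fun γ hγ => h γ fun t => ⟨(hγ t).1.1, (hγ t).1.2, (hγ t).2.2⟩
  rw [← Set.inter_union_distrib_left, Set.inter_eq_left.2 hBEV] at he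
  obtain ⟨g, hg⟩ := hcob e he
  exact ⟨g, fun γ hγ => (hec γ hγ).symm.trans (hg γ fun t => (hγ t).1),
    fun γ hγ => (hed γ hγ).symm.trans (hg γ fun t => (hγ t).1)⟩

namespace SplitsOver

lemma union (hE : IsOpen E) (hV : IsOpen V) (hw : IsCocycleOn (E ∩ V) w) (hB : IsOpen B)
    (hC : IsOpen C) (hBC : B ∩ C ⊆ E ∪ V)
    (hcob : ∀ c : C(I, X) → A, IsCocycleOn (B ∩ C) c → IsCoboundaryOn (B ∩ C) c)
    (hwB : SplitsOver E V w B) (hwC : SplitsOver E V w C) : SplitsOver E V w (B ∪ C) := by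
  obtain ⟨c₁, d₁, hc₁, hd₁, h₁⟩ := hwB
  obtain ⟨c₂, d₂, hc₂, hd₂, h₂⟩ := hwC
  obtain ⟨g, hgc, hgd⟩ := exists_coboundary_eq_sub (c := c₁ - c₂) (d := d₁ - d₂) hE hV
    (hB.inter hC) hBC hcob
    ((hc₁.mono fun x hx => ⟨hx.1.1, hx.2⟩).sub (hc₂.mono fun x hx => ⟨hx.1.2, hx.2⟩))
    ((hd₁.mono fun x hx => ⟨hx.1.1, hx.2⟩).sub (hd₂.mono fun x hx => ⟨hx.1.2, hx.2⟩))
    fun γ hγ => by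
      have h := (h₁ γ fun t => ⟨(hγ t).1.1, (hγ t).2⟩).trans
        (h₂ γ fun t => ⟨(hγ t).1.2, (hγ t).2⟩).symm
      exact sub_eq_sub_iff_sub_eq_sub.1 h
  obtain ⟨c, hc, hcB, hcC⟩ := exists_isCocycleOn_union (hB.inter hE) (hC.inter hE) hc₁
    (hc₂.add (isCocycleOn_coboundary g _)) fun γ hγ =>
      sub_eq_iff_eq_add'.1 (hgc γ fun t => ⟨⟨(hγ t).1.1, (hγ t).2.1⟩, (hγ t).1.2⟩)
  obtain ⟨d, hd, hdB, hdC⟩ := exists_isCocycleOn_union (hB.inter hV) (hC.inter hV) hd₁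
    (hd₂.add (isCocycleOn_coboundary g _)) fun γ hγ =>
      sub_eq_iff_eq_add'.1 (hgd γ fun t => ⟨⟨(hγ t).1.1, (hγ t).2.1⟩, (hγ t).1.2⟩)
  rw [← Set.union_inter_distrib_right] at hc hd
  refine ⟨c, d, hc, hd, fun γ hγ => ?_⟩
  have hdiff : IsCocycleOn ((B ∪ C) ∩ (E ∩ V)) (c - d - w) :=
    ((hc.mono fun x hx => ⟨hx.1, hx.2.1⟩).sub (hd.mono fun x hx => ⟨hx.1, hx.2.2⟩)).sub
      (hw.mono Set.inter_subset_right)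
  rw [Set.union_inter_distrib_right, Set.union_eq_iUnion] at hdiff hγ
  refine sub_eq_zero.1 (hdiff.eq_zero_of_iUnion (Bool.forall_bool.2
    ⟨hC.inter (hE.inter hV), hB.inter (hE.inter hV)⟩) (Bool.forall_bool.2
    ⟨fun γ hγ => ?_, fun γ hγ => ?_⟩) γ hγ)
  · simp only [Pi.sub_apply, hcC γ fun t => ⟨(hγ t).1, (hγ t).2.1⟩,
      hdC γ fun t => ⟨(hγ t).1, (hγ t).2.2⟩, ← h₂ γ hγ, Pi.add_apply, add_sub_add_right_eq_sub,
      sub_self]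
  · simp only [Pi.sub_apply, hcB γ fun t => ⟨(hγ t).1, (hγ t).2.1⟩,
      hdB γ fun t => ⟨(hγ t).1, (hγ t).2.2⟩, ← h₁ γ hγ, sub_self]

lemma of_slabs {F : Type*} [AddCommGroup F] [Module ℝ F] [TopologicalSpace F]
    [ContinuousAdd F] [ContinuousSMul ℝ F] {E V C : Set F} {w : C(I, F) → A} (hE : IsOpen E)
    (hV : IsOpen V) (hw : IsCocycleOn (E ∩ V) w) (hC : IsOpen C) (hconv : Convex ℝ C)
    (hCEV : C ⊆ E ∪ V) (f : F →L[ℝ] ℝ) {K : ℝ} (hK : ∀ x ∈ C, |f x| < K) {l : ℝ} (hl : 0 < l)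
    (h : ∀ a : ℝ, SplitsOver E V w (C ∩ f ⁻¹' Set.Ioo a (a + l))) : SplitsOver E V w C := by
  have hopen (a b : ℝ) : IsOpen (C ∩ f ⁻¹' Set.Ioo a b) :=
    hC.inter (isOpen_Ioo.preimage f.continuous)
  have hslab (a b : ℝ) : Convex ℝ (C ∩ f ⁻¹' Set.Ioo a b) :=
    hconv.inter ((convex_Ioo a b).linear_preimage f.toLinearMap)
  have hwide (n : ℕ) (a : ℝ) : SplitsOver E V w (C ∩ f ⁻¹' Set.Ioo a (a + (1 + n / 2) * l)) := by
    induction n with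
    | zero => simpa using h a
    | succ n ih =>
      refine (union hE hV hw (hopen _ _) (hopen _ _) (fun x hx => hCEV hx.1.1)
        (fun c hc => hc.isCoboundaryOn_convex ((hslab _ _).inter (hslab _ _))) ih
        (h (a + (n + 1) / 2 * l))).mono ?_
      rintro x ⟨hx, hax, hxb⟩
      push_cast at hxb
      rcases lt_or_ge (f x) (a + (1 + n / 2) * l) with hlt | hge
      · exact .inl ⟨hx, hax, hlt⟩
      · refine .inr ⟨hx, ?_, ?_⟩ <;> nlinarith
  obtain ⟨n, hn⟩ := exists_nat_gt (4 * K / l)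
  refine (hwide n (-K)).mono fun x hx => ⟨hx, ?_⟩
  have hxK := abs_lt.1 (hK x hx)
  rw [div_lt_iff₀ hl] at hn
  exact ⟨hxK.1, by nlinarith⟩

end SplitsOver

section Ball

variable {ι : Type*} [Fintype ι]

lemma euclidean_dist_lt_of_forall {x y : EuclideanSpace ℝ ι} {δ : ℝ} (hδ : 0 < δ)
    (h : ∀ i, dist (x i) (y i) < δ / (Fintype.card ι + 1)) : dist x y < δ := by
  obtain ⟨n, hn⟩ : ∃ n : ℝ, n = Fintype.card ι := ⟨_, rfl⟩
  have hn' : 0 ≤ n := hn ▸ Nat.cast_nonneg _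
  rw [← hn] at h
  rw [EuclideanSpace.dist_eq, Real.sqrt_lt' hδ]
  calc
    ∑ i, dist (x i) (y i) ^ 2 ≤ ∑ _i : ι, (δ / (n + 1)) ^ 2 := by
      gcongr with i
      exact (h i).le
    _ = n * (δ / (n + 1)) ^ 2 := by simp [hn]
    _ < δ ^ 2 := by
      rw [div_pow, mul_div_assoc', div_lt_iff₀ (by positivity)]
      nlinarith [mul_pos (sq_pos_of_pos hδ) (by positivity : 0 < n ^ 2 + n + 1)]

omit [Fintype ι] in
lemma exists_forall_box_subset [Finite ι] {E V : Set (EuclideanSpace ℝ ι)} (hE : IsOpen E)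
    (hV : IsOpen V) (hEV : E ∪ V = Set.univ) {K : Set (EuclideanSpace ℝ ι)} (hK : IsCompact K) :
    ∃ l > 0, ∀ S ⊆ K, ∀ a : ι → ℝ, (∀ x ∈ S, ∀ i, x i ∈ Set.Ioo (a i) (a i + l)) →
      S ⊆ E ∨ S ⊆ V := by
  have := Fintype.ofFinite ι
  obtain ⟨δ, hδ, hball⟩ := lebesgue_number_lemma_of_metric (c := (cond · E V)) hK
    (Bool.forall_bool.2 ⟨hV, hE⟩) (Set.union_eq_iUnion (s₁ := E) ▸ hEV ▸ Set.subset_univ _)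
  refine ⟨δ / (Fintype.card ι + 1), by positivity, fun S hSK a hS => ?_⟩
  obtain rfl | ⟨x, hx⟩ := S.eq_empty_or_nonempty
  · exact .inl (Set.empty_subset _)
  obtain ⟨b, hb⟩ := hball x (hSK hx)
  have hsub : S ⊆ cond b E V := fun y hy => hb <| euclidean_dist_lt_of_forall hδ fun i =>
    abs_sub_lt_iff.2 ⟨by linarith [(hS x hx i).1, (hS y hy i).2],
      by linarith [(hS x hx i).2, (hS y hy i).1]⟩
  cases b
  exacts [.inr hsub, .inl hsub]

lemma splitsOver_ball {E V : Set (EuclideanSpace ℝ ι)} (hE : IsOpen E) (hV : IsOpen V)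
    (hEV : E ∪ V = Set.univ) {w : C(I, EuclideanSpace ℝ ι) → A}
    (hw : IsCocycleOn (E ∩ V) w) (R : ℝ) : SplitsOver E V w (Metric.ball 0 R) := by
  classical
  obtain ⟨l, hl, hbase⟩ := exists_forall_box_subset hE hV hEV (isCompact_closedBall 0 R)
  let slab (i : ι) (a : ℝ) : Set (EuclideanSpace ℝ ι) :=
    EuclideanSpace.proj (𝕜 := ℝ) i ⁻¹' Set.Ioo a (a + l)
  have hopen (i : ι) (a : ℝ) : IsOpen (slab i a) :=
    isOpen_Ioo.preimage (EuclideanSpace.proj i).continuous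
  have hconv (i : ι) (a : ℝ) : Convex ℝ (slab i a) :=
    (convex_Ioo _ _).linear_preimage (EuclideanSpace.proj i).toLinearMap
  -- Free the coordinates in `s` one at a time, starting from small boxes inside `E` or `V`.
  have hbox (s : Finset ι) : ∀ a : ι → ℝ,
      SplitsOver E V w (Metric.ball 0 R ∩ ⋂ i ∈ sᶜ, slab i (a i)) := by
    induction s using Finset.induction_on with
    | empty =>
      refine fun a => splitsOver_of_subset hw (hbase _ ?_ a fun x hx i => ?_)
      · exact Set.inter_subset_left.trans Metric.ball_subset_closedBall
      · exact Set.mem_iInter₂.1 hx.2 i (by simp)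
    | insert i s hi ih =>
      refine fun a => .of_slabs hE hV hw
        (Metric.isOpen_ball.inter (isOpen_biInter_finset fun j _ => hopen j _))
        ((convex_ball _ _).inter (convex_iInter₂ fun j _ => hconv j _)) (hEV ▸ Set.subset_univ _)
        (EuclideanSpace.proj i) (K := R)
        (fun x hx => (PiLp.norm_apply_le x i).trans_lt (mem_ball_zero_iff.1 hx.1)) hl
        fun b => (ih (Function.update a i b)).mono ?_
      rintro x ⟨⟨hxR, hx⟩, hxi⟩
      refine ⟨hxR, Set.mem_iInter₂.2 fun j hj => ?_⟩
      rcases eq_or_ne j i with rfl | hji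
      · simpa only [Function.update_self] using hxi
      · simpa only [Function.update_of_ne hji] using
          Set.mem_iInter₂.1 hx j (by simpa [hji] using hj)
  simpa using hbox Finset.univ 0

end Ball

section Chart

variable {φ : OpenPartialHomeomorph X Y}

lemma IsCocycleOn.isCoboundaryOn_chart_preimage (hφ : φ.target = Set.univ) {W : Set Y}
    (hW : ∀ c : C(I, Y) → A, IsCocycleOn W c → IsCoboundaryOn W c) {c : C(I, X) → A}
    (hc : IsCocycleOn (φ.source ∩ φ ⁻¹' W) c) : IsCoboundaryOn (φ.source ∩ φ ⁻¹' W) c :=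
  .of_section (chartSymm φ hφ) φ (φ.continuousOn.mono Set.inter_subset_left) (fun _ hx => hx.2)
    (fun _ hx => chartSymm_chart hφ hx.1) <| hW _ <| hc.comp (chartSymm φ hφ) fun y hy =>
      ⟨chartSymm_mem_source hφ y, by rwa [Set.mem_preimage, chart_chartSymm]⟩

/-- The vanishing of `H²` of a compact space that is, up to a closed subset of `E`, a Euclidean
space: the shell in which the ball meets a neighbourhood of infinity has no `H¹`. -/
lemma splitsOver_univ_of_chart {ι : Type*} [Fintype ι] [CompactSpace X] [T2Space X]
    {φ : OpenPartialHomeomorph X (EuclideanSpace ℝ ι)} (hφ : φ.target = Set.univ)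
    (hι : 2 < Fintype.card ι) {E V : Set X} (hE : IsOpen E) (hV : IsOpen V)
    (hEV : E ∪ V = Set.univ) (hφE : φ.sourceᶜ ⊆ E) {w : C(I, X) → A}
    (hw : IsCocycleOn (E ∩ V) w) : SplitsOver E V w Set.univ := by
  have hEφ : Eᶜ ⊆ φ.source := Set.compl_subset_comm.1 hφE
  have hcompact : IsCompact (φ '' Eᶜ) :=
    hE.isClosed_compl.isCompact.image_of_continuousOn (φ.continuousOn.mono hEφ)
  obtain ⟨r, hr0, hr⟩ := hcompact.isBounded.subset_closedBall_lt 0 0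
  let B : Set X := φ.source ∩ φ ⁻¹' Metric.ball 0 (r + 1)
  let C : Set X := (φ.source ∩ φ ⁻¹' Metric.closedBall 0 r)ᶜ
  have hC : IsOpen C := by
    rw [isOpen_compl_iff, ← φ.symm_image_eq_source_inter_preimage (hφ ▸ Set.subset_univ _)]
    exact ((isCompact_closedBall _ _).image (chartSymm φ hφ).continuous).isClosed
  have hBC : B ∩ C = φ.source ∩ φ ⁻¹' {x | ‖x‖ ∈ Set.Ioo r (r + 1)} := by
    ext x
    simp only [B, C, Set.mem_inter_iff, Set.mem_preimage, mem_ball_zero_iff, Set.mem_compl_iff,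
      mem_closedBall_zero_iff, not_and, not_le, Set.mem_ofPred_eq, Set.mem_Ioo]
    tauto
  have hB : SplitsOver E V w B :=
    .of_section (chartSymm φ hφ) φ (φ.continuousOn.mono Set.inter_subset_left) (fun _ hx => hx.2)
      (fun _ hx => chartSymm_chart hφ hx.1) <| splitsOver_ball
        (hE.preimage (chartSymm φ hφ).continuous) (hV.preimage (chartSymm φ hφ).continuous)
        (by rw [← Set.preimage_union, hEV, Set.preimage_univ])
        (hw.comp (chartSymm φ hφ) fun _ hx => hx) (r + 1)
  have hCE : C ⊆ E := Set.compl_subset_comm.1 fun x hx => ⟨hEφ hx, hr ⟨x, hx, rfl⟩⟩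
  have hBC_univ : B ∪ C = Set.univ := by
    refine Set.eq_univ_of_forall fun x => or_iff_not_imp_right.2 fun hx => ?_
    obtain ⟨hxφ, hxr⟩ := not_not.1 hx
    exact ⟨hxφ, Metric.closedBall_subset_ball (by linarith) hxr⟩
  rw [← hBC_univ]
  refine .union hE hV hw (φ.isOpen_inter_preimage Metric.isOpen_ball) hC
    (hEV ▸ Set.subset_univ _) (fun c hc => ?_) hB (splitsOver_of_subset hw (.inl hCE))
  rw [hBC] at hc ⊢
  exact hc.isCoboundaryOn_chart_preimage hφ fun d hd =>
    hd.isCoboundaryOn_shell (by simpa using hι) hr0.le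

lemma splitsOver_sphere {F : Type*} [NormedAddCommGroup F] [InnerProductSpace ℝ F]
    (hF : 3 < Module.finrank ℝ F) {E V : Set (Metric.sphere (0 : F) 1)} (hE : IsOpen E)
    (hV : IsOpen V) (hEV : E ∪ V = Set.univ) {w : C(I, Metric.sphere (0 : F) 1) → A}
    (hw : IsCocycleOn (E ∩ V) w) : SplitsOver E V w Set.univ := by
  rcases E.eq_empty_or_nonempty with rfl | ⟨p, hp⟩
  · exact splitsOver_of_subset hw (.inr (by rw [← hEV, Set.empty_union]))
  have : FiniteDimensional ℝ F := Module.finite_of_finrank_pos (by omega)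
  have : ProperSpace F := FiniteDimensional.proper_real F
  have : Fact (Module.finrank ℝ F = Module.finrank ℝ F - 1 + 1) := ⟨by omega⟩
  refine splitsOver_univ_of_chart (stereographic'_target (n := Module.finrank ℝ F - 1) p)
    (by rw [Fintype.card_fin]; omega) hE hV hEV ?_ hw
  rw [stereographic'_source, compl_compl, Set.singleton_subset_iff]
  exact hp

end Chart

end Splitting

/-! ### The circle -/

section Circle

variable {X Y A : Type*} [TopologicalSpace X] [TopologicalSpace Y] [AddCommGroup A]

lemma exists_path_lift {p : Y → X} (hp : IsCoveringMap p) (hs : Function.Surjective p)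
    (γ : C(I, X)) : ∃ δ : C(I, Y), ∀ t, p (δ t) = γ t := by
  obtain ⟨y, hy⟩ := hs (γ 0)
  exact ⟨hp.liftPath γ y hy.symm, fun t => congrFun (hp.liftPath_lifts γ y hy.symm) t⟩

lemma exists_square_lift {p : Y → X} (hp : IsCoveringMap p) (hs : Function.Surjective p)
    (H : C(I × I, X)) : ∃ K : C(I × I, Y), ∀ z, p (K z) = H z := by
  obtain ⟨δ, hδ⟩ := exists_path_lift hp hs (leftEdge H)
  exact ⟨hp.liftHomotopy H δ fun t => (hδ t).symm,
    fun z => congrFun (hp.liftHomotopy_lifts H _ _) z⟩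

lemma isCoboundaryOn_of_lift {c : C(I, X) → A} (p : C(Y, X))
    (hp : ∀ γ : C(I, X), ∃ δ : C(I, Y), p.comp δ = γ) {g : Y → A}
    (hg : ∀ δ, c (p.comp δ) = g (δ 1) - g (δ 0)) (hfib : ∀ x y, p x = p y → g x = g y) :
    IsCoboundaryOn Set.univ c := by
  have hs (x : X) : ∃ y, p y = x := by
    obtain ⟨δ, hδ⟩ := hp (.const I x)
    exact ⟨δ 0, DFunLike.congr_fun hδ 0⟩
  choose s hs using hs
  refine ⟨g ∘ s, fun γ _ => ?_⟩
  obtain ⟨δ, rfl⟩ := hp γ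
  rw [hg]
  congr 1 <;> exact hfib _ _ (hs _).symm

lemma exists_descent {p : C(Y, X)} (hp : IsCoveringMap p) (hs : Function.Surjective p)
    {c : C(I, Y) → A} (hc : IsCocycleOn Set.univ c)
    (h : ∀ δ δ' : C(I, Y), p.comp δ = p.comp δ' → c δ = c δ') :
    ∃ d : C(I, X) → A, IsCocycleOn Set.univ d ∧ ∀ δ, d (p.comp δ) = c δ := by
  choose lift hlift using exists_path_lift hp hs
  have hd (δ : C(I, Y)) : c (lift (p.comp δ)) = c δ := h _ _ (ContinuousMap.ext (hlift _))
  refine ⟨fun γ => c (lift γ), ⟨fun x _ => ?_, fun H _ => ?_⟩, hd⟩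
  · obtain ⟨y, rfl⟩ := hs x
    exact (hd (.const I y)).trans (hc.const y trivial)
  · obtain ⟨K, hK⟩ := exists_square_lift hp hs H
    obtain rfl : p.comp K = H := ContinuousMap.ext hK
    exact (congrArg₂ (· + ·) (hd (bottomEdge K)) (hd (rightEdge K))).trans <|
      (hc.square K fun _ => trivial).trans
        (congrArg₂ (· + ·) (hd (leftEdge K)) (hd (topEdge K))).symm

lemma IsCocycleOn.bottomEdge_eq_topEdge {S : Set X} {c : C(I, X) → A} (hc : IsCocycleOn S c)
    {H : C(I × I, X)} (hH : ∀ z, H z ∈ S) (h : leftEdge H = rightEdge H) :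
    c (bottomEdge H) = c (topEdge H) := by
  have hsquare := hc.square H hH
  rwa [h, add_comm, add_right_inj] at hsquare

lemma circle_exp_surjective : Function.Surjective Circle.exp :=
  fun z => ⟨Complex.arg z, Circle.exp_arg z⟩

lemma exists_exp_lift (γ : C(I, Circle)) : ∃ l : C(I, ℝ), ∀ t, Circle.exp (l t) = γ t :=
  exists_path_lift Circle.isCoveringMap_exp circle_exp_surjective γ

lemma sub_eq_sub_of_exp_eq_exp {l l' : C(I, ℝ)} (h : ∀ t, Circle.exp (l t) = Circle.exp (l' t)) :
    l 1 - l 0 = l' 1 - l' 0 := by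
  have heq : (fun t => l t - l 0) = fun t => l' t - l' 0 :=
    Circle.isCoveringMap_exp.eq_of_comp_eq (by fun_prop) (by fun_prop)
      (funext fun t => by simp [Circle.exp_sub, h]) 0 (by simp)
  exact congrFun heq 1

lemma exists_wind (γ : C(I, Circle)) : ∃ n : ℤ, ∀ l : C(I, ℝ), (∀ t, Circle.exp (l t) = γ t) →
    n * (2 * Real.pi) = l 1 - l 0 - (Complex.arg (γ 1) - Complex.arg (γ 0)) := by
  obtain ⟨l, hl⟩ := exists_exp_lift γ
  obtain ⟨m, hm⟩ := Circle.exp_eq_exp.1 ((hl 0).trans (Circle.exp_arg (γ 0)).symm)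
  obtain ⟨n, hn⟩ := Circle.exp_eq_exp.1 ((hl 1).trans (Circle.exp_arg (γ 1)).symm)
  refine ⟨n - m, fun l' hl' => ?_⟩
  rw [sub_eq_sub_of_exp_eq_exp fun t => (hl' t).trans (hl t).symm, hm, hn]
  push_cast
  ring

/-- The winding number of a path in the circle, made an integer by closing the path up through
the principal arguments of its end points. -/
def wind (γ : C(I, Circle)) : ℤ := (exists_wind γ).choose

lemma wind_eq {γ : C(I, Circle)} (l : C(I, ℝ)) (h : ∀ t, Circle.exp (l t) = γ t) :
    wind γ * (2 * Real.pi) = l 1 - l 0 - (Complex.arg (γ 1) - Complex.arg (γ 0)) :=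
  (exists_wind γ).choose_spec l h

lemma wind_eq_of_closed {γ : C(I, Circle)} (hγ : γ 0 = γ 1) {n : ℤ} (l : C(I, ℝ))
    (h : ∀ t, Circle.exp (l t) = γ t) (hn : l 1 - l 0 = n * (2 * Real.pi)) : wind γ = n := by
  have hl := wind_eq l h
  rw [hγ, sub_self, sub_zero, hn] at hl
  exact_mod_cast mul_right_cancel₀ Real.two_pi_pos.ne' hl

lemma isCocycleOn_wind : IsCocycleOn Set.univ wind where
  const z _ := wind_eq_of_closed rfl (.const I (Complex.arg z)) (fun _ => Circle.exp_arg z)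
    (by simp)
  square H _ := by
    obtain ⟨K, hK⟩ := exists_square_lift Circle.isCoveringMap_exp circle_exp_surjective H
    have hbottom := wind_eq (γ := bottomEdge H) (bottomEdge K) fun _ => hK _
    have hright := wind_eq (γ := rightEdge H) (rightEdge K) fun _ => hK _
    have hleft := wind_eq (γ := leftEdge H) (leftEdge K) fun _ => hK _
    have htop := wind_eq (γ := topEdge H) (topEdge K) fun _ => hK _
    simp only [bottomEdge_apply, rightEdge_apply, leftEdge_apply, topEdge_apply]
      at hbottom hright hleft htop
    rw [← Int.cast_inj (α := ℝ), ← mul_left_inj' Real.two_pi_pos.ne']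
    push_cast
    linarith

/-- The loop that runs once around the circle. -/
def loop : C(I, Circle) := ⟨fun t => Circle.exp (2 * Real.pi * t), by fun_prop⟩

lemma loop_apply (t : I) : loop t = Circle.exp (2 * Real.pi * t) := rfl

@[simp]
lemma loop_zero : loop 0 = 1 := by simp [loop_apply]

@[simp]
lemma loop_one : loop 1 = 1 := by simp [loop_apply]

lemma wind_comp_zpow_loop (n : ℤ) :
    wind (ContinuousMap.comp ⟨fun z : Circle => z ^ n, by fun_prop⟩ loop) = n :=
  wind_eq_of_closed (by simp) ⟨fun t => n * (2 * Real.pi * t), by fun_prop⟩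
    (fun _ => Circle.exp_intCast_mul ..) (by simp)

lemma wind_loop : wind loop = 1 :=
  wind_eq_of_closed (by simp) ⟨fun t => 2 * Real.pi * t, by fun_prop⟩ (fun _ => rfl) (by simp)

lemma IsCocycleOn.isCoboundaryOn_circle {c : C(I, Circle) → A} (hc : IsCocycleOn Set.univ c)
    (h : c loop = 0) : IsCoboundaryOn Set.univ c := by
  obtain ⟨g, hg⟩ := (hc.comp_univ Circle.exp).isCoboundaryOn_convex convex_univ
  have hper (x : ℝ) : g (x + 2 * Real.pi) = g x := by
    let K : C(I × I, ℝ) := ⟨fun z => x * z.2 + 2 * Real.pi * z.1, by fun_prop⟩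
    have hbottom : bottomEdge (Circle.exp.comp K) = loop := by
      ext t
      simp [K, loop_apply]
    have hside : leftEdge (Circle.exp.comp K) = rightEdge (Circle.exp.comp K) := by
      ext t
      simp [K, Circle.exp_add]
    have htop : c (topEdge (Circle.exp.comp K)) = g (topEdge K 1) - g (topEdge K 0) :=
      hg (topEdge K) fun _ => trivial
    rw [← hc.bottomEdge_eq_topEdge (fun _ => trivial) hside, hbottom, h, eq_comm,
      sub_eq_zero] at htop
    simpa [K] using htop
  refine isCoboundaryOn_of_lift Circle.exp (fun γ => ?_) (fun δ => hg δ fun _ => trivial)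
    fun x y hxy => ?_
  · exact (exists_exp_lift γ).imp fun l hl => ContinuousMap.ext hl
  · obtain ⟨n, rfl⟩ := Circle.exp_eq_exp.1 hxy
    exact Function.Periodic.int_mul (c := 2 * Real.pi) hper n y

lemma IsCocycleOn.sub_zmultiples_wind {c : C(I, Circle) → A} (hc : IsCocycleOn Set.univ c) :
    IsCoboundaryOn Set.univ (c - zmultiplesHom A (c loop) ∘ wind) :=
  (hc.sub (isCocycleOn_wind.map _)).isCoboundaryOn_circle (by simp [wind_loop])

lemma IsCocycleOn.eq_wind_smul {c : C(I, Circle) → A} (hc : IsCocycleOn Set.univ c)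
    {γ : C(I, Circle)} (hγ : γ 0 = γ 1) : c γ = wind γ • c loop := by
  simpa [sub_eq_zero] using
    hc.sub_zmultiples_wind.eq_zero_of_closed (fun _ => Set.mem_univ _) hγ

lemma IsCocycleOn.const_prodMk_loop_eq {c : C(I, X × Circle) → A} (hc : IsCocycleOn Set.univ c)
    [PathConnectedSpace X] (x y : X) :
    c ((ContinuousMap.const I x).prodMk loop) = c ((ContinuousMap.const I y).prodMk loop) := by
  obtain ⟨η⟩ := PathConnectedSpace.joined x y
  let H : C(I × I, X × Circle) := ⟨fun z => (η z.2, loop z.1), by fun_prop⟩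
  have hbottom : bottomEdge H = (ContinuousMap.const I x).prodMk loop := by
    ext t : 1
    simp [H]
  have htop : topEdge H = (ContinuousMap.const I y).prodMk loop := by
    ext t : 1
    simp [H]
  have hside : leftEdge H = rightEdge H := by
    ext t : 1
    simp [H]
  rw [← hbottom, ← htop]
  exact hc.bottomEdge_eq_topEdge (fun _ => trivial) hside

lemma IsCocycleOn.isCoboundaryOn_prod_circle {c : C(I, X × Circle) → A}
    (hc : IsCocycleOn Set.univ c) [PathConnectedSpace X] (x₀ : X)
    (h₁ : IsCoboundaryOn Set.univ fun γ => c (γ.prodMk (.const I 1)))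
    (h₂ : c ((ContinuousMap.const I x₀).prodMk loop) = 0) : IsCoboundaryOn Set.univ c := by
  have hloop (x : X) := (hc.const_prodMk_loop_eq x x₀).trans h₂
  have hcircle (x : X) :=
    (hc.comp_univ ((ContinuousMap.const _ x).prodMk (.id _))).isCoboundaryOn_circle (hloop x)
  rw [← Set.univ_prod_univ] at hc ⊢
  exact hc.isCoboundaryOn_prod (y₀ := 1)
    (fun y _ => joinedIn_univ.2 (PathConnectedSpace.joined _ _)) h₁ fun x _ => hcircle x

lemma IsCocycleOn.isCoboundaryOn_torus {c : C(I, Circle × Circle) → A}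
    (hc : IsCocycleOn Set.univ c) (h₁ : c (loop.prodMk (.const I 1)) = 0)
    (h₂ : c ((ContinuousMap.const I 1).prodMk loop) = 0) : IsCoboundaryOn Set.univ c :=
  hc.isCoboundaryOn_prod_circle 1
    ((hc.comp_univ ((ContinuousMap.id _).prodMk (.const _ 1))).isCoboundaryOn_circle h₁) h₂

lemma IsCocycleOn.isCoboundaryOn_Icc {a b : ℝ} (hab : a ≤ b) {c : C(I, Set.Icc a b) → A}
    (hc : IsCocycleOn Set.univ c) : IsCoboundaryOn Set.univ c :=
  .of_section (T := Set.univ) ⟨Set.projIcc a b hab, continuous_projIcc⟩ Subtype.val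
    continuous_subtype_val.continuousOn (Set.mapsTo_univ _ _) (fun x _ => Set.projIcc_val hab x)
    ((hc.comp_univ _).isCoboundaryOn_convex convex_univ)

end Circle

section Degree

variable {Y A : Type} [TopologicalSpace Y] [AddCommGroup A]

/-- The degree of a homology class of the circle. -/
def deg (u : H1 Circle) : ℤ := isCocycleOn_wind.eval u

lemma IsCocycleOn.eval_map_circle {c : C(I, Y) → A} (hc : IsCocycleOn Set.univ c)
    (f : C(Circle, Y)) (u : H1 Circle) : hc.eval (H1.map f u) = deg u • c (f.comp loop) := by
  rw [hc.eval_map, IsCocycleOn.eval_congr _ (isCocycleOn_wind.map _)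
    (hc.comp_univ f).sub_zmultiples_wind, isCocycleOn_wind.eval_hom]
  rfl

lemma IsFundamentalClass.deg_eq {u : H1 Circle} (hu : IsFundamentalClass u) :
    deg u = 1 ∨ deg u = -1 := by
  obtain ⟨n, hn⟩ := hu (loopClass loop (loop_zero.trans loop_one.symm))
  have hdeg : n * deg u = 1 := by
    rw [← smul_eq_mul, deg, ← map_zsmul, ← hn, isCocycleOn_wind.eval_loopClass, wind_loop]
  exact Int.eq_one_or_neg_one_of_mul_eq_one' hdeg |>.imp And.right And.right

lemma IsFundamentalClass.deg_smul_eq_zero_iff {u : H1 Circle} (hu : IsFundamentalClass u) (a : A) :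
    deg u • a = 0 ↔ a = 0 := by
  rcases hu.deg_eq with h | h <;> simp [h]

end Degree

/-! ### The double cover of the twisted `I`-bundle -/

section Involution

variable {X Y : Type*} [TopologicalSpace X] [TopologicalSpace Y]

/-- The action of the group of order two generated by an involution. -/
@[reducible]
def involutionAction (f : X → X) (hf : Function.Involutive f) : MulAction ℤˣ X where
  smul g x := if g = 1 then x else f x
  one_smul x := if_pos rfl
  mul_smul g h x := by
    change (if g * h = 1 then x else f x) =
      if g = 1 then (if h = 1 then x else f x) else f (if h = 1 then x else f x)
    rcases Int.units_eq_one_or g with rfl | rfl <;> rcases Int.units_eq_one_or h with rfl | rfl <;>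
      simp [hf x]

lemma isQuotientCoveringMap_of_involutive [T2Space X] {p : X → Y} (hp : Topology.IsQuotientMap p)
    {f : X → X} (hf : Function.Involutive f) (hcont : Continuous f) (hfree : ∀ x, f x ≠ x)
    (hfib : ∀ x y, p x = p y ↔ x = y ∨ x = f y) :
    letI := involutionAction f hf
    IsQuotientCoveringMap p ℤˣ := by
  let _ := involutionAction f hf
  have hneg (x : X) : (-1 : ℤˣ) • x = f x := if_neg (by decide)
  refine ⟨hp, ⟨fun g => ?_⟩, fun {x y} => (hfib x y).trans ⟨?_, ?_⟩, fun x => ?_⟩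
  · rcases Int.units_eq_one_or g with rfl | rfl
    · exact continuous_id.congr fun x => (one_smul _ x).symm
    · exact hcont.congr fun x => (hneg x).symm
  · rintro (rfl | rfl)
    · exact ⟨1, one_smul _ _⟩
    · exact ⟨-1, hneg y⟩
  · rintro ⟨g, rfl⟩
    exact (Int.units_eq_one_or g).imp (by rintro rfl; exact one_smul _ _)
      (by rintro rfl; exact hneg y)
  · obtain ⟨u, v, hu, hv, hxu, hxv, huv⟩ := t2_separation (hfree x)
    refine ⟨v ∩ f ⁻¹' u, (hv.inter (hu.preimage hcont)).mem_nhds ⟨hxv, hxu⟩, ?_⟩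
    rintro g ⟨_, ⟨y, hy, rfl⟩, hy', -⟩
    refine (Int.units_eq_one_or g).resolve_right ?_
    rintro rfl
    exact Set.disjoint_left.1 huv hy.2 (hneg y ▸ hy')

end Involution

namespace N

/-- The double cover of `N`. -/
abbrev Cover : Type := Circle × Circle × Set.Icc (-1 : ℝ) 1

instance : PathConnectedSpace (Set.Icc (-1 : ℝ) 1) :=
  isPathConnected_iff_pathConnectedSpace.1
    ((convex_Icc _ _).isPathConnected (Set.nonempty_Icc.2 (by norm_num)))

lemma flip_involutive : Function.Involutive flip := fun x => by simp [flip]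

lemma flip_ne (x : Cover) : flip x ≠ x := fun h =>
  x.1.coe_ne_zero (neg_eq_self.1 (congrArg (fun y : Cover => (y.1 : ℂ)) h))

lemma continuous_flip : Continuous flip :=
  Continuous.prodMk (by fun_prop)
    (Continuous.prodMk (by fun_prop) (Continuous.subtype_mk (by fun_prop) _))

/-- The deck transformation of the double cover, as a continuous map. -/
@[simps]
def flipMap : C(Cover, Cover) := ⟨flip, continuous_flip⟩

lemma mk_flip (x : Cover) : N.mk (flip x) = N.mk x :=
  (Quot.sound (r := fun x y : Cover => y = flip x) rfl).symm

lemma mk_comp_flipMap_comp (δ : C(I, Cover)) : N.mk.comp (flipMap.comp δ) = N.mk.comp δ :=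
  ContinuousMap.ext fun _ => mk_flip _

lemma mk_eq_mk {x y : Cover} : N.mk x = N.mk y ↔ x = y ∨ x = flip y := by
  constructor
  · intro h
    let pair : N → Set Cover := Quot.lift (fun x => {x, flip x}) fun a b hab => by
      subst hab
      rw [flip_involutive, Set.pair_comm]
    have hx : x ∈ pair (N.mk x) := Set.mem_insert _ _
    rwa [h] at hx
  · rintro (rfl | rfl)
    · rfl
    · exact mk_flip _

lemma isQuotientMap_mk : Topology.IsQuotientMap N.mk := isQuotientMap_quot_mk

lemma mk_surjective : Function.Surjective N.mk := isQuotientMap_mk.surjective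

lemma isQuotientCoveringMap_mk :
    letI := involutionAction flip flip_involutive
    IsQuotientCoveringMap N.mk ℤˣ :=
  isQuotientCoveringMap_of_involutive isQuotientMap_mk _ continuous_flip flip_ne
    fun _ _ => mk_eq_mk

lemma isCoveringMap_mk : IsCoveringMap N.mk :=
  letI := involutionAction flip flip_involutive
  isQuotientCoveringMap_mk.isCoveringMap

lemma exists_lift (γ : C(I, N)) : ∃ δ : C(I, Cover), N.mk.comp δ = γ :=
  (exists_path_lift isCoveringMap_mk mk_surjective γ).imp fun _ => ContinuousMap.ext

lemma mk_comp_eq_mk_comp {δ δ' : C(I, Cover)} (h : N.mk.comp δ = N.mk.comp δ') :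
    δ = δ' ∨ δ = flipMap.comp δ' := by
  have unique {δ δ' : C(I, Cover)} (h : N.mk.comp δ = N.mk.comp δ') (h0 : δ 0 = δ' 0) : δ = δ' :=
    DFunLike.coe_injective <| isCoveringMap_mk.eq_of_comp_eq δ.continuous δ'.continuous
      (funext (DFunLike.congr_fun h)) 0 h0
  exact (mk_eq_mk.1 (DFunLike.congr_fun h 0)).imp (unique h)
    (unique (h.trans (mk_comp_flipMap_comp δ').symm))

instance : T2Space N := by
  let _ := involutionAction flip flip_involutive
  refine (t2Space_iff_of_isOpenQuotientMap isQuotientCoveringMap_mk.isOpenQuotientMap).2 ?_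
  simp only [mk_eq_mk, Set.ofPred_or]
  exact (isClosed_eq continuous_fst continuous_snd).union
    (isClosed_eq continuous_fst (continuous_flip.comp continuous_snd))

/-- The projection `[z, w, t] ↦ z²` to the circle. -/
def zsq : C(N, Circle) :=
  ⟨Quot.lift (fun x => x.1 ^ (2 : ℤ)) fun a b h => by subst h; ext; simp [flip],
    continuous_quot_lift _ (by fun_prop)⟩

@[simp]
lemma zsq_mk (x : Cover) : zsq (N.mk x) = x.1 ^ (2 : ℤ) := rfl

/-- The function `[z, w, t] ↦ |t|`, the distance from the Klein bottle. -/
def absT : C(N, ℝ) :=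
  ⟨Quot.lift (fun x => |(x.2.2 : ℝ)|) fun a b h => by subst h; simp [flip],
    continuous_quot_lift _ (by fun_prop)⟩

@[simp]
lemma absT_mk (x : Cover) : absT (N.mk x) = |(x.2.2 : ℝ)| := rfl

end N

section CircleInversion

lemma circle_exp_pi : Circle.exp Real.pi = -1 := by
  ext
  simp [Circle.coe_exp]

/-- The discontinuity of the principal argument, in full turns: it fails to be odd only at `-1`. -/
def argJump (w : Circle) : ℤ := if (w : ℂ).arg = Real.pi then 1 else 0

lemma arg_add_arg_inv (w : Circle) :
    (w : ℂ).arg + ((w⁻¹ : Circle) : ℂ).arg = argJump w * (2 * Real.pi) := by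
  rw [Circle.coe_inv, Complex.arg_inv, argJump]
  split_ifs with h
  · rw [h]
    push_cast
    ring
  · simp

lemma argJump_inv (w : Circle) : argJump w⁻¹ = argJump w := by
  have h := arg_add_arg_inv w⁻¹
  rw [inv_inv, add_comm, arg_add_arg_inv w] at h
  exact_mod_cast (mul_right_cancel₀ Real.two_pi_pos.ne' h).symm

lemma wind_inv {γ γ' : C(I, Circle)} (h : ∀ t, γ' t = (γ t)⁻¹) :
    wind γ' = -wind γ - (argJump (γ 1) - argJump (γ 0)) := by
  obtain ⟨l, hl⟩ := exists_exp_lift γ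
  have hwind := wind_eq l hl
  have hwind' := wind_eq (γ := γ') ⟨fun t => -l t, by fun_prop⟩ fun t => by
    simp [Circle.exp_neg, hl, h]
  have harg₀ := arg_add_arg_inv (γ 0)
  have harg₁ := arg_add_arg_inv (γ 1)
  simp only [h, ContinuousMap.coe_mk] at hwind'
  rw [← Int.cast_inj (α := ℝ), ← mul_left_inj' Real.two_pi_pos.ne']
  push_cast
  linarith

/-- A half-open half circle, a fundamental domain of `z ↦ -z`. -/
def halfCircle : Set Circle := {z | 0 < (z : ℂ).im ∨ (z : ℂ).im = 0 ∧ 0 < (z : ℂ).re}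

lemma neg_mem_halfCircle (z : Circle) : -z ∈ halfCircle ↔ z ∉ halfCircle := by
  have hz : ¬((z : ℂ).im = 0 ∧ (z : ℂ).re = 0) := fun h => z.coe_ne_zero (Complex.ext h.2 h.1)
  simp only [halfCircle, Set.mem_ofPred_eq, Circle.coe_neg, Complex.neg_im, Complex.neg_re]
  grind

end CircleInversion

namespace N

variable {A : Type*} [AddCommGroup A]

/-! ### Cocycles on the twisted `I`-bundle -/

/-- The zero of the interval `[-1, 1]`. -/
abbrev mid : Set.Icc (-1 : ℝ) 1 := ⟨0, by norm_num⟩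

/-- The loop of `S¹ × S¹ × [-1, 1]` in the first circle factor, at height `t`. -/
def zLoop (t : Set.Icc (-1 : ℝ) 1) : C(I, Cover) := ⟨fun s => (loop s, 1, t), by fun_prop⟩

/-- The loop of `S¹ × S¹ × [-1, 1]` in the second circle factor, at height `t`. -/
def wLoop (t : Set.Icc (-1 : ℝ) 1) : C(I, Cover) := ⟨fun s => (1, loop s, t), by fun_prop⟩

/-- The first half of `zLoop mid`, which is closed up by the deck transformation. -/
def halfZLoop : C(I, Cover) := ⟨fun s => (Circle.exp (Real.pi * s), 1, mid), by fun_prop⟩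

/-- The closed path in `N` along an exceptional fibre of the Seifert structure over the disc. -/
def pathA : C(I, N) := N.mk.comp halfZLoop

/-- The closed path in `N` along a fibre of the Seifert structure over the Möbius band. -/
def pathB : C(I, N) := N.mk.comp (wLoop mid)

lemma halfZLoop_zero : halfZLoop 0 = (1, 1, mid) := by simp [halfZLoop]

lemma halfZLoop_one : halfZLoop 1 = flip (1, 1, mid) := by simp [halfZLoop, flip, circle_exp_pi]

lemma pathA_closed : pathA 0 = pathA 1 := by
  simp only [pathA, ContinuousMap.comp_apply, halfZLoop_zero, halfZLoop_one, mk_flip]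

lemma cocycle_zLoop {c : C(I, N) → A} (hc : IsCocycleOn Set.univ c) (t : Set.Icc (-1 : ℝ) 1) :
    c (N.mk.comp (zLoop t)) = (2 : ℤ) • c pathA := by
  have hmid : c (N.mk.comp (zLoop t)) = c (N.mk.comp (zLoop mid)) :=
    (hc.comp_univ (N.mk.comp ⟨fun x : Set.Icc (-1 : ℝ) 1 × Circle => (x.2, 1, x.1),
      by fun_prop⟩)).const_prodMk_loop_eq t mid
  have hfirst : (N.mk.comp (zLoop mid)).comp (half false) = pathA := by
    ext s : 1
    simp only [pathA, halfZLoop, zLoop, ContinuousMap.comp_apply, ContinuousMap.coe_mk,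
      loop_apply, half_coe]
    congr 3
    simp
    ring
  have hsecond : (N.mk.comp (zLoop mid)).comp (half true) = pathA := by
    ext s : 1
    simp only [pathA, halfZLoop, zLoop, ContinuousMap.comp_apply, ContinuousMap.coe_mk,
      loop_apply, half_coe]
    rw [← mk_flip]
    have hexp : 2 * Real.pi * ((1 + s) / 2) = Real.pi * s + Real.pi := by ring
    simp [flip, hexp, Circle.exp_add, circle_exp_pi]
  rw [hmid, hc.eq_half_add_half fun _ => trivial, hfirst, hsecond, two_smul]

lemma cocycle_wLoop {c : C(I, N) → A} (hc : IsCocycleOn Set.univ c) (t : Set.Icc (-1 : ℝ) 1) :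
    c (N.mk.comp (wLoop t)) = c pathB :=
  (hc.comp_univ (N.mk.comp ⟨fun x : Set.Icc (-1 : ℝ) 1 × Circle => (1, x.2, x.1),
    by fun_prop⟩)).const_prodMk_loop_eq t mid

/-- The Klein bottle relation `a b a⁻¹ = b⁻¹`. -/
lemma two_smul_cocycle_pathB {c : C(I, N) → A} (hc : IsCocycleOn Set.univ c) :
    (2 : ℤ) • c pathB = 0 := by
  let H : C(I × I, N) :=
    N.mk.comp ⟨fun x => (Circle.exp (Real.pi * x.2), loop x.1, mid), by fun_prop⟩
  let wCircle : C(Circle, N) := N.mk.comp ⟨fun w => (1, w, mid), by fun_prop⟩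
  let invLoop : C(I, Circle) :=
    ContinuousMap.comp ⟨fun z : Circle => z ^ (-1 : ℤ), by fun_prop⟩ loop
  have hside : leftEdge H = rightEdge H := by
    ext t : 1
    simp [H]
  have hbottom : bottomEdge H = pathB := by
    ext t : 1
    simp [H, pathB, wLoop]
  have htop : topEdge H = wCircle.comp invLoop := by
    ext t : 1
    simp only [H, wCircle, invLoop, topEdge_apply, ContinuousMap.comp_apply, ContinuousMap.coe_mk]
    rw [← mk_flip]
    simp [flip, circle_exp_pi]
  have hinv := (hc.comp_univ wCircle).eq_wind_smul (γ := invLoop) (by simp [invLoop])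
  rw [wind_comp_zpow_loop, ← htop, ← hc.bottomEdge_eq_topEdge (fun _ => trivial) hside, hbottom,
    neg_one_zsmul] at hinv
  rw [two_smul, ← eq_neg_iff_add_eq_zero]
  exact hinv

lemma isCoboundaryOn_cover {c : C(I, Cover) → A} (hc : IsCocycleOn Set.univ c)
    (hz : c (zLoop mid) = 0) (hw : c (wLoop mid) = 0) : IsCoboundaryOn Set.univ c := by
  let ψ : C((Set.Icc (-1 : ℝ) 1 × Circle) × Circle, Cover) :=
    ⟨fun x => (x.1.2, x.2, x.1.1), by fun_prop⟩
  let ψ' : C(Set.Icc (-1 : ℝ) 1 × Circle, Cover) := ⟨fun x => (x.2, 1, x.1), by fun_prop⟩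
  have hIcc := ((hc.comp_univ ψ').comp_univ
    ((ContinuousMap.id _).prodMk (.const _ 1))).isCoboundaryOn_Icc (by norm_num)
  have hannulus := (hc.comp_univ ψ').isCoboundaryOn_prod_circle mid hIcc hz
  exact .of_section (T := Set.univ) ψ (fun x : Cover => ((x.2.2, x.1), x.2.1))
    (by fun_prop) (Set.mapsTo_univ _ _) (fun _ _ => rfl)
    ((hc.comp_univ ψ).isCoboundaryOn_prod_circle (mid, 1) hannulus hw)

lemma primitive_flip_sub {c : C(I, N) → A} {g : Cover → A}
    (hg : ∀ δ, c (N.mk.comp δ) = g (δ 1) - g (δ 0)) (x : Cover) : g (flip x) - g x = c pathA := by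
  obtain ⟨δ⟩ := PathConnectedSpace.joined (1, 1, mid) x
  have hδ : g (flip x) - g (flip (1, 1, mid)) = g x - g (1, 1, mid) := by
    simpa [mk_comp_flipMap_comp, hg δ.toContinuousMap, eq_comm] using
      hg (flipMap.comp δ.toContinuousMap)
  rw [pathA, hg, halfZLoop_zero, halfZLoop_one]
  exact sub_eq_sub_iff_sub_eq_sub.1 hδ

lemma isCoboundaryOn_of_paths {c : C(I, N) → A} (hc : IsCocycleOn Set.univ c) (hA : c pathA = 0)
    (hB : c pathB = 0) : IsCoboundaryOn Set.univ c := by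
  obtain ⟨g, hg⟩ := isCoboundaryOn_cover (hc.comp_univ N.mk)
    ((cocycle_zLoop hc mid).trans (by rw [hA, smul_zero])) hB
  replace hg (δ) := hg δ fun _ => trivial
  refine isCoboundaryOn_of_lift N.mk exists_lift hg fun x y hxy => ?_
  rcases mk_eq_mk.1 hxy with rfl | rfl
  · rfl
  · exact sub_eq_zero.1 ((primitive_flip_sub hg y).trans hA)

/-- The correction whose coboundary makes the winding number of the second coordinate invariant,
modulo two, under the deck transformation. -/
def torsionPrimitive (β : A) (x : Cover) : A :=
  (Prod.fst ⁻¹' halfCircle).indicator (fun x : Cover => argJump x.2.1 • β) x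

lemma torsionPrimitive_flip {β : A} (hβ : (2 : ℤ) • β = 0) (x : Cover) :
    torsionPrimitive β (flip x) = torsionPrimitive β x + argJump x.2.1 • β := by
  have htwo : argJump x.2.1 • β + argJump x.2.1 • β = 0 := by
    rw [← two_zsmul, smul_comm, hβ, smul_zero]
  by_cases h : x.1 ∈ halfCircle <;>
    simp [torsionPrimitive, Set.indicator, flip, neg_mem_halfCircle, argJump_inv, h, htwo]

/-- The projection of the double cover to the second circle factor. -/
def coverW : C(Cover, Circle) := ⟨fun x => x.2.1, by fun_prop⟩

/-- The cocycle on the double cover that counts the turns of the second coordinate, with values in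
the multiples of an element of order two. -/
def torsionCocycle (β : A) : C(I, Cover) → A :=
  (fun δ => wind (coverW.comp δ) • β) + coboundary (torsionPrimitive β)

lemma isCocycleOn_torsionCocycle (β : A) : IsCocycleOn Set.univ (torsionCocycle β) :=
  ((isCocycleOn_wind.comp_univ coverW).map (zmultiplesHom A β)).add (isCocycleOn_coboundary _ _)

lemma torsionCocycle_flipMap_comp {β : A} (hβ : (2 : ℤ) • β = 0) (δ : C(I, Cover)) :
    torsionCocycle β (flipMap.comp δ) = torsionCocycle β δ := by
  have hneg (n : ℤ) : -(n • β) = n • β := by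
    rw [neg_eq_iff_add_eq_zero, ← two_zsmul, smul_comm, hβ, smul_zero]
  have hwind : wind (coverW.comp (flipMap.comp δ)) =
      -wind (coverW.comp δ) - (argJump (δ 1).2.1 - argJump (δ 0).2.1) := wind_inv fun _ => rfl
  simp only [torsionCocycle, Pi.add_apply, coboundary, hwind, ContinuousMap.comp_apply,
    flipMap_apply, torsionPrimitive_flip hβ, sub_smul, neg_smul, hneg]
  abel

lemma exists_cocycle_torsion {β : A} (hβ : (2 : ℤ) • β = 0) :
    ∃ d : C(I, N) → A, IsCocycleOn Set.univ d ∧ d pathA = 0 ∧ d pathB = β := by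
  obtain ⟨d, hd, hdmk⟩ := exists_descent isCoveringMap_mk mk_surjective
    (isCocycleOn_torsionCocycle β) fun δ δ' h => by
      rcases mk_comp_eq_mk_comp h with rfl | rfl
      exacts [rfl, torsionCocycle_flipMap_comp hβ δ']
  have hjump : argJump 1 = 0 := by simp [argJump, Real.pi_ne_zero.symm]
  have hA : wind (coverW.comp halfZLoop) = 0 := isCocycleOn_wind.const 1 trivial
  have hB : wind (coverW.comp (wLoop mid)) = 1 := wind_loop
  refine ⟨d, hd, ?_, ?_⟩
  · rw [pathA, hdmk]
    simp [torsionCocycle, coboundary, hA, halfZLoop_zero, halfZLoop_one,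
      torsionPrimitive_flip hβ, hjump]
  · rw [pathB, hdmk]
    simp only [torsionCocycle, Pi.add_apply, hB]
    simp [coboundary, wLoop]

lemma exists_cocycle (α : A) {β : A} (hβ : (2 : ℤ) • β = 0) :
    ∃ d : C(I, N) → A, IsCocycleOn Set.univ d ∧ d pathA = α ∧ d pathB = β := by
  obtain ⟨d, hd, hdA, hdB⟩ := exists_cocycle_torsion hβ
  have hA : zsq.comp pathA = loop := by
    ext t : 1
    simp only [pathA, halfZLoop, ContinuousMap.comp_apply, ContinuousMap.coe_mk, zsq_mk,
      loop_apply, ← Circle.exp_intCast_mul]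
    push_cast
    ring_nf
  have hB : wind (zsq.comp pathB) = 0 := by
    have hconst : zsq.comp pathB = .const I 1 := by
      ext t : 1
      simp [pathB, wLoop]
    rw [hconst, isCocycleOn_wind.const 1 trivial]
  exact ⟨_, ((isCocycleOn_wind.comp_univ zsq).map (zmultiplesHom A α)).add hd,
    by simp [hA, wind_loop, hdA], by simp [hB, hdB]⟩

/-- The inclusion of the boundary torus in `N`. -/
def incl : C(N.bdry, N) := ⟨Subtype.val, continuous_subtype_val⟩

lemma cocycle_phi0 {c : C(I, N) → A} (hc : IsCocycleOn Set.univ c) :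
    c ((incl.comp phi0).comp loop) = c pathB :=
  cocycle_wLoop hc ⟨1, by norm_num⟩

lemma cocycle_phi1 {c : C(I, N) → A} (hc : IsCocycleOn Set.univ c) :
    c ((incl.comp phi1).comp loop) = (2 : ℤ) • c pathA :=
  cocycle_zLoop hc ⟨1, by norm_num⟩

lemma param_injective : Function.Injective N.param := by
  intro x y h
  have hmk : N.mk (x.1, x.2, ⟨1, by norm_num⟩) = N.mk (y.1, y.2, ⟨1, by norm_num⟩) :=
    congrArg Subtype.val h
  rcases mk_eq_mk.1 hmk with hxy | hxy
  · exact Prod.ext (congrArg (fun v : Cover => v.1) hxy) (congrArg (fun v : Cover => v.2.1) hxy)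
  · have ht := congrArg (fun v : Cover => (v.2.2 : ℝ)) hxy
    norm_num [flip] at ht

lemma param_surjective : Function.Surjective N.param := by
  rintro ⟨_, ⟨z, w, t⟩, ht, rfl⟩
  obtain ⟨t, ht'⟩ := t
  obtain rfl | rfl := eq_or_eq_neg_of_abs_eq (show |t| = 1 from ht)
  · exact ⟨(z, w), rfl⟩
  · refine ⟨(-z, w⁻¹), Subtype.ext (Eq.trans ?_ (mk_flip _))⟩
    simp [N.param, flip]

/-- The parametrization of the boundary torus of `N` as a homeomorphism. -/
def paramHomeo : Circle × Circle ≃ₜ N.bdry :=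
  Continuous.homeoOfEquivCompactToT2
    (f := Equiv.ofBijective N.param ⟨param_injective, param_surjective⟩) N.param.continuous

lemma isCoboundaryOn_bdry {c : C(I, N.bdry) → A} (hc : IsCocycleOn Set.univ c)
    (h₀ : c (phi0.comp loop) = 0) (h₁ : c (phi1.comp loop) = 0) : IsCoboundaryOn Set.univ c :=
  .of_section (T := Set.univ) N.param paramHomeo.symm (by fun_prop) (Set.mapsTo_univ _ _)
    (fun x _ => paramHomeo.apply_symm_apply x) ((hc.comp_univ N.param).isCoboundaryOn_torus h₁ h₀)

end N

/-! ### Collars and gluings -/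

section Collars

variable {X Y A : Type*} [TopologicalSpace X] [TopologicalSpace Y] [AddCommGroup A]

lemma IsCocycleOn.isCoboundaryOn_homotopy_sub {S : Set X} {T : Set Y} {c : C(I, Y) → A}
    (hc : IsCocycleOn T c) {f g : C(X, Y)} (F : f.Homotopy g)
    (hF : ∀ x ∈ S, ∀ t, F (t, x) ∈ T) :
    IsCoboundaryOn S fun γ => c (g.comp γ) - c (f.comp γ) := by
  refine ⟨fun x => c ⟨fun t => F (t, x), by fun_prop⟩, fun γ hγ => ?_⟩
  let H : C(I × I, Y) := ⟨fun z => F (z.2, γ z.1), by fun_prop⟩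
  have hbottom : bottomEdge H = f.comp γ := ContinuousMap.ext fun s => F.apply_zero (γ s)
  have htop : topEdge H = g.comp γ := ContinuousMap.ext fun s => F.apply_one (γ s)
  have hsquare := hc.square H fun z => hF _ (hγ _) _
  rw [hbottom, htop, add_comm] at hsquare
  rw [sub_eq_sub_iff_add_eq_add, add_comm]
  exact hsquare.symm

/-- A decomposition of a space into two pieces `P` and `Q` with open neighbourhoods `U` and `V`, and
a single deformation of the whole space that preserves all four sets and retracts `U` into `P` and
`V` into `Q`.  It makes the Mayer-Vietoris argument for `U` and `V` available for `P` and `Q`. -/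
structure CollarPair (P Q : Set X) where
  retract : C(X, X)
  homotopy : (ContinuousMap.id X).Homotopy retract
  U : Set X
  V : Set X
  isOpen_U : IsOpen U
  isOpen_V : IsOpen V
  union_eq : U ∪ V = Set.univ
  subset_U : P ⊆ U
  subset_V : Q ⊆ V
  homotopy_mem_P : ∀ x ∈ P, ∀ t, homotopy (t, x) ∈ P
  homotopy_mem_Q : ∀ x ∈ Q, ∀ t, homotopy (t, x) ∈ Q
  homotopy_mem_U : ∀ x ∈ U, ∀ t, homotopy (t, x) ∈ U
  homotopy_mem_V : ∀ x ∈ V, ∀ t, homotopy (t, x) ∈ V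
  retract_mem_P : ∀ x ∈ U, retract x ∈ P
  retract_mem_Q : ∀ x ∈ V, retract x ∈ Q

namespace CollarPair

variable {P Q : Set X}

lemma exists_isCocycleOn_univ (D : CollarPair P Q) {c d : C(I, X) → A} (hc : IsCocycleOn P c)
    (hd : IsCocycleOn Q d) (h : ∀ γ : C(I, X), (∀ t, γ t ∈ P ∩ Q) → c γ = d γ) :
    ∃ e : C(I, X) → A, IsCocycleOn Set.univ e ∧ IsCoboundaryOn P (e - c) ∧
      IsCoboundaryOn Q (e - d) := by
  obtain ⟨e, he, heU, heV⟩ := exists_isCocycleOn_union D.isOpen_U D.isOpen_V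
    (hc.comp D.retract D.retract_mem_P) (hd.comp D.retract D.retract_mem_Q)
    fun γ hγ => h _ fun t => ⟨D.retract_mem_P _ (hγ t).1, D.retract_mem_Q _ (hγ t).2⟩
  rw [D.union_eq] at he
  refine ⟨e, he,
    (hc.isCoboundaryOn_homotopy_sub D.homotopy D.homotopy_mem_P).congr fun γ hγ => ?_,
    (hd.isCoboundaryOn_homotopy_sub D.homotopy D.homotopy_mem_Q).congr fun γ hγ => ?_⟩
  · rw [Pi.sub_apply, heU γ fun t => D.subset_U (hγ t), ContinuousMap.id_comp]
  · rw [Pi.sub_apply, heV γ fun t => D.subset_V (hγ t), ContinuousMap.id_comp]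

lemma isCoboundaryOn_of_retract (D : CollarPair P Q) {S T : Set X} {c : C(I, X) → A}
    (hc : IsCocycleOn S c) (hT : IsCoboundaryOn T c) (hS : ∀ x ∈ S, ∀ t, D.homotopy (t, x) ∈ S)
    (hST : ∀ x ∈ S, D.retract x ∈ T) : IsCoboundaryOn S c :=
  ((hT.comp D.retract hST).add (hc.isCoboundaryOn_homotopy_sub D.homotopy hS).neg).congr
    fun γ _ => by simp

lemma isCoboundaryOn_univ (D : CollarPair P Q)
    (hPQ : ∀ x ∈ P ∩ Q, ∀ y ∈ P ∩ Q, JoinedIn (P ∩ Q) x y) {c : C(I, X) → A}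
    (hc : IsCocycleOn Set.univ c) (hP : IsCoboundaryOn P c) (hQ : IsCoboundaryOn Q c) :
    IsCoboundaryOn Set.univ c := by
  have hU := D.isCoboundaryOn_of_retract (hc.mono (Set.subset_univ _)) hP D.homotopy_mem_U
    D.retract_mem_P
  have hV := D.isCoboundaryOn_of_retract (hc.mono (Set.subset_univ _)) hQ D.homotopy_mem_V
    D.retract_mem_Q
  have joined_retract (x) (hx : x ∈ D.U ∩ D.V) : JoinedIn (D.U ∩ D.V) x (D.retract x) :=
    ⟨D.homotopy.evalAt x, fun t => ⟨D.homotopy_mem_U _ hx.1 t, D.homotopy_mem_V _ hx.2 t⟩⟩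
  have retract_mem (x) (hx : x ∈ D.U ∩ D.V) : D.retract x ∈ P ∩ Q :=
    ⟨D.retract_mem_P _ hx.1, D.retract_mem_Q _ hx.2⟩
  rw [← D.union_eq] at hc ⊢
  refine hc.isCoboundaryOn_union D.isOpen_U D.isOpen_V (fun x hx y hy => ?_) hU hV
  have hxy := (hPQ _ (retract_mem x hx) _ (retract_mem y hy)).mono
    (Set.inter_subset_inter D.subset_U D.subset_V)
  exact ((joined_retract x hx).trans hxy).trans (joined_retract y hy).symm

end CollarPair

/-- A collar `W` of a subspace `S`, in the form of a deformation of the whole space that fixes `S`,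
preserves `W` and retracts `W` onto `S`. -/
structure BdryCollar (S : Set X) where
  retract : C(X, X)
  homotopy : (ContinuousMap.id X).Homotopy retract
  W : Set X
  isOpen_W : IsOpen W
  subset_W : S ⊆ W
  homotopy_eq : ∀ x ∈ S, ∀ t, homotopy (t, x) = x
  homotopy_mem_W : ∀ x ∈ W, ∀ t, homotopy (t, x) ∈ W
  retract_mem : ∀ x ∈ W, retract x ∈ S

end Collars

section Embedding

variable {X Y A : Type*} [TopologicalSpace X] [TopologicalSpace Y] [AddCommGroup A] [Nonempty X]

lemma continuousOn_invFun {f : X → Y} (hf : Topology.IsEmbedding f) :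
    ContinuousOn (Function.invFun f) (Set.range f) := by
  rw [continuousOn_iff_continuous_domRestrict]
  refine hf.toHomeomorph.symm.continuous.congr ?_
  rintro ⟨_, x, rfl⟩
  rw [Set.domRestrict_apply, Function.leftInverse_invFun hf.injective]
  exact hf.toHomeomorph.symm_apply_apply x

lemma IsCocycleOn.exists_range {c : C(I, X) → A} (hc : IsCocycleOn Set.univ c) (f : C(X, Y))
    (hf : Topology.IsEmbedding f) :
    ∃ d : C(I, Y) → A, IsCocycleOn (Set.range f) d ∧ ∀ γ, d (f.comp γ) = c γ := by
  obtain ⟨d, hd, h⟩ := hc.exists_pullback (continuousOn_invFun hf) (Set.mapsTo_univ _ _)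
  exact ⟨d, hd, fun γ => h _ _ (fun t => ⟨γ t, rfl⟩) fun t =>
    (Function.leftInverse_invFun hf.injective _).symm⟩

lemma IsCoboundaryOn.range {c : C(I, Y) → A} (f : C(X, Y)) (hf : Topology.IsEmbedding f)
    (hc : IsCoboundaryOn Set.univ fun γ => c (f.comp γ)) : IsCoboundaryOn (Set.range f) c := by
  refine .of_section f _ (continuousOn_invFun hf) (Set.mapsTo_univ _ _) ?_ hc
  rintro _ ⟨x, rfl⟩
  rw [Function.leftInverse_invFun hf.injective]

end Embedding

namespace Glue

variable {P Q : Type} [TopologicalSpace P] [TopologicalSpace Q] {S : Set P} {T : Set Q}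
  (h : T ≃ₜ S)

/-- The map of the first piece to a glued space. -/
def inl : C(P, Glue h) := ⟨fun x => Quot.mk _ (.inl x), continuous_quot_mk.comp continuous_inl⟩

/-- The map of the second piece to a glued space. -/
def inr : C(Q, Glue h) := ⟨fun x => Quot.mk _ (.inr x), continuous_quot_mk.comp continuous_inr⟩

lemma inl_eq_inr (t : T) : inl h (h t : P) = inr h t := Quot.sound ⟨t, rfl, rfl⟩

variable {h} in
lemma ind {p : Glue h → Prop} (hl : ∀ x, p (inl h x)) (hr : ∀ x, p (inr h x)) (x : Glue h) :
    p x := by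
  obtain ⟨y | y, rfl⟩ := Quot.exists_rep x
  · exact hl y
  · exact hr y

/-- The continuous map on a glued space that is given by `f` and `g` on the two pieces. -/
def lift {Z : Type*} [TopologicalSpace Z] (f : C(P, Z)) (g : C(Q, Z))
    (hfg : ∀ t : T, f (h t) = g t) : C(Glue h, Z) :=
  ⟨Quot.lift (Sum.elim f g) (by rintro _ _ ⟨t, rfl, rfl⟩; exact hfg t),
    continuous_quot_lift _ (by fun_prop)⟩

/-- The exchange of the two pieces of a glued space. -/
def swap : Glue h ≃ₜ Glue h.symm where
  toFun := lift h (inr h.symm) (inl h.symm) fun t => by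
    simpa using (inl_eq_inr h.symm (h t)).symm
  invFun := lift h.symm (inr h) (inl h) fun s => by
    simpa using (inl_eq_inr h (h.symm s)).symm
  left_inv := ind (fun _ => rfl) fun _ => rfl
  right_inv := ind (fun _ => rfl) fun _ => rfl

lemma isQuotientMap_elim : Topology.IsQuotientMap (Sum.elim (inl h) (inr h)) := by
  have : Sum.elim (inl h) (inr h) = Quot.mk _ := by ext (x | y) <;> rfl
  exact this ▸ isQuotientMap_quot_mk

/-- The set of points of the first piece that represent a given point of a glued space. -/
def trace : Glue h → Set P :=
  Quot.lift (Sum.elim ({·}) fun y => (fun t : T => (h t : P)) '' (Subtype.val ⁻¹' {y})) (by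
    rintro _ _ ⟨t, rfl, rfl⟩
    have : (Subtype.val ⁻¹' {(t : Q)} : Set T) = {t} := by ext; simp [Subtype.ext_iff]
    simp [this])

lemma inl_injective : Function.Injective (inl h) := fun _ _ hxy =>
  Set.singleton_injective (congrArg (trace h) hxy)

lemma inr_injective : Function.Injective (inr h) :=
  (swap h.symm).injective.comp (inl_injective h.symm)

lemma exists_eq_of_inl_eq_inr {x : P} {y : Q} (hxy : inl h x = inr h y) :
    ∃ t : T, (h t : P) = x ∧ (t : Q) = y := by
  have hx : x ∈ trace h (inr h y) := hxy ▸ Set.mem_singleton x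
  obtain ⟨t, ht, htx⟩ := hx
  exact ⟨t, htx, ht⟩

lemma preimage_inr_image_inl (C : Set P) :
    inr h ⁻¹' (inl h '' C) = Subtype.val '' ((fun t : T => (h t : P)) ⁻¹' C) := by
  ext y
  constructor
  · rintro ⟨x, hx, hxy⟩
    obtain ⟨t, rfl, rfl⟩ := exists_eq_of_inl_eq_inr h hxy
    exact ⟨t, hx, rfl⟩
  · rintro ⟨t, ht, rfl⟩
    exact ⟨_, ht, inl_eq_inr h t⟩

lemma isClosedEmbedding_inl (hT : IsClosed T) : Topology.IsClosedEmbedding (inl h) := by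
  refine .of_continuous_injective_isClosedMap (inl h).continuous (inl_injective h) fun C hC => ?_
  refine (isQuotientMap_elim h).isClosed_preimage.1 (isClosed_sum_iff.2 ⟨?_, ?_⟩)
  · change IsClosed (inl h ⁻¹' (inl h '' C))
    rwa [Set.preimage_image_eq C (inl_injective h)]
  · change IsClosed (inr h ⁻¹' (inl h '' C))
    rw [preimage_inr_image_inl]
    exact hT.isClosedEmbedding_subtypeVal.isClosedMap _ (hC.preimage (by fun_prop))

lemma isClosedEmbedding_inr (hS : IsClosed S) : Topology.IsClosedEmbedding (inr h) :=
  (swap h.symm).isClosedEmbedding.comp (isClosedEmbedding_inl h.symm hS)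

lemma isOpen_range_inl_union {W : Set Q} (hW : IsOpen W) (hTW : T ⊆ W) :
    IsOpen (Set.range (inl h) ∪ inr h '' W) := by
  refine (isQuotientMap_elim h).isOpen_preimage.1 (isOpen_sum_iff.2 ⟨?_, ?_⟩)
  · change IsOpen (inl h ⁻¹' (Set.range (inl h) ∪ inr h '' W))
    rw [Set.preimage_union, Set.preimage_range, Set.univ_union]
    exact isOpen_univ
  · change IsOpen (inr h ⁻¹' (Set.range (inl h) ∪ inr h '' W))
    rw [Set.preimage_union, Set.preimage_image_eq _ (inr_injective h), ← Set.image_univ,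
      preimage_inr_image_inl, Set.preimage_univ, Set.image_univ, Subtype.range_coe,
      Set.union_eq_right.2 hTW]
    exact hW

lemma isOpen_range_inr_union {W : Set P} (hW : IsOpen W) (hSW : S ⊆ W) :
    IsOpen (Set.range (inr h) ∪ inl h '' W) := by
  have := (swap h.symm).isOpenMap _ (isOpen_range_inl_union h.symm hW hSW)
  rwa [Set.image_union, ← Set.range_comp, ← Set.image_comp] at this

variable (T) in
/-- The inclusion in the second piece of the subspace along which a space is glued. -/
def seamRight : C(T, Q) := ⟨Subtype.val, continuous_subtype_val⟩

/-- The map to the first piece of the subspace along which a space is glued. -/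
def seamLeft : C(T, P) := ⟨fun t => h t, by fun_prop⟩

lemma inl_comp_seamLeft : (inl h).comp (seamLeft h) = (inr h).comp (seamRight T) :=
  ContinuousMap.ext (inl_eq_inr h)

lemma range_inter_range :
    Set.range (inl h) ∩ Set.range (inr h) = Set.range ((inr h).comp (seamRight T)) := by
  ext x
  constructor
  · rintro ⟨⟨y, rfl⟩, ⟨z, hz⟩⟩
    obtain ⟨t, rfl, rfl⟩ := exists_eq_of_inl_eq_inr h hz.symm
    exact ⟨t, hz⟩
  · rintro ⟨t, rfl⟩
    exact ⟨⟨_, inl_eq_inr h t⟩, _, rfl⟩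

lemma exists_eq_comp_seam (hS : IsClosed S) {γ : C(I, Glue h)}
    (hγ : ∀ t, γ t ∈ Set.range (inl h) ∩ Set.range (inr h)) :
    ∃ δ : C(I, T), γ = ((inr h).comp (seamRight T)).comp δ := by
  have hemb : Topology.IsEmbedding ((inr h).comp (seamRight T)) :=
    (isClosedEmbedding_inr h hS).isEmbedding.comp .subtypeVal
  rw [range_inter_range] at hγ
  refine ⟨⟨fun t => hemb.toHomeomorph.symm ⟨γ t, hγ t⟩, by fun_prop⟩, ContinuousMap.ext fun t => ?_⟩
  exact congrArg Subtype.val (hemb.toHomeomorph.apply_symm_apply ⟨γ t, hγ t⟩).symm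

section Collar

variable (DS : BdryCollar S) (DT : BdryCollar T)

/-- The map of a glued space that is given by the collar retractions on the two pieces. -/
def retract : C(Glue h, Glue h) :=
  lift h ((inl h).comp DS.retract) ((inr h).comp DT.retract) fun t => by
    rw [ContinuousMap.comp_apply, ContinuousMap.comp_apply, ← DS.homotopy.apply_one,
      ← DT.homotopy.apply_one, DS.homotopy_eq _ (h t).2, DT.homotopy_eq _ t.2, inl_eq_inr]

/-- The homotopy from the identity to `Glue.retract` that is given by the collar deformations on the
two pieces. -/
def homotopy : (ContinuousMap.id (Glue h)).Homotopy (retract h DS DT) :=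
  let K : C(Glue h, C(I, Glue h)) := lift h
    ((inl h).comp (DS.homotopy.toContinuousMap.comp .prodSwap)).curry
    ((inr h).comp (DT.homotopy.toContinuousMap.comp .prodSwap)).curry fun t => by
      ext s : 1
      change inl h (DS.homotopy (s, h t)) = inr h (DT.homotopy (s, t))
      rw [DS.homotopy_eq _ (h t).2, DT.homotopy_eq _ t.2, inl_eq_inr]
  { toFun := fun z => K z.2 z.1
    map_zero_left := ind (fun x => congrArg (inl h) (DS.homotopy.apply_zero x)) fun x =>
      congrArg (inr h) (DT.homotopy.apply_zero x)
    map_one_left := ind (fun x => congrArg (inl h) (DS.homotopy.apply_one x)) fun x =>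
      congrArg (inr h) (DT.homotopy.apply_one x) }

lemma homotopy_inl (t : I) (x : P) :
    homotopy h DS DT (t, inl h x) = inl h (DS.homotopy (t, x)) := rfl

lemma homotopy_inr (t : I) (x : Q) :
    homotopy h DS DT (t, inr h x) = inr h (DT.homotopy (t, x)) := rfl

lemma retract_inl (x : P) : retract h DS DT (inl h x) = inl h (DS.retract x) := rfl

lemma retract_inr (x : Q) : retract h DS DT (inr h x) = inr h (DT.retract x) := rfl

/-- The decomposition of a space glued along collared subspaces into the two pieces. -/
def collarPair : CollarPair (Set.range (inl h)) (Set.range (inr h)) where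
  retract := retract h DS DT
  homotopy := homotopy h DS DT
  U := Set.range (inl h) ∪ inr h '' DT.W
  V := Set.range (inr h) ∪ inl h '' DS.W
  isOpen_U := isOpen_range_inl_union h DT.isOpen_W DT.subset_W
  isOpen_V := isOpen_range_inr_union h DS.isOpen_W DS.subset_W
  union_eq := Set.eq_univ_of_forall
    (ind (fun x => .inl (.inl ⟨x, rfl⟩)) fun x => .inr (.inl ⟨x, rfl⟩))
  subset_U := Set.subset_union_left
  subset_V := Set.subset_union_left
  homotopy_mem_P := by rintro _ ⟨x, rfl⟩ t; exact ⟨_, (homotopy_inl ..).symm⟩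
  homotopy_mem_Q := by rintro _ ⟨x, rfl⟩ t; exact ⟨_, (homotopy_inr ..).symm⟩
  homotopy_mem_U := by
    rintro _ (⟨x, rfl⟩ | ⟨x, hx, rfl⟩) t
    · exact .inl ⟨_, (homotopy_inl ..).symm⟩
    · exact .inr ⟨_, DT.homotopy_mem_W x hx t, (homotopy_inr ..).symm⟩
  homotopy_mem_V := by
    rintro _ (⟨x, rfl⟩ | ⟨x, hx, rfl⟩) t
    · exact .inl ⟨_, (homotopy_inr ..).symm⟩
    · exact .inr ⟨_, DS.homotopy_mem_W x hx t, (homotopy_inl ..).symm⟩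
  retract_mem_P := by
    rintro _ (⟨x, rfl⟩ | ⟨x, hx, rfl⟩)
    · exact ⟨_, (retract_inl ..).symm⟩
    · rw [retract_inr]
      exact ⟨_, inl_eq_inr h ⟨_, DT.retract_mem x hx⟩⟩
  retract_mem_Q := by
    rintro _ (⟨x, rfl⟩ | ⟨x, hx, rfl⟩)
    · exact ⟨_, (retract_inr ..).symm⟩
    · obtain ⟨t, ht⟩ := h.surjective ⟨_, DS.retract_mem x hx⟩
      rw [retract_inl, ← show (h t : P) = DS.retract x from congrArg Subtype.val ht, inl_eq_inr]
      exact ⟨_, rfl⟩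

end Collar

variable {A : Type*} [AddCommGroup A] [Nonempty P] [Nonempty Q]

lemma exists_cocycle_of_eq (DS : BdryCollar S) (DT : BdryCollar T)
    (hS : IsClosed S) (hT : IsClosed T) {c : C(I, P) → A} {d : C(I, Q) → A}
    (hc : IsCocycleOn Set.univ c) (hd : IsCocycleOn Set.univ d)
    (hcd : ∀ γ : C(I, T), c ((seamLeft h).comp γ) = d ((seamRight T).comp γ)) :
    ∃ e : C(I, Glue h) → A, IsCocycleOn Set.univ e ∧
      IsCoboundaryOn Set.univ (fun γ => e ((inl h).comp γ) - c γ) ∧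
      IsCoboundaryOn Set.univ (fun γ => e ((inr h).comp γ) - d γ) := by
  obtain ⟨c', hc', hcc'⟩ := hc.exists_range (inl h) (isClosedEmbedding_inl h hT).isEmbedding
  obtain ⟨d', hd', hdd'⟩ := hd.exists_range (inr h) (isClosedEmbedding_inr h hS).isEmbedding
  obtain ⟨e, he, hel, her⟩ := (collarPair h DS DT).exists_isCocycleOn_univ hc' hd' fun γ hγ => by
    obtain ⟨δ, rfl⟩ := exists_eq_comp_seam h hS hγ
    rw [← inl_comp_seamLeft, ContinuousMap.comp_assoc, hcc', hcd, ← hdd',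
      ← ContinuousMap.comp_assoc, ← inl_comp_seamLeft, ContinuousMap.comp_assoc]
  refine ⟨e, he, (hel.comp (S := Set.univ) (inl h) fun x _ => ⟨x, rfl⟩).congr fun γ _ => ?_,
    (her.comp (S := Set.univ) (inr h) fun x _ => ⟨x, rfl⟩).congr fun γ _ => ?_⟩
  · rw [Pi.sub_apply, hcc']
  · rw [Pi.sub_apply, hdd']

lemma exists_cocycle (DS : BdryCollar S) (DT : BdryCollar T)
    (hS : IsClosed S) (hT : IsClosed T) {c : C(I, P) → A} {d : C(I, Q) → A}
    (hc : IsCocycleOn Set.univ c) (hd : IsCocycleOn Set.univ d)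
    (hcd : IsCoboundaryOn Set.univ fun γ : C(I, T) =>
      c ((seamLeft h).comp γ) - d ((seamRight T).comp γ)) :
    ∃ e : C(I, Glue h) → A, IsCocycleOn Set.univ e ∧
      IsCoboundaryOn Set.univ (fun γ => e ((inl h).comp γ) - c γ) ∧
      IsCoboundaryOn Set.univ (fun γ => e ((inr h).comp γ) - d γ) := by
  obtain ⟨g, hg⟩ := hcd
  let g' : Q → A := Function.extend Subtype.val g 0
  have hg' (t : T) : g' t = g t := Subtype.val_injective.extend_apply g 0 t
  obtain ⟨e, he, hel, her⟩ := exists_cocycle_of_eq h DS DT hS hT hc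
    (hd.add (isCocycleOn_coboundary g' _)) fun γ => by
      have hγ := (hg γ fun _ => trivial).trans (congrArg₂ (· - ·) (hg' _) (hg' _)).symm
      exact sub_eq_iff_eq_add'.1 hγ
  refine ⟨e, he, hel, (her.add (isCoboundaryOn_coboundary g' _)).congr fun γ _ => ?_⟩
  simp only [Pi.add_apply]
  abel

lemma isCoboundaryOn_univ [PathConnectedSpace T] (DS : BdryCollar S)
    (DT : BdryCollar T) (hS : IsClosed S) (hT : IsClosed T) {e : C(I, Glue h) → A}
    (he : IsCocycleOn Set.univ e) (hl : IsCoboundaryOn Set.univ fun γ => e ((inl h).comp γ))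
    (hr : IsCoboundaryOn Set.univ fun γ => e ((inr h).comp γ)) : IsCoboundaryOn Set.univ e := by
  refine (collarPair h DS DT).isCoboundaryOn_univ ?_ he
    (hl.range _ (isClosedEmbedding_inl h hT).isEmbedding)
    (hr.range _ (isClosedEmbedding_inr h hS).isEmbedding)
  rw [range_inter_range]
  exact fun x hx y hy =>
    (isPathConnected_range ((inr h).comp (seamRight T)).continuous).joinedIn x hx y hy

end Glue

namespace N

/-- The point `(1 + s) t` of the line, clamped to `[-1, 1]`. -/
def stretch (s : I) (t : Set.Icc (-1 : ℝ) 1) : Set.Icc (-1 : ℝ) 1 :=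
  Set.projIcc (-1) 1 (by norm_num) ((1 + s) * t)

lemma stretch_zero (t : Set.Icc (-1 : ℝ) 1) : stretch 0 t = t := by simp [stretch]

lemma stretch_neg (s : I) (t : Set.Icc (-1 : ℝ) 1) :
    (stretch s ⟨-t, neg_le_neg t.2.2, neg_le.mp t.2.1⟩ : ℝ) = -(stretch s t : ℝ) := by
  simp only [stretch, Set.coe_projIcc, mul_neg]
  grind

lemma abs_stretch (s : I) (t : Set.Icc (-1 : ℝ) 1) :
    |(stretch s t : ℝ)| = min 1 ((1 + s) * |(t : ℝ)|) := by
  have abs_clamp (r : ℝ) : |max (-1) (min 1 r)| = min 1 |r| := by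
    rw [abs_eq_max_neg, abs_eq_max_neg]
    grind
  rw [stretch, Set.coe_projIcc, abs_clamp, abs_mul, abs_of_nonneg (add_nonneg zero_le_one s.2.1)]

lemma stretch_of_abs_eq_one (s : I) {t : Set.Icc (-1 : ℝ) 1} (ht : |(t : ℝ)| = 1) :
    stretch s t = t := by
  have hs := s.2.1
  refine Subtype.ext ?_
  rw [stretch, Set.coe_projIcc]
  obtain ht | ht := eq_or_eq_neg_of_abs_eq ht <;> rw [ht] <;> grind

/-- The deformation of the covering space `S¹ × S¹ × [-1, 1]`, pushed down to `N`, that stretches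
the interval coordinate. -/
def stretchCover : C(Cover × I, N) :=
  N.mk.comp ⟨fun x => (x.1.1, x.1.2.1, stretch x.2 x.1.2.2), by unfold stretch; fun_prop⟩

lemma stretchCover_flip (x : Cover) (s : I) :
    stretchCover (flip x, s) = stretchCover (x, s) := by
  refine Eq.trans (congrArg N.mk ?_) (mk_flip _)
  exact Prod.ext rfl (Prod.ext rfl (Subtype.ext (stretch_neg s x.2.2)))

/-- The deformation of `N` that stretches the interval coordinate. -/
def deform : C(I × N, N) :=
  let K : C(N, C(I, N)) :=
    ⟨Quot.lift stretchCover.curry fun x y hxy => by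
      subst hxy
      exact ContinuousMap.ext fun s => (stretchCover_flip x s).symm,
    continuous_quot_lift _ stretchCover.curry.continuous⟩
  ⟨fun z => K z.2 z.1, by fun_prop⟩

lemma deform_mk (s : I) (x : Cover) :
    deform (s, N.mk x) = N.mk (x.1, x.2.1, stretch s x.2.2) := rfl

lemma absT_deform (s : I) (x : N) : absT (deform (s, x)) = min 1 ((1 + s) * absT x) := by
  obtain ⟨y, rfl⟩ := mk_surjective x
  rw [deform_mk, absT_mk, absT_mk, abs_stretch]

lemma mem_bdry_iff (x : N) : x ∈ N.bdry ↔ absT x = 1 := by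
  constructor
  · rintro ⟨y, hy, rfl⟩
    exact hy
  · obtain ⟨y, rfl⟩ := mk_surjective x
    exact fun hy => ⟨y, hy, rfl⟩

/-- The collar `|t| > 1/2` of the boundary of `N`. -/
def bdryCollar : BdryCollar N.bdry where
  retract := ⟨fun x => deform (1, x), by fun_prop⟩
  homotopy :=
    { toContinuousMap := deform
      map_zero_left x := by
        obtain ⟨y, rfl⟩ := mk_surjective x
        exact congrArg (fun t => N.mk (y.1, y.2.1, t)) (stretch_zero _)
      map_one_left _ := rfl }
  W := {x | 1 / 2 < absT x}
  isOpen_W := isOpen_lt continuous_const absT.continuous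
  subset_W x hx := by
    rw [mem_bdry_iff] at hx
    rw [Set.mem_ofPred_eq, hx]
    norm_num
  homotopy_eq x hx s := by
    obtain ⟨y, rfl⟩ := mk_surjective x
    rw [mem_bdry_iff, absT_mk] at hx
    exact congrArg (fun t => N.mk (y.1, y.2.1, t)) (stretch_of_abs_eq_one s hx)
  homotopy_mem_W x (hx : 1 / 2 < absT x) s := by
    change 1 / 2 < absT (deform (s, x))
    rw [absT_deform]
    exact lt_min (by norm_num) (by nlinarith [s.2.1])
  retract_mem x (hx : 1 / 2 < absT x) := by
    change deform (1, x) ∈ N.bdry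
    rw [mem_bdry_iff, absT_deform, min_eq_left]
    rw [Set.Icc.coe_one]
    linarith

lemma isClosed_bdry : IsClosed N.bdry := by
  have : N.bdry = {x | absT x = 1} := Set.ext mem_bdry_iff
  rw [this]
  exact isClosed_eq absT.continuous continuous_const

instance : PathConnectedSpace N.bdry :=
  param_surjective.pathConnectedSpace N.param.continuous

end N

/-! ### Knot exteriors -/

section Radial

/-- A radial scaling factor: `radial r * r` is `1` for `1 / 2 ≤ r ≤ 3 / 2` and `r` for `2 ≤ r`. -/
def radial (r : ℝ) : ℝ := max (max r (1 / 2))⁻¹ (min 1 (2 - 2 * (max r (1 / 2))⁻¹))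

lemma inv_max_half_pos (r : ℝ) : 0 < (max r (1 / 2))⁻¹ :=
  inv_pos.2 (lt_max_of_lt_right (by norm_num))

lemma continuous_radial : Continuous radial := by
  have : Continuous fun r : ℝ => (max r (1 / 2))⁻¹ :=
    Continuous.inv₀ (by fun_prop) fun r => (inv_pos.1 (inv_max_half_pos r)).ne'
  unfold radial
  fun_prop

lemma radial_nonneg (r : ℝ) : 0 ≤ radial r :=
  le_max_of_le_left (inv_max_half_pos r).le

lemma radial_of_two_le {r : ℝ} (hr : 2 ≤ r) : radial r = 1 := by
  have hinv : r⁻¹ ≤ 1 / 2 := by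
    rw [one_div]
    exact inv_anti₀ two_pos hr
  rw [radial, max_eq_left (by linarith : 1 / 2 ≤ r), min_eq_left (by linarith),
    max_eq_right (by linarith)]

lemma radial_mul_le {r : ℝ} (hr : r ≤ 3 / 2) : radial r * r ≤ 1 := by
  have hm : 0 < max r (1 / 2) := inv_pos.1 (inv_max_half_pos r)
  have hinv : 2 / 3 ≤ (max r (1 / 2))⁻¹ := by
    rw [le_inv_comm₀ (by norm_num) hm]
    norm_num [hr]
  rw [radial, max_eq_left ((min_le_right _ _).trans (by linarith)), inv_mul_le_one₀ hm]
  exact le_max_left _ _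

lemma le_radial_mul {r : ℝ} (hr : 1 / 2 ≤ r) : 1 ≤ radial r * r := by
  have hpos : 0 < r := by linarith
  rw [← inv_le_iff_one_le_mul₀ hpos, radial, max_eq_left hr]
  exact le_max_left _ _

/-- The deformation of the open solid torus from the identity to the radial rescaling by
`radial`. -/
def radialMap (x : I × (Circle × ℂ)) : Circle × ℂ :=
  (x.2.1, (((1 - x.1) + x.1 * radial ‖x.2.2‖ : ℝ) : ℂ) * x.2.2)

lemma continuous_radialMap : Continuous radialMap := by
  have := continuous_radial
  unfold radialMap
  fun_prop

lemma norm_radialMap (s : I) (y : Circle × ℂ) :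
    ‖(radialMap (s, y)).2‖ = (1 - s) * ‖y.2‖ + s * (radial ‖y.2‖ * ‖y.2‖) := by
  have hfactor : 0 ≤ (1 - s) + s * radial ‖y.2‖ :=
    add_nonneg (sub_nonneg.2 s.2.2) (mul_nonneg s.2.1 (radial_nonneg _))
  rw [radialMap, norm_mul, Complex.norm_real, Real.norm_of_nonneg hfactor]
  ring

lemma radialMap_zero (y : Circle × ℂ) : radialMap (0, y) = y := by
  simp [radialMap]

lemma radialMap_of_radial_eq_one (s : I) {y : Circle × ℂ} (hy : radial ‖y.2‖ = 1) :
    radialMap (s, y) = y := by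
  simp [radialMap, hy]

lemma radialMap_of_norm_eq_one (s : I) {y : Circle × ℂ} (hy : ‖y.2‖ = 1) :
    radialMap (s, y) = y := by
  refine radialMap_of_radial_eq_one s (le_antisymm ?_ ?_)
  · simpa [hy] using radial_mul_le (r := ‖y.2‖) (by norm_num [hy])
  · simpa [hy] using le_radial_mul (r := ‖y.2‖) (by norm_num [hy])

lemma norm_radialMap_le_one (s : I) {y : Circle × ℂ} (hy : ‖y.2‖ ≤ 1) :
    ‖(radialMap (s, y)).2‖ ≤ 1 := by
  have := radial_mul_le (r := ‖y.2‖) (by linarith)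
  rw [norm_radialMap]
  nlinarith [s.2.1, s.2.2]

lemma one_le_norm_radialMap (s : I) {y : Circle × ℂ} (hy : 1 ≤ ‖y.2‖) :
    1 ≤ ‖(radialMap (s, y)).2‖ := by
  have := le_radial_mul (r := ‖y.2‖) (by linarith)
  rw [norm_radialMap]
  nlinarith [s.2.1, s.2.2]

lemma norm_radialMap_lt (s : I) {y : Circle × ℂ} (hy : ‖y.2‖ < 3 / 2) :
    ‖(radialMap (s, y)).2‖ < 3 / 2 := by
  have := radial_mul_le (r := ‖y.2‖) hy.le
  rw [norm_radialMap]
  rcases le_total ‖y.2‖ 1 with h | h <;> nlinarith [s.2.1, s.2.2]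

lemma lt_norm_radialMap (s : I) {y : Circle × ℂ} (hy : 1 / 2 < ‖y.2‖) :
    1 / 2 < ‖(radialMap (s, y)).2‖ := by
  have := le_radial_mul hy.le
  rw [norm_radialMap]
  rcases le_total ‖y.2‖ 1 with h | h <;> nlinarith [s.2.1, s.2.2]

lemma norm_radialMap_one (y : Circle × ℂ) : ‖(radialMap (1, y)).2‖ = radial ‖y.2‖ * ‖y.2‖ := by
  rw [norm_radialMap, Set.Icc.coe_one, sub_self, zero_mul, zero_add, one_mul]

end Radial

namespace TubularNbhd

variable {J : C(Circle, S3)} (τ : TubularNbhd J)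

lemma injective : Function.Injective τ.toFun := τ.isOpenEmbedding.injective

/-- The closed solid torus of radius `R` around the knot. -/
def closedTube (R : ℝ) : Set S3 := τ.toFun '' {y | ‖y.2‖ ≤ R}

/-- The open solid torus of radius `R` around the knot. -/
def openTube (R : ℝ) : Set S3 := τ.toFun '' {y | ‖y.2‖ < R}

variable {τ} in
lemma mem_closedTube_iff {R : ℝ} {y : Circle × ℂ} : τ.toFun y ∈ τ.closedTube R ↔ ‖y.2‖ ≤ R :=
  τ.injective.mem_set_image

variable {τ} in
lemma mem_openTube_iff {R : ℝ} {y : Circle × ℂ} : τ.toFun y ∈ τ.openTube R ↔ ‖y.2‖ < R :=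
  τ.injective.mem_set_image

variable {τ} in
lemma mem_exterior_iff {y : Circle × ℂ} : τ.toFun y ∈ τ.exterior ↔ 1 ≤ ‖y.2‖ :=
  mem_openTube_iff.not.trans not_lt

variable {τ} in
lemma mem_range_knot_iff {y : Circle × ℂ} : τ.toFun y ∈ Set.range J ↔ y.2 = 0 := by
  constructor
  · rintro ⟨z, hz⟩
    rw [← τ.core z] at hz
    exact (congrArg Prod.snd (τ.injective hz)).symm
  · intro hy
    exact ⟨y.1, by rw [← τ.core, ← hy]⟩

lemma range_knot_subset : Set.range J ⊆ Set.range τ.toFun := by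
  rintro _ ⟨z, rfl⟩
  exact ⟨_, τ.core z⟩

lemma closedTube_subset_openTube {R R' : ℝ} (h : R < R') : τ.closedTube R ⊆ τ.openTube R' :=
  Set.image_mono fun _ hy => lt_of_le_of_lt hy h

lemma isCompact_closedTube (R : ℝ) : IsCompact (τ.closedTube R) := by
  have : {y : Circle × ℂ | ‖y.2‖ ≤ R} = Set.univ ×ˢ Metric.closedBall 0 R := by
    ext y
    simp
  rw [closedTube, this]
  exact (isCompact_univ.prod (isCompact_closedBall 0 R)).image τ.isOpenEmbedding.continuous

lemma isOpen_openTube (R : ℝ) : IsOpen (τ.openTube R) :=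
  τ.isOpenEmbedding.isOpenMap _ (isOpen_lt (by fun_prop) continuous_const)

lemma mem_bdry_iff (x : τ.exterior) : x ∈ τ.bdry ↔ (x : S3) ∈ τ.closedTube 1 := by
  constructor
  · rintro ⟨y, hy, hx⟩
    exact ⟨y, hy.le, hx⟩
  · rintro ⟨y, hy, hx⟩
    exact ⟨y, le_antisymm hy (mem_exterior_iff.1 (hx ▸ x.2)), hx⟩

section Push

/-- The extension of `radialMap` by the identity to the sphere, as a function. -/
def pushFun : I × S3 → S3 :=
  Function.extend (Prod.map id τ.toFun) (τ.toFun ∘ radialMap) Prod.snd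

lemma pushFun_apply (s : I) (y : Circle × ℂ) :
    τ.pushFun (s, τ.toFun y) = τ.toFun (radialMap (s, y)) :=
  (Function.injective_id.prodMap τ.injective).extend_apply _ _ (s, y)

lemma pushFun_of_notMem (s : I) {x : S3} (hx : x ∉ Set.range τ.toFun) : τ.pushFun (s, x) = x :=
  Function.extend_apply' _ _ _ fun ⟨z, hz⟩ => hx ⟨z.2, congrArg Prod.snd hz⟩

lemma pushFun_of_notMem_closedTube (s : I) {x : S3} (hx : x ∉ τ.closedTube 2) :
    τ.pushFun (s, x) = x := by
  by_cases h : x ∈ Set.range τ.toFun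
  · obtain ⟨y, rfl⟩ := h
    rw [mem_closedTube_iff, not_le] at hx
    rw [pushFun_apply, radialMap_of_radial_eq_one s (radial_of_two_le hx.le)]
  · exact τ.pushFun_of_notMem s h

lemma continuous_pushFun : Continuous τ.pushFun := by
  rw [continuous_iff_continuousAt]
  rintro ⟨s, x⟩
  by_cases h : x ∈ Set.range τ.toFun
  · obtain ⟨y, rfl⟩ := h
    have hemb : Topology.IsOpenEmbedding (Prod.map (id : I → I) τ.toFun) :=
      .prodMap .id τ.isOpenEmbedding
    have hcomp : τ.pushFun ∘ Prod.map (id : I → I) τ.toFun = τ.toFun ∘ radialMap :=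
      funext fun z => τ.pushFun_apply z.1 z.2
    have hcont : ContinuousAt (τ.pushFun ∘ Prod.map (id : I → I) τ.toFun) (s, y) := by
      rw [hcomp]
      exact (τ.isOpenEmbedding.continuous.comp continuous_radialMap).continuousAt
    exact hemb.continuousAt_iff.1 hcont
  · have hx : x ∈ (τ.closedTube 2)ᶜ := fun ⟨y, _, hy⟩ => h ⟨y, hy⟩
    have hopen := (τ.isCompact_closedTube 2).isClosed.isOpen_compl
    refine continuousAt_snd.congr ?_
    filter_upwards [(hopen.preimage continuous_snd).mem_nhds hx] with z hz
    exact (τ.pushFun_of_notMem_closedTube z.1 hz).symm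

/-- The deformation of the sphere that is `radialMap` on the tubular neighbourhood and fixes its
complement. -/
def push : C(I × S3, S3) := ⟨τ.pushFun, τ.continuous_pushFun⟩

variable {τ} in
lemma push_mem {s : I} {A B : Set S3}
    (hin : ∀ y, τ.toFun y ∈ A → τ.toFun (radialMap (s, y)) ∈ B)
    (hout : ∀ x ∈ A, x ∉ Set.range τ.toFun → x ∈ B) {x : S3} (hx : x ∈ A) : τ.push (s, x) ∈ B := by
  change τ.pushFun (s, x) ∈ B
  by_cases h : x ∈ Set.range τ.toFun
  · obtain ⟨y, rfl⟩ := h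
    rw [pushFun_apply]
    exact hin y hx
  · rw [τ.pushFun_of_notMem s h]
    exact hout x hx h

lemma push_zero (x : S3) : τ.push (0, x) = x :=
  push_mem (A := {x}) (B := {x}) (fun y hy => (radialMap_zero y).symm ▸ hy) (fun _ hx _ => hx) rfl

lemma push_mem_exterior (s : I) {x : S3} (hx : x ∈ τ.exterior) : τ.push (s, x) ∈ τ.exterior :=
  push_mem (fun _ hy => mem_exterior_iff.2 (one_le_norm_radialMap s (mem_exterior_iff.1 hy)))
    (fun _ h _ => h) hx

lemma push_mem_closedTube (s : I) {x : S3} (hx : x ∈ τ.closedTube 1) :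
    τ.push (s, x) ∈ τ.closedTube 1 :=
  push_mem (fun _ hy => mem_closedTube_iff.2 (norm_radialMap_le_one s (mem_closedTube_iff.1 hy)))
    (fun _ h _ => h) hx

lemma push_mem_openTube (s : I) {x : S3} (hx : x ∈ τ.openTube (3 / 2)) :
    τ.push (s, x) ∈ τ.openTube (3 / 2) :=
  push_mem (fun _ hy => mem_openTube_iff.2 (norm_radialMap_lt s (mem_openTube_iff.1 hy)))
    (fun _ h _ => h) hx

lemma push_mem_compl_closedTube (s : I) {x : S3} (hx : x ∈ (τ.closedTube (1 / 2))ᶜ) :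
    τ.push (s, x) ∈ (τ.closedTube (1 / 2))ᶜ := by
  refine push_mem (fun y hy => ?_) (fun _ h _ => h) hx
  rw [Set.mem_compl_iff, mem_closedTube_iff, not_le] at hy ⊢
  exact lt_norm_radialMap s hy

lemma push_one_mem_closedTube {x : S3} (hx : x ∈ τ.openTube (3 / 2)) :
    τ.push (1, x) ∈ τ.closedTube 1 := by
  refine push_mem (fun y hy => ?_) (fun x hx h => absurd (Set.image_subset_range _ _ hx) h) hx
  rw [mem_closedTube_iff, norm_radialMap_one]
  exact radial_mul_le (mem_openTube_iff.1 hy).le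

lemma push_one_mem_exterior {x : S3} (hx : x ∈ (τ.closedTube (1 / 2))ᶜ) :
    τ.push (1, x) ∈ τ.exterior := by
  refine push_mem (B := τ.exterior) (fun y hy => ?_)
    (fun x _ h hx => h (Set.image_subset_range _ _ hx)) hx
  rw [Set.mem_compl_iff, mem_closedTube_iff, not_le] at hy
  rw [mem_exterior_iff, norm_radialMap_one]
  exact le_radial_mul hy.le

/-- The decomposition of the sphere into the knot exterior and a closed solid torus. -/
def collarPair : CollarPair τ.exterior (τ.closedTube 1) where
  retract := ⟨fun x => τ.push (1, x), by fun_prop⟩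
  homotopy := ⟨τ.push, τ.push_zero, fun _ => rfl⟩
  U := (τ.closedTube (1 / 2))ᶜ
  V := τ.openTube (3 / 2)
  isOpen_U := (τ.isCompact_closedTube _).isClosed.isOpen_compl
  isOpen_V := τ.isOpen_openTube _
  union_eq := Set.eq_univ_of_forall fun _ =>
    (em _).symm.imp_right fun hx => τ.closedTube_subset_openTube (by norm_num) hx
  subset_U := Set.compl_subset_compl.2 (τ.closedTube_subset_openTube (by norm_num))
  subset_V := τ.closedTube_subset_openTube (by norm_num)
  homotopy_mem_P _ hx s := τ.push_mem_exterior s hx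
  homotopy_mem_Q _ hx s := τ.push_mem_closedTube s hx
  homotopy_mem_U _ hx s := τ.push_mem_compl_closedTube s hx
  homotopy_mem_V _ hx s := τ.push_mem_openTube s hx
  retract_mem_P _ hx := τ.push_one_mem_exterior hx
  retract_mem_Q _ hx := τ.push_one_mem_closedTube hx

/-- The collar of the boundary of the knot exterior in the tubular neighbourhood. -/
def bdryCollar : BdryCollar τ.bdry where
  retract := ⟨fun x => ⟨τ.push (1, x), τ.push_mem_exterior 1 x.2⟩, by fun_prop⟩
  homotopy := ⟨⟨fun x => ⟨τ.push (x.1, x.2), τ.push_mem_exterior x.1 x.2.2⟩, by fun_prop⟩,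
    fun x => Subtype.ext (τ.push_zero x), fun _ => rfl⟩
  W := Subtype.val ⁻¹' τ.openTube (3 / 2)
  isOpen_W := (τ.isOpen_openTube _).preimage continuous_subtype_val
  subset_W x hx := τ.closedTube_subset_openTube (by norm_num) ((τ.mem_bdry_iff x).1 hx)
  homotopy_eq := by
    rintro x ⟨y, hy, hx⟩ s
    refine Subtype.ext ?_
    change τ.pushFun (s, x) = x
    rw [← hx, pushFun_apply, radialMap_of_norm_eq_one s hy]
  homotopy_mem_W _ hx s := τ.push_mem_openTube s hx
  retract_mem _ hx := (τ.mem_bdry_iff _).2 (τ.push_one_mem_closedTube hx)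

end Push

section Boundary

lemma param_injective : Function.Injective τ.param := by
  intro x y h
  have hxy : ((x.1, (x.2 : ℂ)) : Circle × ℂ) = (y.1, (y.2 : ℂ)) :=
    τ.injective (congrArg (fun z : τ.bdry => ((z : τ.exterior) : S3)) h)
  have ⟨h₁, h₂⟩ := Prod.mk.inj hxy
  exact Prod.ext h₁ (Circle.ext h₂)

lemma param_surjective : Function.Surjective τ.param := by
  rintro ⟨x, y, hy, hx⟩
  exact ⟨(y.1, ⟨y.2, mem_sphere_zero_iff_norm.2 hy⟩), Subtype.ext (Subtype.ext hx)⟩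

/-- The parametrization `TubularNbhd.param` as a homeomorphism. -/
def paramHomeo : Circle × Circle ≃ₜ τ.bdry :=
  Continuous.homeoOfEquivCompactToT2 (f := Equiv.ofBijective τ.param
    ⟨τ.param_injective, τ.param_surjective⟩) τ.param.continuous

lemma isClosed_bdry : IsClosed τ.bdry := by
  have : τ.bdry = Subtype.val ⁻¹' τ.closedTube 1 := Set.ext τ.mem_bdry_iff
  rw [this]
  exact (τ.isCompact_closedTube 1).isClosed.preimage continuous_subtype_val

variable {A : Type*} [AddCommGroup A]

lemma isCoboundaryOn_bdry (n : ℤ) {c : C(I, τ.bdry) → A} (hc : IsCocycleOn Set.univ c)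
    (h₀ : c ((τ.parallel n).comp loop) = 0) (h₁ : c (τ.meridian.comp loop) = 0) :
    IsCoboundaryOn Set.univ c := by
  let ψ : C(Circle × Circle, τ.bdry) := τ.param.comp ⟨fun x => (x.1, x.1 ^ n * x.2), by fun_prop⟩
  have hparallel : ψ.comp (loop.prodMk (.const I 1)) = (τ.parallel n).comp loop := by
    ext t : 1
    simp [ψ, parallel]
  have hmeridian : ψ.comp ((ContinuousMap.const I 1).prodMk loop) = τ.meridian.comp loop := by
    ext t : 1
    simp [ψ, meridian]
  refine .of_section (T := Set.univ) ψ (fun x => ((τ.paramHomeo.symm x).1,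
    ((τ.paramHomeo.symm x).1 ^ n)⁻¹ * (τ.paramHomeo.symm x).2)) (by fun_prop)
    (Set.mapsTo_univ _ _) (fun x _ => ?_) ((hc.comp_univ ψ).isCoboundaryOn_torus ?_ ?_)
  · simp only [ψ, ContinuousMap.comp_apply, ContinuousMap.coe_mk, mul_inv_cancel_left]
    exact τ.paramHomeo.apply_symm_apply x
  · rw [hparallel, h₀]
  · rw [hmeridian, h₁]

end Boundary

section Exterior

/-- The inclusion of the knot exterior in the sphere. -/
def exteriorIncl : C(τ.exterior, S3) := ⟨Subtype.val, continuous_subtype_val⟩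

instance : Nonempty τ.exterior := ⟨τ.param (1, 1)⟩

variable {A : Type*} [AddCommGroup A]

lemma exists_isCocycleOn_sphere {c : C(I, τ.exterior) → A} (hc : IsCocycleOn Set.univ c)
    (hbdry : IsCoboundaryOn Set.univ fun γ => c (τ.incl.comp γ)) :
    ∃ e : C(I, S3) → A, IsCocycleOn Set.univ e ∧
      IsCoboundaryOn Set.univ fun γ => e (τ.exteriorIncl.comp γ) - c γ := by
  obtain ⟨g, hg⟩ := hbdry
  let g' : S3 → A := Function.extend (τ.exteriorIncl ∘ τ.incl) g 0
  have hg' (y : τ.bdry) : g' (y : τ.exterior) = g y :=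
    (Subtype.val_injective.comp Subtype.val_injective).extend_apply g 0 y
  obtain ⟨d, hd, hdc⟩ := hc.exists_range τ.exteriorIncl .subtypeVal
  rw [show Set.range τ.exteriorIncl = τ.exterior from Subtype.range_val] at hd
  obtain ⟨e, he, hed, -⟩ := τ.collarPair.exists_isCocycleOn_univ hd (isCocycleOn_coboundary g' _)
    fun γ hγ => by
      let δ : C(I, τ.bdry) :=
        ⟨fun t => ⟨⟨γ t, (hγ t).1⟩, (τ.mem_bdry_iff _).2 (hγ t).2⟩, by fun_prop⟩
      exact (hdc (τ.incl.comp δ)).trans ((hg δ fun _ => trivial).trans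
        (congrArg₂ (· - ·) (hg' _) (hg' _)).symm)
  refine ⟨e, he, (hed.comp (S := Set.univ) τ.exteriorIncl fun x _ => x.2).congr fun γ _ => ?_⟩
  rw [Pi.sub_apply, hdc]

lemma isCoboundaryOn_exterior (n : ℤ) {c : C(I, τ.exterior) → A} (hc : IsCocycleOn Set.univ c)
    (h₀ : c ((τ.incl.comp (τ.parallel n)).comp loop) = 0)
    (h₁ : c ((τ.incl.comp τ.meridian).comp loop) = 0) : IsCoboundaryOn Set.univ c := by
  obtain ⟨e, he, hec⟩ := τ.exists_isCocycleOn_sphere hc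
    (τ.isCoboundaryOn_bdry n (hc.comp_univ τ.incl) h₀ h₁)
  have hsphere := IsCocycleOn.isCoboundaryOn_sphere (by simp) he
  refine ((hsphere.comp (S := Set.univ) τ.exteriorIncl fun _ _ => trivial).add hec.neg).congr
    fun γ _ => ?_
  simp

end Exterior

section Meridian

/-- The direction of a non-zero complex number, as a point of the circle. -/
def direction (z : ℂ) : Circle := Circle.exp z.arg

lemma coe_direction {z : ℂ} (hz : z ≠ 0) : (direction z : ℂ) = z / ‖z‖ := by
  rw [direction, Circle.coe_exp, eq_div_iff (by simpa using hz), mul_comm,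
    Complex.norm_mul_exp_arg_mul_I]

lemma continuousOn_direction : ContinuousOn direction {0}ᶜ := by
  refine Topology.IsInducing.subtypeVal.continuousOn_iff.2 ?_
  refine ContinuousOn.congr (f := fun z : ℂ => z / ‖z‖) ?_ fun z hz => coe_direction hz
  exact continuousOn_id.div (by fun_prop) fun z hz => by simpa using hz

/-- The angular coordinate around the knot in the tubular neighbourhood. -/
def angle (x : S3) : Circle := direction (Function.invFun τ.toFun x).2

lemma angle_apply (y : Circle × ℂ) : τ.angle (τ.toFun y) = direction y.2 := by
  rw [angle, Function.leftInverse_invFun τ.injective]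

lemma continuousOn_angle : ContinuousOn τ.angle ((Set.range J)ᶜ ∩ Set.range τ.toFun) := by
  refine continuousOn_direction.comp (t := {0}ᶜ) (continuous_snd.comp_continuousOn
    ((continuousOn_invFun τ.isOpenEmbedding.isEmbedding).mono Set.inter_subset_right)) ?_
  rintro _ ⟨hx, y, rfl⟩
  change (Function.invFun τ.toFun (τ.toFun y)).2 ≠ 0
  rw [Function.leftInverse_invFun τ.injective]
  exact mt mem_range_knot_iff.2 hx

lemma exists_isCocycleOn_sub_eq_wind : ∃ c d : C(I, S3) → ℤ,
    IsCocycleOn (Set.range J)ᶜ c ∧ IsCocycleOn (Set.range τ.toFun) d ∧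
      ∀ (γ : C(I, S3)) (δ : C(I, Circle)),
        (∀ t, γ t ∈ (Set.range J)ᶜ ∩ Set.range τ.toFun) → (∀ t, δ t = τ.angle (γ t)) →
        c γ - d γ = wind δ := by
  obtain ⟨w, hw, hwind⟩ := isCocycleOn_wind.exists_pullback τ.continuousOn_angle
    (Set.mapsTo_univ _ _)
  have hcover : (Set.range J)ᶜ ∪ Set.range τ.toFun = Set.univ :=
    Set.eq_univ_of_forall fun _ => (em _).symm.imp_right fun hx => τ.range_knot_subset hx
  obtain ⟨c, d, hc, hd, hcd⟩ := splitsOver_sphere (by simp)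
    (isCompact_range J.continuous).isClosed.isOpen_compl τ.isOpenEmbedding.isOpen_range hcover hw
  rw [Set.univ_inter] at hc hd
  exact ⟨c, d, hc, hd, fun γ δ hγ hδ =>
    (hcd γ fun t => ⟨trivial, hγ t⟩).trans (hwind γ δ hγ hδ)⟩

lemma eq_zero_of_isCocycleOn_range {A : Type*} [AddCommGroup A] {d : C(I, S3) → A}
    (hd : IsCocycleOn (Set.range τ.toFun) d) :
    d (τ.exteriorIncl.comp ((τ.incl.comp τ.meridian).comp loop)) = 0 := by
  let disc : C(ℂ, S3) := ⟨fun z => τ.toFun (1, z), τ.isOpenEmbedding.continuous.comp (by fun_prop)⟩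
  have hdisc := (hd.comp (S := Set.univ) disc fun z _ => ⟨_, rfl⟩).isCoboundaryOn_convex
    convex_univ
  exact hdisc.eq_zero_of_closed (γ := ⟨fun t => (loop t : ℂ), by fun_prop⟩) (fun _ => trivial)
    (congrArg ((↑) : Circle → ℂ) (loop_zero.trans loop_one.symm))

lemma exists_cocycle_meridian : ∃ c : C(I, τ.exterior) → ℤ, IsCocycleOn Set.univ c ∧
    c ((τ.incl.comp τ.meridian).comp loop) = 1 := by
  obtain ⟨c, d, hc, hd, hcd⟩ := τ.exists_isCocycleOn_sub_eq_wind
  refine ⟨_, hc.comp (S := Set.univ) τ.exteriorIncl fun x _ hx => ?_, ?_⟩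
  · obtain ⟨y, hy⟩ := τ.range_knot_subset hx
    have hy' : τ.toFun y ∈ τ.exterior := hy ▸ x.2
    have hy₀ : y.2 = 0 := mem_range_knot_iff.1 (hy ▸ hx)
    rw [mem_exterior_iff, hy₀, norm_zero] at hy'
    exact absurd hy' (by norm_num)
  let γ : C(I, S3) := τ.exteriorIncl.comp ((τ.incl.comp τ.meridian).comp loop)
  have hγ (t : I) : γ t = τ.toFun (1, (loop t : ℂ)) := rfl
  have hmem (t : I) : γ t ∈ (Set.range J)ᶜ ∩ Set.range τ.toFun :=
    ⟨fun h => (loop t).coe_ne_zero (mem_range_knot_iff.1 h), _, rfl⟩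
  have hangle (t : I) : loop t = τ.angle (γ t) := by
    rw [hγ, angle_apply, direction, Circle.exp_arg]
  have hsub := hcd γ loop hmem hangle
  rwa [τ.eq_zero_of_isCocycleOn_range hd, sub_zero, wind_loop] at hsub

end Meridian

end TubularNbhd

/-! ### The first homology of the glued manifold -/

/-- `G` is the abelian group generated by `m` and `a` with the relations `2 p m = 0` and
`s m = 2 a`; the universal property is stated for targets in `Type`. -/
structure IsPresented (G : Type*) [AddCommGroup G] (m a : G) (p s : ℤ) : Prop where
  closure_eq_top : AddSubgroup.closure {m, a} = ⊤
  two_mul_smul_eq_zero : (2 * p) • m = 0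
  smul_eq_two_smul : s • m = (2 : ℤ) • a
  exists_hom : ∀ (A : Type) [AddCommGroup A] (m' a' : A),
    (2 * p) • m' = 0 → s • m' = (2 : ℤ) • a' → ∃ f : G →+ A, f m = m' ∧ f a = a'

namespace IsPresented

variable {G : Type*} [AddCommGroup G] {m a : G} {p s : ℤ}

lemma exists_eq (hG : IsPresented G m a p s) (x : G) : ∃ i j : ℤ, x = i • m + j • a := by
  have hx : x ∈ AddSubgroup.closure {m, a} := hG.closure_eq_top ▸ AddSubgroup.mem_top x
  obtain ⟨i, j, hij⟩ := AddSubgroup.mem_closure_pair.1 hx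
  exact ⟨i, j, hij.symm⟩

lemma addOrderOf_eq (hG : IsPresented G m a p s) : addOrderOf m = (2 * p).natAbs := by
  refine Nat.dvd_antisymm ?_ ?_
  · rw [← Int.natCast_dvd, addOrderOf_dvd_iff_zsmul_eq_zero]
    exact hG.two_mul_smul_eq_zero
  -- The relations hold for `m ↦ 2`, `a ↦ s` modulo `4 p`, where `2` has order `2 |p|`.
  · have hp : ((2 * (2 * p) : ℤ) : ZMod (2 * (2 * p)).natAbs) = 0 :=
      (ZMod.intCast_zmod_eq_zero_iff_dvd _ _).2 (Int.natAbs_dvd.2 dvd_rfl)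
    obtain ⟨f, hf, -⟩ := hG.exists_hom (ZMod (2 * (2 * p)).natAbs) 2 s
      (by rw [zsmul_eq_mul, ← hp]; push_cast; ring) (by simp [mul_comm])
    have horder : ((2 * addOrderOf m : ℤ) : ZMod (2 * (2 * p)).natAbs) = 0 := by
      have hfm : f ((addOrderOf m : ℤ) • m) = 0 := by
        rw [addOrderOf_dvd_iff_zsmul_eq_zero.1 dvd_rfl, map_zero]
      rw [← hfm, map_zsmul, hf, zsmul_eq_mul]
      push_cast
      ring
    rw [ZMod.intCast_zmod_eq_zero_iff_dvd, Int.natAbs_dvd] at horder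
    exact Int.natAbs_dvd_natAbs.2 ((mul_dvd_mul_iff_left two_ne_zero).1 horder)

lemma exists_hom_zmod_two (hG : IsPresented G m a p s) :
    ∃ g : G →+ ZMod 2, Function.Surjective g ∧ g.ker = AddSubgroup.zmultiples m := by
  obtain ⟨g, hgm, hga⟩ := hG.exists_hom (ZMod 2) 0 1 (smul_zero _) ((smul_zero _).trans rfl)
  refine ⟨g, fun y => ?_, le_antisymm (fun x hx => ?_) ?_⟩
  · obtain ⟨j, rfl⟩ := ZMod.intCast_surjective y
    exact ⟨j • a, by rw [map_zsmul, hga, zsmul_one]⟩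
  · obtain ⟨i, j, rfl⟩ := hG.exists_eq x
    rw [AddMonoidHom.mem_ker, map_add, map_zsmul, map_zsmul, hgm, hga, smul_zero, zero_add,
      zsmul_one, ZMod.intCast_zmod_eq_zero_iff_dvd] at hx
    obtain ⟨k, rfl⟩ := hx
    refine AddSubgroup.mem_zmultiples_iff.2 ⟨i + k * s, ?_⟩
    rw [add_smul, mul_smul, hG.smul_eq_two_smul, smul_smul, mul_comm k, Nat.cast_ofNat]
  · rw [AddSubgroup.zmultiples_le, AddMonoidHom.mem_ker, hgm]

lemma card_eq (hG : IsPresented G m a p s) : Nat.card G = 4 * p.natAbs := by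
  obtain ⟨g, hsurj, hker⟩ := hG.exists_hom_zmod_two
  rw [AddSubgroup.card_eq_card_quotient_mul_card_addSubgroup g.ker,
    Nat.card_congr (QuotientAddGroup.quotientKerEquivOfSurjective g hsurj).toEquiv, hker,
    Nat.card_zmultiples, hG.addOrderOf_eq, Nat.card_zmod, Int.natAbs_mul, ← mul_assoc]
  rfl

lemma nonempty_equiv_of_surjective (hG : IsPresented G m a p s) (hp : |p| = 2) {A : Type*}
    [AddCommGroup A] (hA : Nat.card A = 8) (f : G →+ A) (hf : Function.Surjective f) :
    Nonempty (G ≃+ A) := by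
  have hcard : Nat.card G = Nat.card A := by
    rw [Int.abs_eq_natAbs] at hp
    rw [hG.card_eq, hA]
    omega
  have : Finite G := Nat.finite_of_card_ne_zero (by rw [hcard, hA]; norm_num)
  exact ⟨AddEquiv.ofBijective f (hf.bijective_of_nat_card_le hcard.le)⟩

lemma nonempty_equiv_of_even (hG : IsPresented G m a p s) (hp : |p| = 2) (hs : Even s) :
    Nonempty (G ≃+ ZMod 2 × ZMod 4) := by
  obtain ⟨t, rfl⟩ := hs
  obtain ⟨f, hfm, hfa⟩ := hG.exists_hom (ZMod 2 × ZMod 4) (0, 1) (1, t)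
    (by obtain rfl | rfl := eq_or_eq_neg_of_abs_eq hp <;> decide)
    (Prod.ext (by simp [(by decide : (2 : ZMod 2) = 0)]) (by simp [two_mul]))
  refine hG.nonempty_equiv_of_surjective hp (by simp) f ?_
  rintro ⟨x, y⟩
  obtain ⟨j, rfl⟩ := ZMod.intCast_surjective x
  obtain ⟨i, rfl⟩ := ZMod.intCast_surjective y
  refine ⟨j • a + (i - j * t) • m, ?_⟩
  rw [map_add, map_zsmul, map_zsmul, hfm, hfa]
  exact Prod.ext (by simp) (by simp)

lemma nonempty_equiv_of_odd (hG : IsPresented G m a p s) (hp : |p| = 2) (hs : Odd s) :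
    Nonempty (G ≃+ ZMod 8) := by
  obtain ⟨t, rfl⟩ := hs
  obtain ⟨f, hfm, hfa⟩ := hG.exists_hom (ZMod 8) 2 (2 * t + 1 : ℤ)
    (by obtain rfl | rfl := eq_or_eq_neg_of_abs_eq hp <;> decide)
    (by rw [zsmul_eq_mul, zsmul_eq_mul]; push_cast; ring)
  refine hG.nonempty_equiv_of_surjective hp (by simp) f fun y => ?_
  obtain ⟨k, rfl⟩ := ZMod.intCast_surjective y
  refine ⟨k • a + (-(k * t)) • m, ?_⟩
  rw [map_add, map_zsmul, map_zsmul, hfm, hfa, zsmul_eq_mul, zsmul_eq_mul]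
  push_cast
  ring

end IsPresented

section Detection

variable {Y Z : Type} [TopologicalSpace Y] [TopologicalSpace Z]

lemma H1.map_comp (g : C(Y, Z)) {W : Type} [TopologicalSpace W] (f : C(W, Y)) (x : H1 W) :
    H1.map (g.comp f) x = H1.map g (H1.map f x) := by
  rw [H1.map, TopCat.ofHom_comp, CategoryTheory.Functor.map_comp]
  rfl

lemma H1.eq_of_eval_eq {x y : H1 Y} (h : ∀ (A : Type) [AddCommGroup A] (c : C(I, Y) → A)
    (hc : IsCocycleOn Set.univ c), hc.eval x = hc.eval y) : x = y := by
  obtain ⟨e, he, hid⟩ := exists_universalCocycle Y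
  rw [← hid x, ← hid y, h]

lemma H1.closure_eq_top {S : Set (H1 Y)} (hS : ∀ (A : Type) [AddCommGroup A] (c : C(I, Y) → A)
    (hc : IsCocycleOn Set.univ c), (∀ x ∈ S, hc.eval x = 0) → IsCoboundaryOn Set.univ c) :
    AddSubgroup.closure S = ⊤ := by
  obtain ⟨c, hc, heval⟩ := exists_eval_eq (QuotientAddGroup.mk' (AddSubgroup.closure S))
  have hcoboundary := hS _ c hc fun x hx => (heval x).trans
    ((QuotientAddGroup.eq_zero_iff x).2 (AddSubgroup.subset_closure hx))
  exact eq_top_iff.2 fun x _ => (QuotientAddGroup.eq_zero_iff x).1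
    ((heval x).symm.trans (hc.eval_eq_zero hcoboundary x))

lemma IsFundamentalClass.cocycle_eq_smul {u : H1 Circle} (hu : IsFundamentalClass u)
    {f g : C(Circle, Y)} {k : ℤ} (h : H1.map f u = k • H1.map g u) {A : Type} [AddCommGroup A]
    {c : C(I, Y) → A} (hc : IsCocycleOn Set.univ c) : c (f.comp loop) = k • c (g.comp loop) := by
  have heval := congrArg hc.eval h
  rwa [map_zsmul, hc.eval_map_circle, hc.eval_map_circle, smul_comm k, ← sub_eq_zero, ← smul_sub,
    hu.deg_smul_eq_zero_iff, sub_eq_zero] at heval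

end Detection

section Gluing

instance : Nonempty N := ⟨N.pathA 0⟩

variable {J : C(Circle, S3)} {τ : TubularNbhd J} {h : N.bdry ≃ₜ τ.bdry} {u : H1 Circle}
  {n p s : ℤ} {A : Type} [AddCommGroup A]

lemma TubularNbhd.IsLongitude.cocycle_eq_zero (hn : τ.IsLongitude n) (hu : IsFundamentalClass u)
    {c : C(I, τ.exterior) → A} (hc : IsCocycleOn Set.univ c) :
    c ((τ.incl.comp (τ.parallel n)).comp loop) = 0 := by
  have hzero : H1.map (τ.incl.comp (τ.parallel n)) u = 0 := LinearMap.congr_fun hn u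
  rw [hu.cocycle_eq_smul (g := τ.incl.comp (τ.parallel n)) (hzero.trans (zero_smul ℤ _).symm) hc,
    zero_smul]

lemma TubularNbhd.IsLongitude.map_seamLeft (hn : τ.IsLongitude n) {f : C(Circle, N.bdry)} {q : ℤ}
    (hf : bdryMap h (H1.map f u) = q • H1.map (τ.parallel n) u + p • H1.map τ.meridian u) :
    H1.map ((Glue.seamLeft h).comp f) u = p • H1.map (τ.incl.comp τ.meridian) u := by
  have hzero : H1.map τ.incl (H1.map (τ.parallel n) u) = 0 :=
    (H1.map_comp _ _ u).symm.trans (LinearMap.congr_fun hn u)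
  have hincl : H1.map ((Glue.seamLeft h).comp f) u = H1.map τ.incl (bdryMap h (H1.map f u)) :=
    (H1.map_comp (τ.incl.comp ⟨h, h.continuous⟩) f u).trans (H1.map_comp _ _ _)
  rw [hincl, hf, map_add, map_zsmul, map_zsmul, hzero, zsmul_zero, zero_add,
    ← H1.map_comp]

variable (h) in
/-- The meridian as a path in the glued manifold. -/
def meridianPath : C(I, Glue h) := (Glue.inl h).comp ((τ.incl.comp τ.meridian).comp loop)

lemma meridianPath_closed : meridianPath h 0 = meridianPath h 1 := by
  simp [meridianPath]

variable (h) in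
/-- The path `N.pathA` in the glued manifold. -/
def corePath : C(I, Glue h) := (Glue.inr h).comp N.pathA

lemma corePath_closed : corePath h 0 = corePath h 1 := congrArg (Glue.inr h) N.pathA_closed

lemma cocycle_bdry_curve (hu : IsFundamentalClass u) {f : C(Circle, N.bdry)}
    (hf : H1.map ((Glue.seamLeft h).comp f) u = p • H1.map (τ.incl.comp τ.meridian) u)
    {e : C(I, Glue h) → A} (he : IsCocycleOn Set.univ e) :
    e ((Glue.inr h).comp ((N.incl.comp f).comp loop)) = p • e (meridianPath h) := by
  have hcurve := hu.cocycle_eq_smul hf (he.comp_univ (Glue.inl h))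
  rw [← ContinuousMap.comp_assoc, ← ContinuousMap.comp_assoc, Glue.inl_comp_seamLeft] at hcurve
  exact hcurve

section Relations

variable (hu : IsFundamentalClass u)
  (h₀ : H1.map ((Glue.seamLeft h).comp N.phi0) u = p • H1.map (τ.incl.comp τ.meridian) u)
  (h₁ : H1.map ((Glue.seamLeft h).comp N.phi1) u = s • H1.map (τ.incl.comp τ.meridian) u)

include hu

include h₀ in
lemma cocycle_inr_pathB {e : C(I, Glue h) → A} (he : IsCocycleOn Set.univ e) :
    e ((Glue.inr h).comp N.pathB) = p • e (meridianPath h) :=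
  (N.cocycle_phi0 (he.comp_univ (Glue.inr h))).symm.trans (cocycle_bdry_curve hu h₀ he)

include h₁ in
lemma two_smul_cocycle_corePath {e : C(I, Glue h) → A} (he : IsCocycleOn Set.univ e) :
    (2 : ℤ) • e (corePath h) = s • e (meridianPath h) :=
  (N.cocycle_phi1 (he.comp_univ (Glue.inr h))).symm.trans (cocycle_bdry_curve hu h₁ he)

include h₀ in
lemma isCoboundaryOn_glue (hn : τ.IsLongitude n) {e : C(I, Glue h) → A}
    (he : IsCocycleOn Set.univ e) (hm : e (meridianPath h) = 0) (ha : e (corePath h) = 0) :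
    IsCoboundaryOn Set.univ e := by
  have hl := he.comp_univ (Glue.inl h)
  have hr := he.comp_univ (Glue.inr h)
  have hb := cocycle_inr_pathB hu h₀ he
  rw [hm, smul_zero] at hb
  exact Glue.isCoboundaryOn_univ h τ.bdryCollar N.bdryCollar τ.isClosed_bdry N.isClosed_bdry he
    (τ.isCoboundaryOn_exterior n hl (hn.cocycle_eq_zero hu hl) hm)
    (N.isCoboundaryOn_of_paths hr ha hb)

include h₀ h₁ in
lemma exists_cocycle_glue {m a : A} (hm : (2 * p) • m = 0) (ha : s • m = (2 : ℤ) • a) :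
    ∃ e : C(I, Glue h) → A, IsCocycleOn Set.univ e ∧ e (meridianPath h) = m ∧
      e (corePath h) = a := by
  obtain ⟨c, hc, hcm⟩ : ∃ c : C(I, τ.exterior) → A, IsCocycleOn Set.univ c ∧
      c ((τ.incl.comp τ.meridian).comp loop) = m := by
    obtain ⟨c, hc, hcm⟩ := τ.exists_cocycle_meridian
    exact ⟨_, hc.map (zmultiplesHom A m), by rw [hcm, zmultiplesHom_apply, one_smul]⟩
  obtain ⟨d, hd, hda, hdb⟩ := N.exists_cocycle a (β := p • m) (by rw [smul_smul, hm])
  have hcd := N.isCoboundaryOn_bdry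
    ((hc.comp_univ (Glue.seamLeft h)).sub (hd.comp_univ (Glue.seamRight N.bdry)))
    (sub_eq_zero.2 ?_) (sub_eq_zero.2 ?_)
  · obtain ⟨e, he, hel, her⟩ := Glue.exists_cocycle h τ.bdryCollar N.bdryCollar τ.isClosed_bdry
      N.isClosed_bdry hc hd hcd
    refine ⟨e, he, ?_, ?_⟩
    · rw [← hcm]
      exact sub_eq_zero.1 (hel.eq_zero_of_closed (fun _ => trivial) (by simp))
    · rw [← hda]
      exact sub_eq_zero.1 (her.eq_zero_of_closed (fun _ => trivial) N.pathA_closed)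
  · calc c ((Glue.seamLeft h).comp (N.phi0.comp loop)) = p • m :=
          (hu.cocycle_eq_smul h₀ hc).trans (by rw [hcm])
      _ = d ((N.incl.comp N.phi0).comp loop) := by rw [N.cocycle_phi0 hd, hdb]
  · calc c ((Glue.seamLeft h).comp (N.phi1.comp loop)) = s • m :=
          (hu.cocycle_eq_smul h₁ hc).trans (by rw [hcm])
      _ = d ((N.incl.comp N.phi1).comp loop) := by rw [N.cocycle_phi1 hd, hda, ha]

include h₀ h₁ in
theorem isPresented_H1_glue (hn : τ.IsLongitude n) :
    IsPresented (H1 (Glue h)) (loopClass (meridianPath h) meridianPath_closed)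
      (loopClass (corePath h) corePath_closed) p s where
  closure_eq_top := H1.closure_eq_top fun A _ c hc hzero =>
    isCoboundaryOn_glue hu h₀ hn hc (by simpa using hzero _ (Set.mem_insert _ _))
      (by simpa using hzero _ (Set.mem_insert_of_mem _ rfl))
  two_mul_smul_eq_zero := H1.eq_of_eval_eq fun A _ c hc => by
    rw [map_zsmul, hc.eval_loopClass, mul_smul, ← cocycle_inr_pathB hu h₀ hc, map_zero]
    exact N.two_smul_cocycle_pathB (hc.comp_univ (Glue.inr h))
  smul_eq_two_smul := H1.eq_of_eval_eq fun A _ c hc => by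
    rw [map_zsmul, map_zsmul, hc.eval_loopClass, hc.eval_loopClass,
      two_smul_cocycle_corePath hu h₁ hc]
  exists_hom A _ m a hm ha := by
    obtain ⟨e, he, hem, hea⟩ := exists_cocycle_glue hu h₀ h₁ hm ha
    exact ⟨he.eval, by rw [he.eval_loopClass, hem], by rw [he.eval_loopClass, hea]⟩

end Relations

end Gluing

end KleinGluing

end

theorem mainTheorem9
    (J : C(Circle, KleinGluing.S3)) (τ : KleinGluing.TubularNbhd J)
    (h : KleinGluing.N.bdry ≃ₜ τ.bdry)
    (u : KleinGluing.H1 Circle) (hu : KleinGluing.IsFundamentalClass u)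
    (n : ℤ) (hn : τ.IsLongitude n)
    (q r p s : ℤ)
    (h0 : KleinGluing.bdryMap h (KleinGluing.H1.map KleinGluing.N.phi0 u) =
      q • KleinGluing.H1.map (τ.parallel n) u + p • KleinGluing.H1.map τ.meridian u)
    (h1 : KleinGluing.bdryMap h (KleinGluing.H1.map KleinGluing.N.phi1 u) =
      r • KleinGluing.H1.map (τ.parallel n) u + s • KleinGluing.H1.map τ.meridian u) :
    (Nat.card (KleinGluing.H1 (KleinGluing.Glue h)) = 8 ↔ |p| = 2) ∧
    (|p| = 2 → Even s →
      Nonempty (KleinGluing.H1 (KleinGluing.Glue h) ≃+ ZMod 2 × ZMod 4)) ∧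
    (|p| = 2 → Odd s →
      Nonempty (KleinGluing.H1 (KleinGluing.Glue h) ≃+ ZMod 8)) := by
  have hG := KleinGluing.isPresented_H1_glue hu (hn.map_seamLeft h0) (hn.map_seamLeft h1) hn
  refine ⟨?_, hG.nonempty_equiv_of_even, hG.nonempty_equiv_of_odd⟩
  rw [hG.card_eq, Int.abs_eq_natAbs]
  omega
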